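/- Let $\ell\in\mathbb N_0$. There is a constant $C>0$ depending only on $\ell$ such that the following holds. **Setting.** Let $d\in\{2,3\}$, let $\Omega\subset\mathbb R^d$ be a bounded open set with $\Omega=\operatorname{int}\overline\Omega$ (e.g. a bounded Lipschitz polytope), $T>0$, $\nu>0$, $k\ge 1$. Let $\mathcal T_h$ be a conforming simplicial mesh of $\Omega$ with shape-regularity parameter $\rho$: every $K\in\mathcal T_h$ contains a ball of diameter $\rho_K>0$ with $\operatorname{diam}K\le\rho\,\rho_K$. Its facets are $\mathcal F_h$, its interior facets $\mathcal F_{h,\circ}$, its boundary facets $\mathcal F_{h,\mathcal D}$. For a facet $F$ let $h_F$ be its diameter and $\mathbf n_F$ a unit normal to $F$ (outward on the boundary). On an interior facet $F=\partial K_+\cap\partial K_-$, with $\mathbf n_F$ pointing out of $K_+$, put $[\![v]\!]=v|_{K_+}-v|_{K_-}$ and $\{\!\{v\}\!\}=\frac12(v|_{K_+}+v|_{K_-})$; on a boundary facet $[\![v]\!]=\{\!\{v\}\!\}=v$. Let $0=t_0<t_1<\dots<t_N=T$, $I_n=(t_{n-1},t_n)$, and let $[\![z]\!]_n=z(\cdot,t_n^-)-z(\cdot,t_n^+)$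 be the time jumps. Let $V_h\subset H(\operatorname{div},\Omega)$ be either the Raviart–Thomas space of order $k$ (locally $\mathbb P_k^d+x\,\mathbb P_k$) or the Brezzi–Douglas–Marini space of order $k$ (locally $\mathbb P_k^d$) on $\mathcal T_h$: piecewise polynomial fields of the given local form whose normal components are single-valued on the interior facets. Let $V_{h\tau}$ be the space of functions whose restriction to each $\Omega\times I_n$ lies in $\mathbb P_\ell(I_n)\otimes V_h$ and whose normal component vanishes on $\partial\Omega$, and $Z_{h\tau}=\{v\in V_{h\tau}:\operatorname{div}v=0\}$. On each $I_n$ let $\mathsf Q^{(n)}$ be the left-sided Gauss–Radau quadrature rule with $\ell+1$ nodes ($t_{n-1}$ is a node; exact on $\mathbb P_{2\ell}$), $\mathsf Q=\sum_n\mathsf Q^{(n)}$, and let $\mathcal I$ be the slabwise Lagrange interpolation in time at its nodes. For $c_S>0$ and $w\in Z_{h\tau}$ let $\gamma_F(w)=\max\{c_S,\|w\cdot\mathbf n_F\|_{L^\infty(F)}\}$ (a function of time). Define $$m(u,v)=\sum_{n=1}^N\int_{I_n}(\partial_t u,v)_\Omega\,dt-\sum_{n=1}^{N-1}([\![u]\!]_n,v(\cdot,t_n^+))_\Omega+(u(\cdot,0),v(\cdot,0))_\Omega,$$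 $$a(u,v)=\sum_{n=1}^N\int_{I_n}\Big[(\nabla_h u,\nabla_h v)_\Omega+\sum_{F\in\mathcal F_h}\int_F\big(-\{\!\{\nabla_h u\}\!\}\mathbf n_F\cdot[\![v]\!]-[\![u]\!]\cdot\{\!\{\nabla_h v\}\!\}\mathbf n_F+\sigma h_F^{-1}[\![u]\!]\cdot[\![v]\!]\big)dS\Big]dt,$$ $$c(w;u,v)=\sum_{n=1}^N\int_{I_n}\Big[(\mathcal I((\nabla_h u)w),v)_\Omega+\sum_{F\in\mathcal F_{h,\circ}}\int_F\big(-\mathcal I((w\cdot\mathbf n_F)[\![u]\!])\cdot\{\!\{v\}\!\}+\tfrac12\mathcal I(\gamma_F(w)[\![u]\!])\cdot[\![v]\!]\big)dS\Big]dt.$$ **Statement.** There is $\sigma_0>0$, depending only on $d$, $k$, the choice of element family and $\rho$, such that whenever $\sigma\ge\sigma_0$, the following holds for all $\Omega$, $T$, $\nu$, $c_S$, all such meshes and time partitions, all $f\in L^1(0,T;L^2(\Omega)^d)$, $u_0\in L^2(\Omega)^d$ and $w\in Z_{h\tau}$. Every $u\in Z_{h\tau}$ with $$m(u,z)+\nu\,a(u,z)+c(w;u,z)=\int_0^T(f,z)_\Omega\,dt+(u_0,z(\cdot,0))_\Omega\qquad\text{for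 all }z\in Z_{h\tau}$$ satisfies $$|||u|||_w^2\le C\big(\|f\|_{L^1(0,T;L^2(\Omega)^d)}^2+\|u_0\|_{L^2(\Omega)^d}^2\big),$$ where $$\begin{aligned}|||u|||_w^2={}&\|u\|_{L^\infty(0,T;L^2(\Omega)^d)}^2+\nu\int_0^T\Big(\|\nabla_h u\|_{L^2(\Omega)}^2+\sum_{F\in\mathcal F_h}\sigma h_F^{-1}\|[\![u]\!]\|_{L^2(F)}^2\Big)dt\\&+\tfrac12\Big(\|u(\cdot,T)\|_{L^2}^2+\sum_{n=1}^{N-1}\|[\![u]\!]_n\|_{L^2}^2+\|u(\cdot,0)\|_{L^2}^2\Big)+\tfrac12\sum_{F\in\mathcal F_{h,\circ}}\mathsf Q\big(\gamma_F(w)\|[\![u]\!]\|_{L^2(F)}^2\big).\end{aligned}$$ In particular $C$ does not depend on the meshes, $T$, $\nu$, $\sigma$, $c_S$, $k$, $d$ or $w$. -/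

import Mathlib

open MeasureTheory Polynomial

namespace OseenDG

/-! ## Left-sided Gauss-Radau quadrature on the reference interval -/

/-- `x`, `ω` are the nodes (in increasing order) and weights of the left-sided Gauss-Radau rule with
`ℓ + 1` points on `[0, 1]`: the left end point is a node, the other nodes lie inside the interval,
the weights are positive, and the rule is exact for polynomials of degree at most `2ℓ`. -/
structure IsLeftGaussRadau (ℓ : ℕ) (x ω : Fin (ℓ + 1) → ℝ) : Prop where
  strictMono : StrictMono x
  first : x 0 = 0
  lt_one : ∀ i, x i < 1
  weight_pos : ∀ i, 0 < ω i
  exact_of_le : ∀ p : ℝ[X], p.natDegree ≤ 2 * ℓ →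
    ∑ i, ω i * p.eval (x i) = ∫ s in (0 : ℝ)..1, p.eval s

theorem rolle_finset (p : ℝ[X]) (m : ℕ) (T : Finset ℝ) (hT : T.card = m + 1)
    (hT01 : ∀ x ∈ T, 0 ≤ x ∧ x ≤ 1) (hroot : ∀ x ∈ T, p.eval x = 0) :
    ∃ S : Finset ℝ, S.card = m ∧ (∀ x ∈ S, 0 < x ∧ x < 1) ∧
      ∀ x ∈ S, (derivative p).eval x = 0 := by
  let e := T.orderEmbOfFin hT
  have he : ∀ i, e i ∈ T := fun i => T.orderEmbOfFin_mem hT i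
  have h : ∀ i : Fin m, ∃ c, e i.castSucc < c ∧ c < e i.succ ∧ (derivative p).eval c = 0 := by
    intro i
    obtain ⟨c, hc, h0⟩ := exists_hasDerivAt_eq_zero (f := fun x => p.eval x)
      (f' := fun x => (derivative p).eval x)
      (e.strictMono (Fin.castSucc_lt_succ (i := i))) p.continuousOn
      (by simp [hroot _ (he _)]) (fun x _ => p.hasDerivAt x)
    exact ⟨c, hc.1, hc.2, h0⟩
  choose c h1 h2 h3 using h
  have hc : StrictMono c := by
    intro i j hij
    have : e i.succ ≤ e j.castSucc := e.monotone (by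
      rw [Fin.le_def]; simpa using hij)
    exact (h2 i).trans_le (this.trans (h1 j).le)
  refine ⟨Finset.univ.map ⟨c, hc.injective⟩, by simp, ?_, ?_⟩
  · intro x hx
    simp only [Finset.mem_map, Finset.mem_univ, true_and, Function.Embedding.coeFn_mk] at hx
    obtain ⟨i, rfl⟩ := hx
    exact ⟨(hT01 _ (he _)).1.trans_lt (h1 i), (h2 i).trans_le (hT01 _ (he _)).2⟩
  · intro x hx
    simp only [Finset.mem_map, Finset.mem_univ, true_and, Function.Embedding.coeFn_mk] at hx
    obtain ⟨i, rfl⟩ := hx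
    exact h3 i

/-- The `j`-th derivative of `X^(ℓ+1) (X-1)^ℓ`; for `j = ℓ` its roots are the Radau nodes. -/
noncomputable def radauAux (ℓ j : ℕ) : ℝ[X] := derivative^[j] (X ^ (ℓ + 1) * (X - C 1) ^ ℓ)

theorem radauAux_succ (ℓ j : ℕ) : radauAux ℓ (j + 1) = derivative (radauAux ℓ j) := by
  simp only [radauAux, Function.iterate_succ_apply']

theorem radauAux_zero_left (ℓ j : ℕ) (hj : j ≤ ℓ) : (radauAux ℓ j).eval 0 = 0 := by
  have h : X ^ (ℓ + 1 - j) ∣ radauAux ℓ j :=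
    pow_sub_dvd_iterate_derivative_of_pow_dvd j (Dvd.intro _ rfl)
  have h' : (X : ℝ[X]) ∣ radauAux ℓ j := (dvd_pow_self X (by omega)).trans h
  obtain ⟨q, hq⟩ := h'
  simp [hq]

theorem radauAux_zero_right (ℓ j : ℕ) (hj : j < ℓ) : (radauAux ℓ j).eval 1 = 0 := by
  have h : (X - C 1) ^ (ℓ - j) ∣ radauAux ℓ j :=
    pow_sub_dvd_iterate_derivative_of_pow_dvd j (Dvd.intro_left _ rfl)
  have h' : (X - C 1 : ℝ[X]) ∣ radauAux ℓ j := (dvd_pow_self _ (by omega)).trans h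
  obtain ⟨q, hq⟩ := h'
  simp [hq]

theorem radauAux_roots (ℓ j : ℕ) (hj : j ≤ ℓ) :
    ∃ S : Finset ℝ, S.card = j ∧ (∀ x ∈ S, 0 < x ∧ x < 1) ∧
      ∀ x ∈ S, (radauAux ℓ j).eval x = 0 := by
  induction j with
  | zero => exact ⟨∅, by simp⟩
  | succ j ih =>
    obtain ⟨S, hS, h01, hr⟩ := ih (by omega)
    rw [radauAux_succ]
    apply rolle_finset _ _ (insert 0 (insert 1 S))
    · rw [Finset.card_insert_of_notMem, Finset.card_insert_of_notMem, hS]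
      · intro h; exact absurd (h01 _ h).2 (lt_irrefl _)
      · intro h
        rcases Finset.mem_insert.1 h with h | h
        · exact zero_ne_one h
        · exact absurd (h01 _ h).1 (lt_irrefl _)
    · intro x hx
      rcases Finset.mem_insert.1 hx with rfl | hx
      · simp
      rcases Finset.mem_insert.1 hx with rfl | hx
      · simp
      exact ⟨(h01 x hx).1.le, (h01 x hx).2.le⟩
    · intro x hx
      rcases Finset.mem_insert.1 hx with rfl | hx
      · exact radauAux_zero_left ℓ j (by omega)
      rcases Finset.mem_insert.1 hx with rfl | hx
      · exact radauAux_zero_right ℓ j (by omega)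
      exact hr x hx

theorem radauAux_orthogonal (ℓ j : ℕ) (hj : j ≤ ℓ) (q : ℝ[X]) (hq : derivative^[j] q = 0) :
    ∫ s in (0 : ℝ)..1, (radauAux ℓ j).eval s * q.eval s = 0 := by
  induction j generalizing q with
  | zero => simp at hq; simp [hq]
  | succ j ih =>
    have h := intervalIntegral.integral_mul_deriv_eq_deriv_mul (a := 0) (b := 1)
      (u := fun s => q.eval s) (v := fun s => (radauAux ℓ j).eval s)
      (u' := fun s => (derivative q).eval s) (v' := fun s => (derivative (radauAux ℓ j)).eval s)
      (fun x _ => q.hasDerivAt x) (fun x _ => (radauAux ℓ j).hasDerivAt x)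
      ((derivative q).continuous.intervalIntegrable _ _)
      ((derivative (radauAux ℓ j)).continuous.intervalIntegrable _ _)
    have h2 := ih (by omega) (derivative q) (by rwa [Function.iterate_succ_apply] at hq)
    rw [radauAux_zero_left ℓ j (by omega), radauAux_zero_right ℓ j (by omega)] at h
    simp only [radauAux_succ]
    simp only [mul_comm] at h h2 ⊢
    rw [h, h2]; simp

theorem radauAux_natDegree (ℓ : ℕ) : (radauAux ℓ ℓ).natDegree = ℓ + 1 := by
  have h0 : (X ^ (ℓ + 1) * (X - C 1) ^ ℓ : ℝ[X]).Monic :=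
    (monic_X_pow _).mul ((monic_X_sub_C 1).pow _)
  have h1 : (X ^ (ℓ + 1) * (X - C 1) ^ ℓ : ℝ[X]).natDegree = 2 * ℓ + 1 := by
    rw [(monic_X_pow _).natDegree_mul ((monic_X_sub_C 1).pow _), natDegree_X_pow,
      (monic_X_sub_C 1).natDegree_pow, natDegree_X_sub_C]; ring
  apply le_antisymm
  · refine (natDegree_iterate_derivative _ _).trans ?_
    rw [h1]; omega
  · apply le_natDegree_of_ne_zero
    rw [radauAux, coeff_iterate_derivative]
    have : ℓ + 1 + ℓ = (X ^ (ℓ + 1) * (X - C 1) ^ ℓ : ℝ[X]).natDegree := by rw [h1]; ring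
    rw [this, Monic.coeff_natDegree h0, h1]
    have : 0 < (2 * ℓ + 1).descFactorial ℓ := Nat.descFactorial_pos.2 (by omega)
    simpa using this.ne'

theorem exists_isLeftGaussRadau (ℓ : ℕ) :
    ∃ r : (Fin (ℓ + 1) → ℝ) × (Fin (ℓ + 1) → ℝ), IsLeftGaussRadau ℓ r.1 r.2 := by
  obtain ⟨S, hS, h01, hr⟩ := radauAux_roots ℓ ℓ le_rfl
  have h0S : (0 : ℝ) ∉ S := fun h => absurd (h01 _ h).1 (lt_irrefl _)
  have hT : (insert 0 S).card = ℓ + 1 := by rw [Finset.card_insert_of_notMem h0S, hS]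
  let x := (insert 0 S).orderEmbOfFin hT
  have hx : ∀ i, x i ∈ insert 0 S := fun i => Finset.orderEmbOfFin_mem _ hT i
  have hx01 : ∀ i, 0 ≤ x i ∧ x i < 1 := by
    intro i
    rcases Finset.mem_insert.1 (hx i) with h | h
    · simp [h]
    · exact ⟨(h01 _ h).1.le, (h01 _ h).2⟩
  have hxr : ∀ i, (radauAux ℓ ℓ).eval (x i) = 0 := by
    intro i
    rcases Finset.mem_insert.1 (hx i) with h | h
    · rw [h]; exact radauAux_zero_left ℓ ℓ le_rfl
    · exact hr _ h
  have hinj : Set.InjOn x (Finset.univ : Finset (Fin (ℓ + 1))) := x.injective.injOn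
  let b : Fin (ℓ + 1) → ℝ[X] := fun i => Lagrange.basis Finset.univ x i
  let ω : Fin (ℓ + 1) → ℝ := fun i => ∫ s in (0 : ℝ)..1, (b i).eval s
  have hint : ∀ p : ℝ[X], IntervalIntegrable (fun s => p.eval s) MeasureTheory.volume 0 1 :=
    fun p => p.continuous.intervalIntegrable _ _
  have hlow : ∀ p : ℝ[X], p.degree < (ℓ + 1 : ℕ) →
      ∑ i, ω i * p.eval (x i) = ∫ s in (0 : ℝ)..1, p.eval s := by
    intro p hp
    have h := Lagrange.eq_interpolate (s := Finset.univ) (v := x) (f := p) hinj (by simpa using hp)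
    conv_rhs => rw [h]
    simp only [Lagrange.interpolate_apply, eval_finsetSum, eval_mul, eval_C]
    rw [intervalIntegral.integral_finsetSum]
    · refine Finset.sum_congr rfl fun i _ => ?_
      rw [intervalIntegral.integral_const_mul, mul_comm]
    · intro i _
      exact (hint _).const_mul _
  have hR : (radauAux ℓ ℓ) ≠ 0 := by
    intro h; have := radauAux_natDegree ℓ; simp [h] at this
  have hRd : (radauAux ℓ ℓ).degree = (ℓ + 1 : ℕ) := by
    rw [degree_eq_natDegree hR, radauAux_natDegree]
  have hexact : ∀ p : ℝ[X], p.natDegree ≤ 2 * ℓ →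
      ∑ i, ω i * p.eval (x i) = ∫ s in (0 : ℝ)..1, p.eval s := by
    intro p hp
    have hdm := EuclideanDomain.div_add_mod p (radauAux ℓ ℓ)
    have hq : derivative^[ℓ] (p / radauAux ℓ ℓ) = 0 := by
      by_cases hlt : p.degree < (radauAux ℓ ℓ).degree
      · rw [(Polynomial.div_eq_zero_iff hR).2 hlt]; simp
      · apply iterate_derivative_eq_zero
        have h3 := degree_add_div hR (not_lt.1 hlt)
        have hq0 : p / radauAux ℓ ℓ ≠ 0 := fun h => hlt ((Polynomial.div_eq_zero_iff hR).1 h)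
        have hp0 : p ≠ 0 := by rintro rfl; simp at hq0
        rw [hRd, degree_eq_natDegree hq0, degree_eq_natDegree hp0] at h3
        have : ℓ + 1 + (p / radauAux ℓ ℓ).natDegree = p.natDegree := by exact_mod_cast h3
        omega
    have hort := radauAux_orthogonal ℓ ℓ le_rfl _ hq
    have hmod := hlow (p % radauAux ℓ ℓ) (by rw [← hRd]; exact degree_mod_lt p hR)
    have e1 : ∀ s, p.eval s = (radauAux ℓ ℓ).eval s * (p / radauAux ℓ ℓ).eval s
        + (p % radauAux ℓ ℓ).eval s := by
      intro s; conv_lhs => rw [← hdm]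
      simp
    have e2 : ∀ i, p.eval (x i) = (p % radauAux ℓ ℓ).eval (x i) := by
      intro i; rw [e1, hxr]; simp
    simp only [e2]
    rw [hmod]
    conv_rhs => simp only [e1]
    rw [intervalIntegral.integral_add, hort, zero_add]
    · simpa using hint (radauAux ℓ ℓ * (p / radauAux ℓ ℓ))
    · exact hint _
  refine ⟨⟨x, ω⟩, x.strictMono, ?_, fun i => (hx01 i).2, ?_, hexact⟩
  · have : (0 : ℝ) ∈ Set.range x := by
      rw [Finset.range_orderEmbOfFin]; simp
    obtain ⟨i, hi⟩ := this
    exact le_antisymm (hi ▸ x.monotone (Fin.zero_le i)) (hx01 0).1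
  · intro i
    have hd : (b i).natDegree = ℓ := by
      simp only [b]; rw [Lagrange.natDegree_basis hinj (Finset.mem_univ i)]; simp
    have hb : ∀ j, (b i).eval (x j) = if j = i then 1 else 0 := by
      intro j
      split_ifs with h
      · rw [h]; exact Lagrange.eval_basis_self hinj (Finset.mem_univ i)
      · exact Lagrange.eval_basis_of_ne (Ne.symm h) (Finset.mem_univ j)
    have h2 := hexact (b i ^ 2) (by rw [natDegree_pow, hd])
    have h3 : ∑ j, ω j * (b i ^ 2).eval (x j) = ω i := by
      simp [hb]
    have h4 : ω i = ∫ s in (0 : ℝ)..1, (b i ^ 2).eval s := by rw [← h2, h3]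
    show 0 < ω i
    rw [h4]
    refine intervalIntegral.integral_pos one_pos (b i ^ 2).continuousOn
      (fun s _ => by simp only [eval_pow]; positivity)
      ⟨x i, ⟨(hx01 i).1, (hx01 i).2.le⟩, by simp [hb]⟩

/-- Nodes of the left-sided Gauss-Radau rule with `ℓ + 1` points on `[0, 1]`. -/
noncomputable def radauNode (ℓ : ℕ) : Fin (ℓ + 1) → ℝ := (exists_isLeftGaussRadau ℓ).choose.1

/-- Weights of the left-sided Gauss-Radau rule with `ℓ + 1` points on `[0, 1]`. -/
noncomputable def radauWeight (ℓ : ℕ) : Fin (ℓ + 1) → ℝ := (exists_isLeftGaussRadau ℓ).choose.2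

theorem isLeftGaussRadau_radau (ℓ : ℕ) : IsLeftGaussRadau ℓ (radauNode ℓ) (radauWeight ℓ) :=
  (exists_isLeftGaussRadau ℓ).choose_spec

/-! ## Polynomial vector fields -/

/-- Points and vectors of `ℝ^d`, with the Euclidean norm. -/
abbrev Pt (d : ℕ) := EuclideanSpace ℝ (Fin d)

/-- Vector fields on `ℝ^d` with polynomial components. -/
abbrev PolyField (d : ℕ) := Fin d → MvPolynomial (Fin d) ℝ

/-- The value of a polynomial vector field at a point. -/
noncomputable def val {d : ℕ} (p : PolyField d) (x : Pt d) : Pt d :=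
  WithLp.toLp 2 fun i => MvPolynomial.eval (fun j => x j) (p i)

/-- The gradient of a vector field: the matrix whose rows are the gradients of the components. -/
noncomputable def grad {d : ℕ} (p : PolyField d) (x : Pt d) : Matrix (Fin d) (Fin d) ℝ :=
  Matrix.of fun i j => MvPolynomial.eval (fun m => x m) (MvPolynomial.pderiv j (p i))

/-- The divergence of a polynomial vector field. -/
noncomputable def divergence {d : ℕ} (p : PolyField d) : MvPolynomial (Fin d) ℝ :=
  ∑ i, MvPolynomial.pderiv i (p i)

/-- Matrix times vector, as a vector of Euclidean space. -/
noncomputable def matVec {d : ℕ} (A : Matrix (Fin d) (Fin d) ℝ) (x : Pt d) : Pt d :=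
  WithLp.toLp 2 fun i => ∑ j, A i j * x j

/-! ## Simplicial meshes -/

/-- A conforming simplicial mesh in `ℝ^d`. An element is given by its `d + 1` vertices, and two
elements meet at most in the face spanned by their common vertices. -/
structure SimplicialMesh (d : ℕ) where
  elems : Finset (Finset (Pt d))
  card_eq : ∀ K ∈ elems, K.card = d + 1
  indep : ∀ K ∈ elems, AffineIndependent ℝ (fun x : K => (x : Pt d))
  conforming : ∀ K ∈ elems, ∀ L ∈ elems,
    convexHull ℝ (K : Set (Pt d)) ∩ convexHull ℝ (L : Set (Pt d)) ⊆
      convexHull ℝ ((K : Set (Pt d)) ∩ (L : Set (Pt d)))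

/-- `M` is a mesh of the open set `Ω`. A bounded Lipschitz domain is the interior of its closure;
no other consequence of the Lipschitz property is used. -/
structure SimplicialMesh.IsMeshOf {d : ℕ} (M : SimplicialMesh d) (Ω : Set (Pt d)) : Prop where
  isOpen : IsOpen Ω
  interior_closure : interior (closure Ω) = Ω
  closure_eq : closure Ω = ⋃ K ∈ M.elems, convexHull ℝ (K : Set (Pt d))

/-- Shape regularity with parameter `ρ`: every element `K` contains a ball whose diameter `2r`
satisfies `h_K ≤ ρ (2r)`. -/
def SimplicialMesh.ShapeRegular {d : ℕ} (M : SimplicialMesh d) (ρ : ℝ) : Prop :=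
  ∀ K ∈ M.elems, ∃ (x : Pt d) (r : ℝ), 0 < r ∧
    Metric.closedBall x r ⊆ convexHull ℝ (K : Set (Pt d)) ∧
    Metric.diam (convexHull ℝ (K : Set (Pt d))) ≤ ρ * (2 * r)

open Classical in
/-- The facets of a mesh, each given by its `d` vertices. -/
noncomputable def SimplicialMesh.facets {d : ℕ} (M : SimplicialMesh d) : Finset (Finset (Pt d)) :=
  M.elems.biUnion fun K => K.powersetCard d

/-- `F` is shared by two elements. -/
def SimplicialMesh.IsShared {d : ℕ} (M : SimplicialMesh d) (F : Finset (Pt d)) : Prop :=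
  ∃ K ∈ M.elems, ∃ L ∈ M.elems, K ≠ L ∧ F ⊆ K ∧ F ⊆ L

open Classical in
/-- The interior facets: those shared by two elements. -/
noncomputable def SimplicialMesh.interiorFacets {d : ℕ} (M : SimplicialMesh d) :
    Finset (Finset (Pt d)) :=
  M.facets.filter fun F => M.IsShared F

open Classical in
/-- The boundary facets: those that belong to one element only. -/
noncomputable def SimplicialMesh.boundaryFacets {d : ℕ} (M : SimplicialMesh d) :
    Finset (Finset (Pt d)) :=
  M.facets.filter fun F => ¬ M.IsShared F

/-- The choice, for each facet `F`, of one of the two unit normals `n_F`. The element `K₊ = plus F`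
is the one out of which `n_F` points, and on an interior facet `K₋ = minus F` is the other element.
On a boundary facet `plus F` is the only element that contains `F`, so that `n_F` points outwards
of the domain. -/
structure FacetOrientation {d : ℕ} (M : SimplicialMesh d) where
  normal : Finset (Pt d) → Pt d
  plus : Finset (Pt d) → Finset (Pt d)
  minus : Finset (Pt d) → Finset (Pt d)
  plus_mem : ∀ F ∈ M.facets, plus F ∈ M.elems ∧ F ⊆ plus F
  minus_mem : ∀ F ∈ M.interiorFacets, minus F ∈ M.elems ∧ F ⊆ minus F ∧ minus F ≠ plus F
  normal_norm : ∀ F ∈ M.facets, ‖normal F‖ = 1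
  normal_orth : ∀ F ∈ M.facets, ∀ x ∈ F, ∀ y ∈ F, inner ℝ (x - y) (normal F) = 0
  normal_outward : ∀ F ∈ M.facets, ∀ x ∈ F, ∀ z ∈ plus F, z ∉ F → inner ℝ (z - x) (normal F) < 0

/-- A mesh in space together with a partition `0 = t_0 < t_1 < ... < t_N = T` of the time interval.
The values `t n` for `n > N` play no role. The time slab number `n < N` is `(t n, t (n + 1))`. -/
structure SpaceTimeMesh (d : ℕ) (T : ℝ) where
  mesh : SimplicialMesh d
  orient : FacetOrientation mesh
  N : ℕ
  t : ℕ → ℝ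
  t_zero : t 0 = 0
  t_last : t N = T
  t_lt : ∀ n < N, t n < t (n + 1)

/-! ## Discrete functions -/

/-- Piecewise polynomial vector fields: `v K` is the polynomial field on the element `K`.
The values of `v` outside the elements of the mesh play no role. -/
abbrev BrokenField (d : ℕ) := Finset (Pt d) → PolyField d

/-- Piecewise-in-time functions: `u n s` is the field at time `s` of (the polynomial extension of)
the function on the slab number `n`. Thus `u(t_n^-)` is `u (n - 1) (t n)` and `u(t_n^+)` is
`u n (t n)`. The values for `n ≥ N` play no role. -/
abbrev SpaceTimeField (d : ℕ) := ℕ → ℝ → BrokenField d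

/-- The two families of `H(div)`-conforming elements. -/
inductive VelocityFamily
  | RT
  | BDM

/-- The local polynomial spaces of order `k`: `P_k^d + x P_k` (Raviart-Thomas) and `P_k^d`
(Brezzi-Douglas-Marini). -/
def IsLocalVelocity {d : ℕ} (fam : VelocityFamily) (k : ℕ) (p : PolyField d) : Prop :=
  match fam with
  | .RT => ∃ (q : PolyField d) (r : MvPolynomial (Fin d) ℝ),
      (∀ i, (q i).totalDegree ≤ k) ∧ r.totalDegree ≤ k ∧ ∀ i, p i = q i + MvPolynomial.X i * r
  | .BDM => ∀ i, (p i).totalDegree ≤ k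

/-- The space `V_h`, that is `RT_k` or `BDM_k` on the mesh: the local spaces on the elements, and
a single-valued normal component on the interior facets. -/
def velocitySpace {d : ℕ} {M : SimplicialMesh d} (O : FacetOrientation M) (fam : VelocityFamily)
    (k : ℕ) : Set (BrokenField d) :=
  {v | (∀ K ∈ M.elems, IsLocalVelocity fam k (v K)) ∧
    ∀ F ∈ M.interiorFacets, ∀ x ∈ convexHull ℝ (F : Set (Pt d)),
      inner ℝ (val (v (O.plus F)) x) (O.normal F) = inner ℝ (val (v (O.minus F)) x) (O.normal F)}

/-- The space `V_{hτ}`: on each slab an element of `P_ℓ ⊗ V_h`, whose normal component vanishes on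
the boundary. -/
def spaceTimeVelocity {d : ℕ} {T : ℝ} (D : SpaceTimeMesh d T) (fam : VelocityFamily) (k ℓ : ℕ) :
    Set (SpaceTimeField d) :=
  {u | ∀ n < D.N,
    (∃ c : ℕ → BrokenField d, (∀ j, c j ∈ velocitySpace D.orient fam k) ∧
      ∀ s : ℝ, u n s = ∑ j ∈ Finset.range (ℓ + 1), s ^ j • c j) ∧
    ∀ s : ℝ, ∀ F ∈ D.mesh.boundaryFacets, ∀ x ∈ convexHull ℝ (F : Set (Pt d)),
      inner ℝ (val (u n s (D.orient.plus F)) x) (D.orient.normal F) = 0}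

/-- The space `Z_{hτ}` of the divergence-free functions in `V_{hτ}`. -/
def spaceTimeKernel {d : ℕ} {T : ℝ} (D : SpaceTimeMesh d T) (fam : VelocityFamily) (k ℓ : ℕ) :
    Set (SpaceTimeField d) :=
  {u | u ∈ spaceTimeVelocity D fam k ℓ ∧
    ∀ n < D.N, ∀ s : ℝ, ∀ K ∈ D.mesh.elems, divergence (u n s K) = 0}

/-! ## Integrals, jumps and averages in space -/

/-- The integral over the facet `F` with respect to the surface measure. -/
noncomputable def facetIntegral {d : ℕ} (F : Finset (Pt d)) (g : Pt d → ℝ) : ℝ :=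
  ∫ x in convexHull ℝ (F : Set (Pt d)), g x ∂(Measure.euclideanHausdorffMeasure (d - 1))

/-- The integral over the domain of a function that is given elementwise. -/
noncomputable def meshIntegral {d : ℕ} (M : SimplicialMesh d) (g : Finset (Pt d) → Pt d → ℝ) : ℝ :=
  ∑ K ∈ M.elems, ∫ x in convexHull ℝ (K : Set (Pt d)), g K x

/-- The `L²(Ω)^d` inner product of two broken fields. -/
noncomputable def innerL2 {d : ℕ} (M : SimplicialMesh d) (v w : BrokenField d) : ℝ :=
  meshIntegral M fun K x => inner ℝ (val (v K) x) (val (w K) x)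

/-- The square of the `L²(Ω)^d` norm of a broken field. -/
noncomputable def normL2Sq {d : ℕ} (M : SimplicialMesh d) (v : BrokenField d) : ℝ :=
  meshIntegral M fun K x => ‖val (v K) x‖ ^ 2

/-- The diameter `h_F` of a facet. -/
noncomputable def facetDiam {d : ℕ} (F : Finset (Pt d)) : ℝ :=
  Metric.diam (convexHull ℝ (F : Set (Pt d)))

open Classical in
/-- The jump `[v]` on the facet `F`. -/
noncomputable def jump {d : ℕ} {M : SimplicialMesh d} (O : FacetOrientation M) (v : BrokenField d)
    (F : Finset (Pt d)) (x : Pt d) : Pt d :=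
  if F ∈ M.interiorFacets then val (v (O.plus F)) x - val (v (O.minus F)) x
  else val (v (O.plus F)) x

open Classical in
/-- The average `{v}` on the facet `F`. -/
noncomputable def average {d : ℕ} {M : SimplicialMesh d} (O : FacetOrientation M)
    (v : BrokenField d) (F : Finset (Pt d)) (x : Pt d) : Pt d :=
  if F ∈ M.interiorFacets then (1 / 2 : ℝ) • (val (v (O.plus F)) x + val (v (O.minus F)) x)
  else val (v (O.plus F)) x

open Classical in
/-- The average `{∇v}` of the gradient on the facet `F`. -/
noncomputable def gradAverage {d : ℕ} {M : SimplicialMesh d} (O : FacetOrientation M)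
    (v : BrokenField d) (F : Finset (Pt d)) (x : Pt d) : Matrix (Fin d) (Fin d) ℝ :=
  if F ∈ M.interiorFacets then (1 / 2 : ℝ) • (grad (v (O.plus F)) x + grad (v (O.minus F)) x)
  else grad (v (O.plus F)) x

/-- `γ_F(w) = max {c_S, ‖w · n_F‖_{L^∞(F)}}` at a fixed time. -/
noncomputable def upwindCoeff {d : ℕ} {M : SimplicialMesh d} (O : FacetOrientation M) (cS : ℝ)
    (w : BrokenField d) (F : Finset (Pt d)) : ℝ :=
  max cS (eLpNorm (fun x => inner ℝ (val (w (O.plus F)) x) (O.normal F)) ⊤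
    ((Measure.euclideanHausdorffMeasure (d - 1)).restrict
      (convexHull ℝ (F : Set (Pt d))))).toReal

/-! ## Interpolation and quadrature in time -/

/-- The Gauss-Radau nodes on the slab number `n`. -/
noncomputable def SpaceTimeMesh.node {d : ℕ} {T : ℝ} (D : SpaceTimeMesh d T) (ℓ n : ℕ)
    (i : Fin (ℓ + 1)) : ℝ :=
  D.t n + (D.t (n + 1) - D.t n) * radauNode ℓ i

/-- The Gauss-Radau weights on the slab number `n`. -/
noncomputable def SpaceTimeMesh.weight {d : ℕ} {T : ℝ} (D : SpaceTimeMesh d T) (ℓ n : ℕ)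
    (i : Fin (ℓ + 1)) : ℝ :=
  (D.t (n + 1) - D.t n) * radauWeight ℓ i

/-- The Gauss-Radau quadrature of a function of time on the slab number `n`. -/
noncomputable def SpaceTimeMesh.quad {d : ℕ} {T : ℝ} (D : SpaceTimeMesh d T) (ℓ n : ℕ)
    (g : ℝ → ℝ) : ℝ :=
  ∑ i, D.weight ℓ n i * g (D.node ℓ n i)

/-- The Lagrange interpolant in time at the Gauss-Radau nodes of the slab number `n`. -/
noncomputable def SpaceTimeMesh.interp {d : ℕ} {T : ℝ} (D : SpaceTimeMesh d T) (ℓ n : ℕ)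
    (g : ℝ → Pt d) (s : ℝ) : Pt d :=
  ∑ i, (Lagrange.basis Finset.univ (D.node ℓ n) i).eval s • g (D.node ℓ n i)

/-! ## The space-time forms -/

/-- The form `m_{hτ}`: time derivative on the slabs, upwinded time jumps
`u(t_n^-) - u(t_n^+)`, and the term at time `0`. -/
noncomputable def timeForm {d : ℕ} {T : ℝ} (D : SpaceTimeMesh d T) (u v : SpaceTimeField d) : ℝ :=
  (∑ n ∈ Finset.range D.N, ∫ s in (D.t n)..(D.t (n + 1)), meshIntegral D.mesh fun K x =>
    inner ℝ (deriv (fun r => val (u n r K) x) s) (val (v n s K) x))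
  - (∑ n ∈ Finset.range (D.N - 1),
      innerL2 D.mesh (u n (D.t (n + 1)) - u (n + 1) (D.t (n + 1))) (v (n + 1) (D.t (n + 1))))
  + innerL2 D.mesh (u 0 0) (v 0 0)

/-- The symmetric interior penalty form in space, at a fixed time. -/
noncomputable def penaltyForm {d : ℕ} {M : SimplicialMesh d} (O : FacetOrientation M) (σ : ℝ)
    (v w : BrokenField d) : ℝ :=
  (meshIntegral M fun K x => ∑ i, ∑ j, grad (v K) x i j * grad (w K) x i j)
  - (∑ F ∈ M.facets, facetIntegral F fun x =>
      inner ℝ (matVec (gradAverage O v F x) (O.normal F)) (jump O w F x))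
  - (∑ F ∈ M.facets, facetIntegral F fun x =>
      inner ℝ (jump O v F x) (matVec (gradAverage O w F x) (O.normal F)))
  + ∑ F ∈ M.facets, facetIntegral F fun x =>
      σ * (facetDiam F)⁻¹ * inner ℝ (jump O v F x) (jump O w F x)

/-- The form `a_{hτ}`. -/
noncomputable def viscousForm {d : ℕ} {T : ℝ} (D : SpaceTimeMesh d T) (σ : ℝ)
    (u v : SpaceTimeField d) : ℝ :=
  ∑ n ∈ Finset.range D.N, ∫ s in (D.t n)..(D.t (n + 1)), penaltyForm D.orient σ (u n s) (v n s)

/-- The form `c_{hτ}(w; u, v)`: the convective term, its consistency correction and the upwind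
stabilization on the interior facets, each with the Gauss-Radau interpolant in time. -/
noncomputable def convectiveForm {d : ℕ} {T : ℝ} (D : SpaceTimeMesh d T) (ℓ : ℕ) (cS : ℝ)
    (w u v : SpaceTimeField d) : ℝ :=
  ∑ n ∈ Finset.range D.N,
    ((∫ s in (D.t n)..(D.t (n + 1)), meshIntegral D.mesh fun K x =>
        inner ℝ (D.interp ℓ n (fun r => matVec (grad (u n r K) x) (val (w n r K) x)) s)
          (val (v n s K) x))
    - (∫ s in (D.t n)..(D.t (n + 1)), ∑ F ∈ D.mesh.interiorFacets, facetIntegral F fun x =>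
        inner ℝ
          (D.interp ℓ n (fun r =>
            (inner ℝ (val (w n r (D.orient.plus F)) x) (D.orient.normal F) : ℝ) •
              jump D.orient (u n r) F x) s)
          (average D.orient (v n s) F x))
    + (1 / 2) * ∫ s in (D.t n)..(D.t (n + 1)), ∑ F ∈ D.mesh.interiorFacets, facetIntegral F fun x =>
        inner ℝ
          (D.interp ℓ n (fun r =>
            upwindCoeff D.orient cS (w n r) F • jump D.orient (u n r) F x) s)
          (jump D.orient (v n s) F x))

/-- The pairing `(g, v)_Ω` of a function on `Ω` with a broken field. -/
noncomputable def pairing {d : ℕ} (M : SimplicialMesh d) (g : Pt d → Pt d) (v : BrokenField d) :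
    ℝ :=
  meshIntegral M fun K x => inner ℝ (g x) (val (v K) x)

/-- `u` solves the linearized space-time problem with convective coefficient `w`, viscosity `ν`,
force `f`, initial datum `u₀`, penalty parameter `σ` and safeguard constant `cS`. -/
def IsLinearizedSolution {d : ℕ} {T : ℝ} (D : SpaceTimeMesh d T) (Ω : Set (Pt d))
    (fam : VelocityFamily) (k ℓ : ℕ) (ν σ cS : ℝ) (f : ℝ → Lp (Pt d) 2 (volume.restrict Ω))
    (u₀ : Lp (Pt d) 2 (volume.restrict Ω)) (w u : SpaceTimeField d) : Prop :=
  u ∈ spaceTimeKernel D fam k ℓ ∧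
  ∀ z ∈ spaceTimeKernel D fam k ℓ,
    timeForm D u z + ν * viscousForm D σ u z + convectiveForm D ℓ cS w u z =
      (∑ n ∈ Finset.range D.N, ∫ s in (D.t n)..(D.t (n + 1)), pairing D.mesh (f s) (z n s))
      + pairing D.mesh u₀ (z 0 0)

/-! ## The energy norm -/

/-- The norm in `L^∞(0, T; L²(Ω)^d)`. -/
noncomputable def normLinftyL2 {d : ℕ} {T : ℝ} (D : SpaceTimeMesh d T) (u : SpaceTimeField d) : ℝ :=
  (eLpNorm (fun s => ∑ n ∈ Finset.range D.N,
      (Set.Ioo (D.t n) (D.t (n + 1))).indicator (fun r => √(normL2Sq D.mesh (u n r))) s)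
    ⊤ (volume.restrict (Set.Ioo 0 T))).toReal

/-- The square of the norm `‖·‖_{A,h}` in space. -/
noncomputable def penaltyNormSq {d : ℕ} {M : SimplicialMesh d} (O : FacetOrientation M) (σ : ℝ)
    (v : BrokenField d) : ℝ :=
  (meshIntegral M fun K x => ∑ i, ∑ j, (grad (v K) x i j) ^ 2)
  + ∑ F ∈ M.facets, facetIntegral F fun x => σ * (facetDiam F)⁻¹ * ‖jump O v F x‖ ^ 2

/-- The square of the norm `‖·‖_A`. -/
noncomputable def viscousNormSq {d : ℕ} {T : ℝ} (D : SpaceTimeMesh d T) (σ : ℝ)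
    (u : SpaceTimeField d) : ℝ :=
  ∑ n ∈ Finset.range D.N, ∫ s in (D.t n)..(D.t (n + 1)), penaltyNormSq D.orient σ (u n s)

/-- The square of the time-jump seminorm: values at `T` and `0`, and jumps at the inner times. -/
noncomputable def timeJumpSq {d : ℕ} {T : ℝ} (D : SpaceTimeMesh d T) (u : SpaceTimeField d) : ℝ :=
  (1 / 2) * (normL2Sq D.mesh (u (D.N - 1) T)
    + (∑ n ∈ Finset.range (D.N - 1),
        normL2Sq D.mesh (u n (D.t (n + 1)) - u (n + 1) (D.t (n + 1))))
    + normL2Sq D.mesh (u 0 0))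

/-- The square of the upwind seminorm. -/
noncomputable def upwindSq {d : ℕ} {T : ℝ} (D : SpaceTimeMesh d T) (ℓ : ℕ) (cS : ℝ)
    (w u : SpaceTimeField d) : ℝ :=
  (1 / 2) * ∑ F ∈ D.mesh.interiorFacets, ∑ n ∈ Finset.range D.N, D.quad ℓ n fun s =>
    upwindCoeff D.orient cS (w n s) F * facetIntegral F fun x => ‖jump D.orient (u n s) F x‖ ^ 2

/-- The square of the energy norm `|||u|||_w`. -/
noncomputable def energyNormSq {d : ℕ} {T : ℝ} (D : SpaceTimeMesh d T) (ℓ : ℕ) (ν σ cS : ℝ)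
    (w u : SpaceTimeField d) : ℝ :=
  normLinftyL2 D u ^ 2 + ν * viscousNormSq D σ u + timeJumpSq D u + upwindSq D ℓ cS w u

end OseenDG

open OseenDG

namespace OseenDG

/-! ## Polynomials and Gauss-Radau quadrature in one variable -/

/-! The estimate is an energy argument with two test functions on each time slab. Testing with `u`
controls the values at the slab ends, the time jumps and the dissipation, but leaves `∫ (f, u)`,
which is bounded by the `L¹(L²)` norm of `f` times the supremum of `‖u‖` in time. In general the
values at the slab ends do not control that supremum. The second test function is therefore the
Radau interpolant of `θ u`, where `θ` falls linearly from 1 to 0 across the slab: its slope produces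
the mean of `‖u‖²` over the slab (`IsLinearizedSolution.slab_identity`).

The Radau rule makes the interpolation harmless. Products of two functions of degree `ℓ` in time are
integrated exactly, and so is `∂ₜu · θ u`, of degree at most `2ℓ`; hence every form is a weighted
sum of its values at the nodes, where the test function is a nonnegative multiple of `u`. The left
end of the slab is a node, so the upwinded jump is also tested with a multiple of `u`. At a node the
volume and flux parts of convection cancel (`convVolume_eq_convFlux`), the upwind part is
nonnegative, and the penalty form is coercive (`exists_penalty_threshold`).

Let `A` be the largest nodal value of `‖u‖`, `Λ` the Lebesgue constant of the nodes, `κ` the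
smallest reference weight and `F` the norm of `f`. Then `‖u‖` and both test functions are bounded by
`Λ A`, the mean of `‖u‖²` over the slab where `A` is attained is at least `κ A²`, and the weighted
test gives `κ A² ≤ ‖u₀‖² + 4 Λ A F`. Young's inequality absorbs `A`. Only `Λ` and `κ` enter the
constant, and they depend on `ℓ` alone.

The spatial ingredients rest on one formula, integration over a simplex along the rays from a vertex
(`IsConeBase.integral_eq`). It yields a trace inequality with a constant independent of the shape of
the simplex, used for coercivity, and the divergence theorem for polynomial fields, used for
convection. -/

theorem radauNode_mem (ℓ : ℕ) (i : Fin (ℓ + 1)) : 0 ≤ radauNode ℓ i ∧ radauNode ℓ i < 1 := by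
  have h := isLeftGaussRadau_radau ℓ
  refine ⟨?_, h.lt_one i⟩
  rw [← h.first]
  exact h.strictMono.monotone (Fin.zero_le i)

/-- The Lagrange basis at the reference nodes is bounded on the unit interval. -/
theorem exists_lebesgue_constant (ℓ : ℕ) :
    ∃ Λ : ℝ, 1 ≤ Λ ∧ ∀ s ∈ Set.Icc (0 : ℝ) 1,
      ∑ i, |(Lagrange.basis Finset.univ (radauNode ℓ) i).eval s| ≤ Λ := by
  have hc : Continuous fun s : ℝ =>
      ∑ i, |(Lagrange.basis Finset.univ (radauNode ℓ) i).eval s| :=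
    continuous_finsetSum _ fun i _ => (Polynomial.continuous _).abs
  obtain ⟨B, hB⟩ := (isCompact_Icc (a := (0 : ℝ)) (b := 1)).bddAbove_image hc.continuousOn
  exact ⟨max 1 B, le_max_left _ _, fun s hs => (hB ⟨s, hs, rfl⟩).trans (le_max_right _ _)⟩

/-- Finitely many positive weights have a positive minimum. It compares the largest nodal value with
a mean over the slab. -/
theorem exists_weight_lower_bound (ℓ : ℕ) : ∃ κ : ℝ, 0 < κ ∧ ∀ i, κ ≤ radauWeight ℓ i := by
  obtain ⟨i, hi⟩ := Finite.exists_min (radauWeight ℓ)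
  exact ⟨_, (isLeftGaussRadau_radau ℓ).weight_pos i, hi⟩

theorem eval_eq_sum_lagrange {ι : Type*} [Fintype ι] [DecidableEq ι] {x : ι → ℝ}
    (hx : Function.Injective x) (p : ℝ[X]) (hp : p.natDegree < Fintype.card ι) (s : ℝ) :
    p.eval s = ∑ i, (Lagrange.basis Finset.univ x i).eval s * p.eval (x i) := by
  have h := Lagrange.eq_interpolate (s := Finset.univ) (v := x) (f := p) hx.injOn
    (lt_of_le_of_lt degree_le_natDegree (by simpa using hp))
  conv_lhs => rw [h]
  simp only [Lagrange.interpolate_apply, eval_finsetSum, eval_mul, eval_C]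
  exact Finset.sum_congr rfl fun i _ => mul_comm _ _

/-- An inverse estimate: the maximum of a polynomial is bounded by its mean square. -/
theorem exists_sq_eval_le_integral (ℓ : ℕ) :
    ∃ C : ℝ, 0 < C ∧ ∀ p : ℝ[X], p.natDegree ≤ ℓ → ∀ s ∈ Set.Icc (0 : ℝ) 1,
      p.eval s ^ 2 ≤ C * ∫ r in (0 : ℝ)..1, p.eval r ^ 2 := by
  obtain ⟨Λ, hΛ, hb⟩ := exists_lebesgue_constant ℓ
  obtain ⟨κ, hκ, hw⟩ := exists_weight_lower_bound ℓ
  have hR := isLeftGaussRadau_radau ℓ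
  refine ⟨Λ ^ 2 / κ, by positivity, fun p hp s hs => ?_⟩
  -- The square has degree at most `2ℓ`, so its mean is a sum of nonnegative nodal terms, each of
  -- which bounds one nodal value.
  have hq := hR.exact_of_le (p ^ 2) (natDegree_pow_le.trans (by gcongr))
  simp only [eval_pow] at hq
  rw [← hq]
  set S := ∑ i, radauWeight ℓ i * p.eval (radauNode ℓ i) ^ 2 with hS
  have h1 : ∀ i, |p.eval (radauNode ℓ i)| ≤ √(S / κ) := by
    intro i
    apply Real.abs_le_sqrt
    rw [le_div_iff₀ hκ]
    calc p.eval (radauNode ℓ i) ^ 2 * κ ≤ radauWeight ℓ i * p.eval (radauNode ℓ i) ^ 2 := by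
          rw [mul_comm]; gcongr; exact hw i
      _ ≤ S := Finset.single_le_sum (f := fun i => radauWeight ℓ i * p.eval (radauNode ℓ i) ^ 2)
          (fun j _ => mul_nonneg (hR.weight_pos j).le (sq_nonneg _)) (Finset.mem_univ i)
  have hS0 : 0 ≤ S := Finset.sum_nonneg fun j _ => mul_nonneg (hR.weight_pos j).le (sq_nonneg _)
  have h2 : |p.eval s| ≤ Λ * √(S / κ) := by
    rw [eval_eq_sum_lagrange hR.strictMono.injective p (by simp; omega) s]
    calc _ ≤ ∑ i, |(Lagrange.basis Finset.univ (radauNode ℓ) i).eval s| * √(S / κ) := by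
          refine (Finset.abs_sum_le_sum_abs _ _).trans (Finset.sum_le_sum fun i _ => ?_)
          rw [abs_mul]
          exact mul_le_mul_of_nonneg_left (h1 i) (abs_nonneg _)
      _ ≤ Λ * √(S / κ) := by
          rw [← Finset.sum_mul]
          exact mul_le_mul_of_nonneg_right (hb s hs) (Real.sqrt_nonneg _)
  calc p.eval s ^ 2 = |p.eval s| ^ 2 := (sq_abs _).symm
    _ ≤ (Λ * √(S / κ)) ^ 2 := by gcongr
    _ = Λ ^ 2 / κ * S := by rw [mul_pow, Real.sq_sqrt (by positivity)]; ring

/-- A weighted trace estimate on the unit interval. -/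
theorem exists_sq_eval_one_le (k m : ℕ) :
    ∃ C : ℝ, 0 < C ∧ ∀ p : ℝ[X], p.natDegree ≤ k →
      p.eval 1 ^ 2 ≤ C * ∫ r in (0 : ℝ)..1, r ^ m * p.eval r ^ 2 := by
  obtain ⟨C, hC, h⟩ := exists_sq_eval_le_integral k
  -- The unweighted estimate is applied on `[1/2, 1]`, through `p((r + 1)/2)`. The change of
  -- variables costs a factor 2, and `2 ^ m` comes from `r ^ m ≥ 2 ^ (-m)` there.
  refine ⟨C * 2 ^ (m + 1), by positivity, fun p hp => ?_⟩
  have h1 := h (p.comp (Polynomial.C (1 / 2) * X + Polynomial.C (1 / 2)))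
    (natDegree_comp_le.trans (by
      refine (Nat.mul_le_mul_left _ (natDegree_linear_le)).trans ?_
      simpa using hp)) 1 (by simp)
  simp only [eval_comp, eval_add, eval_mul, eval_C, eval_X] at h1
  rw [intervalIntegral.integral_comp_mul_add (f := fun x => p.eval x ^ 2) (c := (1 / 2 : ℝ))
    (by norm_num)] at h1
  norm_num at h1
  have hci : ∀ a b : ℝ, IntervalIntegrable (fun r : ℝ => r ^ m * p.eval r ^ 2) volume a b :=
    fun a b => ((continuous_pow m).mul (p.continuous.pow 2)).intervalIntegrable _ _
  have h2 : ∫ x in (1 / 2 : ℝ)..1, p.eval x ^ 2 ≤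
      2 ^ m * ∫ r in (1 / 2 : ℝ)..1, r ^ m * p.eval r ^ 2 := by
    rw [← intervalIntegral.integral_const_mul]
    apply intervalIntegral.integral_mono_on (by norm_num)
      ((p.continuous.pow 2).intervalIntegrable _ _) ((hci _ _).const_mul _)
    intro x hx
    have : (1 : ℝ) ≤ 2 ^ m * x ^ m := by
      rw [← mul_pow]; exact one_le_pow₀ (by linarith [hx.1])
    have h0 := mul_le_mul_of_nonneg_right this (sq_nonneg (p.eval x))
    simpa [mul_assoc] using h0
  have h3 : ∫ r in (1 / 2 : ℝ)..1, r ^ m * p.eval r ^ 2 ≤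
      ∫ r in (0 : ℝ)..1, r ^ m * p.eval r ^ 2 := by
    rw [← intervalIntegral.integral_add_adjacent_intervals (hci 0 (1 / 2)) (hci (1 / 2) 1)]
    have : 0 ≤ ∫ r in (0 : ℝ)..(1 / 2), r ^ m * p.eval r ^ 2 :=
      intervalIntegral.integral_nonneg (by norm_num) fun x hx =>
        mul_nonneg (pow_nonneg hx.1 _) (sq_nonneg _)
    linarith
  calc p.eval 1 ^ 2 ≤ C * (2 * ∫ x in (1 / 2 : ℝ)..1, p.eval x ^ 2) := h1
    _ ≤ C * (2 * (2 ^ m * ∫ r in (0 : ℝ)..1, r ^ m * p.eval r ^ 2)) := by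
        have := h2.trans (mul_le_mul_of_nonneg_left h3 (by positivity))
        gcongr
    _ = _ := by ring

/-- The Gauss-Radau rule on `[a, b]`. -/
theorem sum_radau_eq_integral (ℓ : ℕ) {a b : ℝ} (hab : a < b) (p : ℝ[X])
    (hp : p.natDegree ≤ 2 * ℓ) :
    ∫ s in a..b, p.eval s =
      ∑ i, ((b - a) * radauWeight ℓ i) * p.eval (a + (b - a) * radauNode ℓ i) := by
  have h1 := (isLeftGaussRadau_radau ℓ).exact_of_le
    (p.comp (Polynomial.C (b - a) * X + Polynomial.C a)) (natDegree_comp_le.trans (by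
      refine (Nat.mul_le_mul_left _ (natDegree_linear_le)).trans ?_
      simpa using hp))
  simp only [eval_comp, eval_add, eval_mul, eval_C, eval_X] at h1
  rw [intervalIntegral.integral_comp_mul_add (f := fun x => p.eval x)
    (sub_pos.2 hab).ne'] at h1
  simp only [mul_zero, zero_add, mul_one, sub_add_cancel, smul_eq_mul] at h1
  rw [eq_comm, inv_mul_eq_iff_eq_mul₀ (sub_pos.2 hab).ne'] at h1
  rw [h1, Finset.mul_sum]
  exact Finset.sum_congr rfl fun i _ => by rw [add_comm a]; ring

/-! ## Polynomial paths in a vector space -/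

section Paths

variable {V : Type*} [AddCommGroup V] [Module ℝ V]

/-- `u` is a polynomial path of degree at most `ℓ` with coefficients in `W`. -/
def IsPolyPath (W : Submodule ℝ V) (ℓ : ℕ) (u : ℝ → V) : Prop :=
  ∃ c : ℕ → V, (∀ j, c j ∈ W) ∧ ∀ s : ℝ, u s = ∑ j ∈ Finset.range (ℓ + 1), s ^ j • c j

theorem IsPolyPath.mem {W : Submodule ℝ V} {ℓ : ℕ} {u : ℝ → V} (hu : IsPolyPath W ℓ u) (s : ℝ) :
    u s ∈ W := by
  obtain ⟨c, hc, h⟩ := hu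
  rw [h]
  exact W.sum_mem fun j _ => W.smul_mem _ (hc j)

theorem isPolyPath_sum_eval_smul {ι : Type*} {W : Submodule ℝ V} {ℓ : ℕ} (S : Finset ι)
    (q : ι → ℝ[X]) (hq : ∀ i ∈ S, (q i).natDegree ≤ ℓ) (v : ι → V) (hv : ∀ i ∈ S, v i ∈ W) :
    IsPolyPath W ℓ fun s => ∑ i ∈ S, (q i).eval s • v i := by
  refine ⟨fun j => ∑ i ∈ S, (q i).coeff j • v i,
    fun j => W.sum_mem fun i hi => W.smul_mem _ (hv i hi), fun s => ?_⟩
  simp only [Finset.smul_sum]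
  rw [Finset.sum_comm]
  refine Finset.sum_congr rfl fun i hi => ?_
  rw [eval_eq_sum_range' (Nat.lt_succ_of_le (hq i hi)), Finset.sum_smul]
  exact Finset.sum_congr rfl fun j _ => by rw [smul_smul, mul_comm]

/-- Expanding both paths in powers of time leaves a real polynomial. This reduces every time
integral of a discrete form to quadrature in one variable, without a topology on `V`. -/
theorem IsPolyPath.exists_bilin_poly {W₁ W₂ : Submodule ℝ V} {m n : ℕ} {u v : ℝ → V}
    (hu : IsPolyPath W₁ m u) (hv : IsPolyPath W₂ n v) {B : V → V → ℝ} (hB : IsBilinearMap ℝ B) :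
    ∃ P : ℝ[X], P.natDegree ≤ m + n ∧ ∀ s, P.eval s = B (u s) (v s) := by
  obtain ⟨c, -, hc⟩ := hu
  obtain ⟨e, -, he⟩ := hv
  refine ⟨∑ i ∈ Finset.range (m + 1), ∑ j ∈ Finset.range (n + 1),
    Polynomial.C (B (c i) (e j)) * X ^ (i + j), ?_, fun s => ?_⟩
  · refine natDegree_sum_le_of_forall_le _ _ fun i hi => natDegree_sum_le_of_forall_le _ _
      fun j hj => (natDegree_C_mul_X_pow_le _ _).trans ?_
    simp only [Finset.mem_range] at hi hj
    omega
  · change _ = hB.toLinearMap (u s) (v s)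
    rw [hc, he]
    simp only [eval_finsetSum, eval_mul, eval_C, eval_pow, eval_X, map_sum, map_smul,
      LinearMap.sum_apply, LinearMap.smul_apply, smul_eq_mul, Finset.mul_sum]
    rw [Finset.sum_comm]
    refine Finset.sum_congr rfl fun j _ => Finset.sum_congr rfl fun i _ => ?_
    change B _ _ * _ = _ * (_ * B _ _)
    ring

/-- The derivative of a polynomial path. -/
theorem IsPolyPath.exists_deriv {W : Submodule ℝ V} {ℓ : ℕ} {u : ℝ → V} (hu : IsPolyPath W ℓ u) :
    ∃ u' : ℝ → V, IsPolyPath W ℓ u' ∧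
      (∀ (E : Type) [NormedAddCommGroup E] [NormedSpace ℝ E] (φ : V →ₗ[ℝ] E) (s : ℝ),
        HasDerivAt (fun r => φ (u r)) (φ (u' s)) s) ∧
      ∀ (B : V → V → ℝ), IsBilinearMap ℝ B → ∀ s : ℝ,
        HasDerivAt (fun r => B (u r) (u r)) (B (u' s) (u s) + B (u s) (u' s)) s := by
  obtain ⟨c, hcW, hc⟩ := hu
  let p : ℕ → ℝ[X] := fun j => derivative (X ^ j)
  have hφ : ∀ (E : Type) [NormedAddCommGroup E] [NormedSpace ℝ E] (φ : V →ₗ[ℝ] E) (s : ℝ),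
      HasDerivAt (fun r => φ (u r))
        (φ (∑ j ∈ Finset.range (ℓ + 1), (p j).eval s • c j)) s := by
    intro E _ _ φ s
    simp only [hc, map_sum, map_smul]
    refine HasDerivAt.fun_sum fun j _ => HasDerivAt.smul_const ?_ _
    simpa [p] using (X ^ j : ℝ[X]).hasDerivAt s
  refine ⟨fun s => ∑ j ∈ Finset.range (ℓ + 1), (p j).eval s • c j,
    isPolyPath_sum_eval_smul _ _ (fun j hj => ?_) _ fun j _ => hcW j, hφ, fun B hB s => ?_⟩
  · refine (natDegree_derivative_le _).trans ?_
    rw [natDegree_X_pow]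
    simp only [Finset.mem_range] at hj
    omega
  · have h : ∀ r, B (u r) (u r) =
        ∑ j ∈ Finset.range (ℓ + 1), r ^ j * hB.toLinearMap (u r) (c j) := by
      intro r
      have h0 : hB.toLinearMap (u r) (∑ j ∈ Finset.range (ℓ + 1), r ^ j • c j) =
        ∑ j ∈ Finset.range (ℓ + 1), r ^ j * hB.toLinearMap (u r) (c j) := by simp
      rwa [← hc r] at h0
    have h2 : B (u s) (∑ j ∈ Finset.range (ℓ + 1), (p j).eval s • c j) =
        ∑ j ∈ Finset.range (ℓ + 1), (p j).eval s * hB.toLinearMap (u s) (c j) := by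
      change hB.toLinearMap _ _ = _
      simp
    have h3 : B (∑ j ∈ Finset.range (ℓ + 1), (p j).eval s • c j) (u s) =
        ∑ j ∈ Finset.range (ℓ + 1), s ^ j *
          hB.toLinearMap (∑ j ∈ Finset.range (ℓ + 1), (p j).eval s • c j) (c j) := by
      change hB.toLinearMap _ _ = _
      conv_lhs => rw [hc s]
      simp
    simp only [h]
    rw [h2, h3, ← Finset.sum_add_distrib]
    refine HasDerivAt.fun_sum fun j _ => ?_
    rw [add_comm (s ^ j * _)]
    refine HasDerivAt.fun_mul ?_ ?_
    · simpa [p] using (X ^ j : ℝ[X]).hasDerivAt s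
    · exact hφ ℝ (hB.toLinearMap.flip (c j)) s

/-! ### Interpolated multiples of a path -/

/-- The nodes of the Gauss-Radau rule on `[a, b]`. -/
noncomputable def slabNode (ℓ : ℕ) (a b : ℝ) (i : Fin (ℓ + 1)) : ℝ := a + (b - a) * radauNode ℓ i

theorem slabNode_injective (ℓ : ℕ) {a b : ℝ} (hab : a < b) :
    Function.Injective (slabNode ℓ a b) := by
  intro i j h
  have := sub_pos.2 hab
  simp only [slabNode, add_right_inj, mul_eq_mul_left_iff, this.ne', or_false] at h
  exact (isLeftGaussRadau_radau ℓ).strictMono.injective h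

theorem slabNode_zero (ℓ : ℕ) (a b : ℝ) : slabNode ℓ a b 0 = a := by
  simp [slabNode, (isLeftGaussRadau_radau ℓ).first]

theorem slabNode_mem (ℓ : ℕ) {a b : ℝ} (hab : a < b) (i : Fin (ℓ + 1)) :
    slabNode ℓ a b i ∈ Set.Icc a b := by
  have := radauNode_mem ℓ i
  constructor <;> simp only [slabNode] <;> nlinarith

theorem eval_basis_slabNode (ℓ : ℕ) {a b : ℝ} (hab : a < b) (i : Fin (ℓ + 1)) (x : ℝ) :
    (Lagrange.basis Finset.univ (slabNode ℓ a b) i).eval (a + (b - a) * x) =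
      (Lagrange.basis Finset.univ (radauNode ℓ) i).eval x := by
  have := (sub_pos.2 hab).ne'
  simp only [Lagrange.basis, Lagrange.basisDivisor, eval_prod, eval_mul, eval_C, eval_sub, eval_X,
    slabNode]
  refine Finset.prod_congr rfl fun j _ => ?_
  rw [show a + (b - a) * radauNode ℓ i - (a + (b - a) * radauNode ℓ j) =
    (b - a) * (radauNode ℓ i - radauNode ℓ j) by ring, mul_inv]
  field_simp
  ring

theorem sum_abs_basis_slabNode_le {ℓ : ℕ} {Λ : ℝ} (hΛ : ∀ s ∈ Set.Icc (0 : ℝ) 1,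
      ∑ i, |(Lagrange.basis Finset.univ (radauNode ℓ) i).eval s| ≤ Λ) {a b : ℝ} (hab : a < b)
    {s : ℝ} (hs : s ∈ Set.Icc a b) :
    ∑ i, |(Lagrange.basis Finset.univ (slabNode ℓ a b) i).eval s| ≤ Λ := by
  have h0 := sub_pos.2 hab
  have h : s = a + (b - a) * ((s - a) / (b - a)) := by field_simp; ring
  rw [h]
  simp only [eval_basis_slabNode ℓ hab]
  refine hΛ _ ⟨div_nonneg (by linarith [hs.1]) h0.le, ?_⟩
  rw [div_le_one h0]; linarith [hs.2]

/-- The interpolant of `θ u` at the Gauss-Radau nodes of `[a, b]`. -/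
noncomputable def interpMul (ℓ : ℕ) (a b : ℝ) (θ : ℝ → ℝ) (u : ℝ → V) (s : ℝ) : V :=
  ∑ i, (Lagrange.basis Finset.univ (slabNode ℓ a b) i).eval s •
    (θ (slabNode ℓ a b i) • u (slabNode ℓ a b i))

theorem eval_basis_slabNode_node (ℓ : ℕ) {a b : ℝ} (hab : a < b) (i j : Fin (ℓ + 1)) :
    (Lagrange.basis Finset.univ (slabNode ℓ a b) i).eval (slabNode ℓ a b j) =
      if i = j then 1 else 0 := by
  split_ifs with h
  · rw [h]; exact Lagrange.eval_basis_self (slabNode_injective ℓ hab).injOn (Finset.mem_univ j)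
  · exact Lagrange.eval_basis_of_ne h (Finset.mem_univ j)

theorem natDegree_basis_slabNode (ℓ : ℕ) {a b : ℝ} (hab : a < b) (i : Fin (ℓ + 1)) :
    (Lagrange.basis Finset.univ (slabNode ℓ a b) i).natDegree = ℓ := by
  rw [Lagrange.natDegree_basis (slabNode_injective ℓ hab).injOn (Finset.mem_univ i)]; simp

theorem interpMul_node (ℓ : ℕ) {a b : ℝ} (hab : a < b) (θ : ℝ → ℝ) (u : ℝ → V)
    (j : Fin (ℓ + 1)) :
    interpMul ℓ a b θ u (slabNode ℓ a b j) = θ (slabNode ℓ a b j) • u (slabNode ℓ a b j) := by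
  simp only [interpMul, eval_basis_slabNode_node ℓ hab, ite_smul, one_smul, zero_smul,
    Finset.sum_ite_eq', Finset.mem_univ, if_true]

theorem interpMul_left (ℓ : ℕ) {a b : ℝ} (hab : a < b) (θ : ℝ → ℝ) (u : ℝ → V) :
    interpMul ℓ a b θ u a = θ a • u a := by
  simpa only [slabNode_zero] using interpMul_node ℓ hab θ u 0

theorem isPolyPath_interpMul {W : Submodule ℝ V} (ℓ : ℕ) {a b : ℝ} (hab : a < b) (θ : ℝ → ℝ)
    {u : ℝ → V} (hu : IsPolyPath W ℓ u) : IsPolyPath W ℓ (interpMul ℓ a b θ u) :=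
  isPolyPath_sum_eval_smul _ _ (fun i _ => (natDegree_basis_slabNode ℓ hab i).le) _
    fun _ _ => W.smul_mem _ (hu.mem _)

/-- Lagrange interpolation at `ℓ + 1` nodes reproduces degree `ℓ`. The values at the nodes thus
replace the monomial coefficients, which gives pointwise bounds and moves the coefficients into any
subspace that contains the values. -/
theorem IsPolyPath.eq_sum_basis {W : Submodule ℝ V} {ℓ : ℕ} {a b : ℝ} (hab : a < b)
    {u : ℝ → V} (hu : IsPolyPath W ℓ u) (s : ℝ) :
    u s = ∑ i, (Lagrange.basis Finset.univ (slabNode ℓ a b) i).eval s • u (slabNode ℓ a b i) := by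
  obtain ⟨c, -, hc⟩ := hu
  simp only [hc, Finset.smul_sum, smul_smul]
  rw [Finset.sum_comm]
  refine Finset.sum_congr rfl fun j hj => ?_
  rw [← Finset.sum_smul]
  congr 1
  have := eval_eq_sum_lagrange (slabNode_injective ℓ hab) (X ^ j : ℝ[X]) (by
    simp only [natDegree_X_pow, Fintype.card_fin]; exact Finset.mem_range.1 hj) s
  simpa using this

/-- Gauss-Radau quadrature of a bilinear form along two paths is exact. -/
theorem integral_bilin_eq_sum {W₁ W₂ : Submodule ℝ V} {ℓ : ℕ} {a b : ℝ} (hab : a < b)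
    {u v : ℝ → V} (hu : IsPolyPath W₁ ℓ u) (hv : IsPolyPath W₂ ℓ v) {B : V → V → ℝ}
    (hB : IsBilinearMap ℝ B) :
    ∫ s in a..b, B (u s) (v s) = ∑ i, ((b - a) * radauWeight ℓ i) *
      B (u (slabNode ℓ a b i)) (v (slabNode ℓ a b i)) := by
  obtain ⟨P, hP, h⟩ := hu.exists_bilin_poly hv hB
  simp only [← h]
  exact sum_radau_eq_integral ℓ hab P (by omega)

/-- Both arguments have degree at most `ℓ`, so the rule is exact; at a node the interpolant is just
`θ u`. The sign of the form on the diagonal therefore survives when `θ` is nonnegative. -/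
theorem integral_bilin_interpMul {W : Submodule ℝ V} {ℓ : ℕ} {a b : ℝ} (hab : a < b)
    {u : ℝ → V} (hu : IsPolyPath W ℓ u) {B : V → V → ℝ} (hB : IsBilinearMap ℝ B) (θ : ℝ → ℝ) :
    ∫ s in a..b, B (u s) (interpMul ℓ a b θ u s) = ∑ i, ((b - a) * radauWeight ℓ i) *
      (θ (slabNode ℓ a b i) * B (u (slabNode ℓ a b i)) (u (slabNode ℓ a b i))) := by
  rw [integral_bilin_eq_sum hab hu (isPolyPath_interpMul ℓ hab θ hu) hB]
  simp only [interpMul_node ℓ hab, hB.smul_right, smul_eq_mul]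

/-- The time derivative tested with the interpolant of `θ u`, for an affine weight `θ`. -/
theorem integral_deriv_interpMul {W : Submodule ℝ V} {ℓ : ℕ} {a b : ℝ} (hab : a < b)
    {u u' : ℝ → V} (hu : IsPolyPath W ℓ u) (hu' : IsPolyPath W ℓ u') {B : V → V → ℝ}
    (hB : IsBilinearMap ℝ B) (hsymm : ∀ v w, B v w = B w v)
    (hd : ∀ s, HasDerivAt (fun r => B (u r) (u r)) (B (u' s) (u s) + B (u s) (u' s)) s)
    (α β : ℝ) :
    ∫ s in a..b, B (u' s) (interpMul ℓ a b (fun r => α + β * r) u s) =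
      (1 / 2) * ((α + β * b) * B (u b) (u b) - (α + β * a) * B (u a) (u a))
        - β / 2 * ∫ s in a..b, B (u s) (u s) := by
  obtain ⟨P, hP, h⟩ := hu.exists_bilin_poly hu hB
  have hP' : ∀ s, (derivative P).eval s = 2 * B (u' s) (u s) := by
    intro s
    have h1 : (fun r => B (u r) (u r)) = fun r => P.eval r := funext fun r => (h r).symm
    have h2 := hd s
    rw [h1, hsymm (u s)] at h2
    rw [(P.hasDerivAt s).unique h2]; ring
  set θ : ℝ[X] := Polynomial.C β * X + Polynomial.C α with hθ
  have hθe : ∀ s, θ.eval s = α + β * s := fun s => by simp [hθ, add_comm]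
  -- Differentiation lowers the degree `2ℓ` by one and the affine weight restores it. A constant `P`
  -- is treated apart because the truncated subtraction would lose one degree.
  have hdeg : (θ * derivative P).natDegree ≤ 2 * ℓ := by
    by_cases h0 : P.natDegree = 0
    · rw [natDegree_eq_zero.1 h0 |>.choose_spec.symm]; simp
    · refine natDegree_mul_le.trans ?_
      have h1 : θ.natDegree ≤ 1 := natDegree_linear_le
      have h2 := natDegree_derivative_le P
      omega
  -- The rule is exact both for the integrand with the interpolant and for `θ P'`, and up to a
  -- factor 2 the two agree at the nodes. The interpolant may thus be replaced by `θ u`, and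
  -- integration by parts finishes.
  rw [integral_bilin_eq_sum hab hu' (isPolyPath_interpMul ℓ hab _ hu) hB]
  have h3 := sum_radau_eq_integral ℓ hab (θ * derivative P) hdeg
  have h4 : ∫ s in a..b, (θ * derivative P).eval s =
      θ.eval b * P.eval b - θ.eval a * P.eval a - ∫ s in a..b, β * P.eval s := by
    simp only [eval_mul]
    have := intervalIntegral.integral_mul_deriv_eq_deriv_mul (a := a) (b := b)
      (u := fun s => θ.eval s) (v := fun s => P.eval s)
      (u' := fun s => (derivative θ).eval s) (v' := fun s => (derivative P).eval s)
      (fun x _ => θ.hasDerivAt x) (fun x _ => P.hasDerivAt x)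
      ((derivative θ).continuous.intervalIntegrable _ _)
      ((derivative P).continuous.intervalIntegrable _ _)
    rw [this]
    simp [hθ]
  rw [h4, intervalIntegral.integral_const_mul] at h3
  simp only [eval_mul, hθe, hP', h] at h3
  simp only [interpMul_node ℓ hab, hB.smul_right, smul_eq_mul]
  have h5 : ∑ i, (b - a) * radauWeight ℓ i * ((α + β * (a + (b - a) * radauNode ℓ i)) *
      (2 * B (u' (a + (b - a) * radauNode ℓ i)) (u (a + (b - a) * radauNode ℓ i)))) =
      2 * ∑ i, (b - a) * radauWeight ℓ i * ((α + β * slabNode ℓ a b i) *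
        B (u' (slabNode ℓ a b i)) (u (slabNode ℓ a b i))) := by
    rw [Finset.mul_sum]
    exact Finset.sum_congr rfl fun i _ => by simp only [slabNode]; ring
  rw [h5] at h3
  linarith

/-! ### Positive semidefinite bilinear forms -/

theorem bilin_cauchy {B : V → V → ℝ} (hB : IsBilinearMap ℝ B) (hsymm : ∀ v w, B v w = B w v)
    (hpos : ∀ v, 0 ≤ B v v) (v w : V) : |B v w| ≤ (B v v + B w w) / 2 := by
  have h1 := hpos (v + w)
  have h2 := hpos (v + (-1 : ℝ) • w)
  simp only [hB.add_left, hB.add_right, hB.smul_left, hB.smul_right, smul_eq_mul, hsymm w v]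
    at h1 h2
  rw [abs_le]
  constructor <;> linarith

/-- This is the Lebesgue-constant bound in the seminorm of `B`: expand the double sum and bound each
mixed product by `A`. The arithmetic-mean form of Cauchy-Schwarz suffices because all diagonal
values share the bound `A`. -/
theorem bilin_sum_le {ι : Type*} (S : Finset ι) {B : V → V → ℝ} (hB : IsBilinearMap ℝ B)
    (hsymm : ∀ v w, B v w = B w v) (hpos : ∀ v, 0 ≤ B v v) (q : ι → ℝ) (v : ι → V) {A : ℝ}
    (hA : ∀ i ∈ S, B (v i) (v i) ≤ A) :
    B (∑ i ∈ S, q i • v i) (∑ i ∈ S, q i • v i) ≤ (∑ i ∈ S, |q i|) ^ 2 * A := by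
  have : B (∑ i ∈ S, q i • v i) (∑ i ∈ S, q i • v i) =
      ∑ i ∈ S, ∑ j ∈ S, q i * q j * B (v i) (v j) := by
    change hB.toLinearMap _ _ = _
    simp only [map_sum, map_smul, LinearMap.sum_apply, LinearMap.smul_apply, smul_eq_mul,
      Finset.mul_sum]
    rw [Finset.sum_comm]
    refine Finset.sum_congr rfl fun i _ => Finset.sum_congr rfl fun j _ => ?_
    change _ * (_ * B _ _) = _ * B _ _
    ring
  rw [this, sq, Finset.sum_mul_sum, Finset.sum_mul]
  refine Finset.sum_le_sum fun i hi => ?_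
  rw [Finset.sum_mul]
  refine Finset.sum_le_sum fun j hj => ?_
  have h1 := bilin_cauchy hB hsymm hpos (v i) (v j)
  have h2 : |B (v i) (v j)| ≤ A := by linarith [hA i hi, hA j hj]
  calc q i * q j * B (v i) (v j) ≤ |q i * q j * B (v i) (v j)| := le_abs_self _
    _ = |q i| * |q j| * |B (v i) (v j)| := by rw [abs_mul, abs_mul]
    _ ≤ |q i| * |q j| * A := by gcongr

end Paths

/-! ## Integration over a cone -/

/-- `F` lies in the hyperplane at signed distance `h` from `a` in the direction `n`. -/
structure IsConeBase {d : ℕ} (F : Finset (Pt d)) (a n : Pt d) (h : ℝ) : Prop where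
  nonempty : F.Nonempty
  height_pos : 0 < h
  norm_eq : ‖n‖ = 1
  inner_eq : ∀ x ∈ F, inner ℝ (x - a) n = h

/-- The surface measure on a facet. -/
noncomputable def facetMeasure {d : ℕ} (F : Finset (Pt d)) : Measure (Pt d) :=
  (Measure.euclideanHausdorffMeasure (d - 1)).restrict (convexHull ℝ (F : Set (Pt d)))

theorem isCompact_hull {d : ℕ} (F : Finset (Pt d)) : IsCompact (convexHull ℝ (F : Set (Pt d))) :=
  F.finite_toSet.isCompact_convexHull (𝕜 := ℝ)

theorem measurableSet_hull {d : ℕ} (F : Finset (Pt d)) :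
    MeasurableSet (convexHull ℝ (F : Set (Pt d))) :=
  (isCompact_hull F).isClosed.measurableSet

theorem inner_eq_of_mem_hull {d : ℕ} {F : Finset (Pt d)} {a n : Pt d} {h : ℝ}
    (hF : ∀ x ∈ F, inner ℝ (x - a) n = h) {x : Pt d} (hx : x ∈ convexHull ℝ (F : Set (Pt d))) :
    inner ℝ (x - a) n = h := by
  have hc : Convex ℝ {y : Pt d | inner ℝ (y - a) n = h} := by
    have : {y : Pt d | inner ℝ (y - a) n = h} = {y : Pt d | inner ℝ n y = h + inner ℝ n a} := by
      ext y
      simp only [Set.mem_ofPred_eq]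
      rw [real_inner_comm n, inner_sub_right]
      constructor <;> intro h <;> linarith
    rw [this]
    exact convex_hyperplane (innerSL ℝ n).toLinearMap.isLinear _
  exact convexHull_min (fun y hy => hF y hy) hc hx

theorem IsConeBase.inner_hull {d : ℕ} {F : Finset (Pt d)} {a n : Pt d} {h : ℝ}
    (hF : IsConeBase F a n h) {x : Pt d} (hx : x ∈ convexHull ℝ (F : Set (Pt d))) :
    inner ℝ (x - a) n = h := inner_eq_of_mem_hull hF.inner_eq hx

open Classical in
theorem mem_hull_insert_iff {d : ℕ} {F : Finset (Pt d)} (hF : F.Nonempty) (a x : Pt d) :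
    x ∈ convexHull ℝ ((insert a F : Finset (Pt d)) : Set (Pt d)) ↔
      ∃ r ∈ Set.Icc (0 : ℝ) 1, ∃ y ∈ convexHull ℝ (F : Set (Pt d)), a + r • (y - a) = x := by
  rw [Finset.coe_insert, convexHull_insert (by simpa using hF), convexJoin_singleton_left]
  simp only [Set.mem_iUnion, segment_eq_image', Set.mem_image, exists_prop]
  constructor
  · rintro ⟨y, hy, r, hr, h⟩; exact ⟨r, hr, y, hy, h⟩
  · rintro ⟨r, hr, y, hy, h⟩; exact ⟨y, hy, r, hr, h⟩

-- Slice the cone by the hyperplanes orthogonal to `n`. The slice at relative height `r` is a copy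
-- of the base scaled by `r` about the apex, so its measure carries the factor `r ^ (d - 1)`; the
-- factor `h` comes from measuring height in units of `h`.
open Classical in
theorem IsConeBase.volume_inter {d : ℕ} {F : Finset (Pt d)} {a n : Pt d} {h : ℝ}
    (hF : IsConeBase F a n h) {s : Set (Pt d)} (hs : MeasurableSet s) :
    volume (s ∩ convexHull ℝ ((insert a F : Finset (Pt d)) : Set (Pt d))) =
      ∫⁻ r in Set.Ioc (0 : ℝ) 1, ENNReal.ofReal (h * r ^ (d - 1)) *
        facetMeasure F ((fun y => a + r • (y - a)) ⁻¹' s) := by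
  have hh := hF.height_pos
  have hv : h • n ≠ 0 := by
    rw [Ne, smul_eq_zero, not_or]
    exact ⟨hh.ne', fun h0 => by simpa [h0] using hF.norm_eq⟩
  have hvn : ‖h • n‖ₑ = ENNReal.ofReal h := by
    rw [← ofReal_norm, norm_smul, hF.norm_eq, mul_one, Real.norm_of_nonneg hh.le]
  have key := EuclideanGeometry.euclideanHausdorffMeasure_eq_lintegral (P := Pt d) a hv
    (t := s ∩ convexHull ℝ ((insert a F : Finset (Pt d)) : Set (Pt d)))
    (hs.inter (measurableSet_hull _))
  rw [finrank_euclideanSpace_fin, EuclideanSpace.euclideanHausdorffMeasure_eq_volume, hvn] at key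
  rw [key, ← lintegral_const_mul' _ _ ENNReal.ofReal_ne_top,
    ← lintegral_indicator measurableSet_Ioc]
  have hmk : ∀ (r : ℝ) (x : Pt d),
      x ∈ AffineSubspace.mk' (r • h • n +ᵥ a) (Submodule.span ℝ {h • n})ᗮ ↔
        inner ℝ (x - a) n = r * h := by
    intro r x
    rw [AffineSubspace.mem_mk', Submodule.mem_orthogonal_singleton_iff_inner_left, inner_smul_right,
      mul_eq_zero, or_iff_right hh.ne']
    simp only [vsub_eq_sub, vadd_eq_add]
    rw [show x - (r • h • n + a) = (x - a) - (r * h) • n by rw [smul_smul]; abel, inner_sub_left,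
      inner_smul_left, real_inner_self_eq_norm_sq, hF.norm_eq]
    simp [sub_eq_zero]
  have hin : ∀ (r : ℝ) (y : Pt d), y ∈ convexHull ℝ (F : Set (Pt d)) →
      inner ℝ (a + r • (y - a) - a) n = r * h := by
    intro r y hy
    rw [add_sub_cancel_left, inner_smul_left, hF.inner_hull hy]; simp
  -- The height of `a + r' (y - a)` is `r' h`, so the hyperplane at height `r h` selects exactly the
  -- points with parameter `r`.
  have hslice : ∀ r : ℝ, 0 < r → r ≤ 1 →
      (s ∩ convexHull ℝ ((insert a F : Finset (Pt d)) : Set (Pt d))) ∩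
        (AffineSubspace.mk' (r • h • n +ᵥ a) (Submodule.span ℝ {h • n})ᗮ : Set (Pt d)) =
      AffineMap.homothety a r ''
        ((fun y => a + r • (y - a)) ⁻¹' s ∩ convexHull ℝ (F : Set (Pt d))) := by
    intro r hr0 hr1
    ext x
    simp only [Set.mem_inter_iff, SetLike.mem_coe, hmk, mem_hull_insert_iff hF.nonempty,
      Set.mem_image, Set.mem_preimage, AffineMap.homothety_apply, vsub_eq_sub]
    constructor
    · rintro ⟨⟨hxs, r', -, y, hy, rfl⟩, hx⟩
      rw [hin r' y hy] at hx
      obtain rfl := mul_right_cancel₀ hh.ne' hx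
      exact ⟨y, ⟨hxs, hy⟩, add_comm _ _⟩
    · rintro ⟨y, ⟨hys, hy⟩, rfl⟩
      rw [show r • (y - a) +ᵥ a = a + r • (y - a) from add_comm _ _]
      exact ⟨⟨hys, r, ⟨hr0.le, hr1⟩, y, hy, rfl⟩, hin r y hy⟩
  have hae : ∀ᵐ r : ℝ, r ≠ 0 := by simp [ae_iff]
  refine lintegral_congr_ae ?_
  filter_upwards [hae] with r hr
  by_cases hr' : r ∈ Set.Ioc (0 : ℝ) 1
  · rw [Set.indicator_of_mem hr', hslice r hr'.1 hr'.2, euclideanHausdorffMeasure_homothety_image _ _ hr,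
      ENNReal.ofReal_mul hh.le, mul_assoc, facetMeasure, Measure.restrict_apply
        (hs.preimage (by fun_prop)), ENNReal.ofReal_pow hr'.1.le]
    congr 1
    rw [ENNReal.smul_def, smul_eq_mul]
    congr 1
    push_cast
    rw [← Real.enorm_of_nonneg hr'.1.le]
    rfl
  -- For nonzero `r` outside `(0, 1]` the hyperplane misses the cone. The value `r = 0`, where the
  -- slice is the apex, has been discarded as a null set.
  · rw [Set.indicator_of_notMem hr']
    refine mul_eq_zero_of_right _ ?_
    refine measure_mono_null (t := ∅) (fun x hx => (?_ : False).elim) measure_empty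
    revert x
    rintro x ⟨⟨-, hx⟩, hx2⟩
    rw [mem_hull_insert_iff hF.nonempty] at hx
    obtain ⟨r', hr1, y, hy, rfl⟩ := hx
    rw [SetLike.mem_coe, hmk, hin r' y hy] at hx2
    obtain rfl := mul_right_cancel₀ hh.ne' hx2
    exact hr' ⟨lt_of_le_of_ne hr1.1 hr.symm, hr1.2⟩

-- The volume of the compact cone is a positive multiple of the measure of its base, so the base
-- cannot have infinite surface measure.
open Classical in
theorem IsConeBase.isFiniteMeasure {d : ℕ} {F : Finset (Pt d)} {a n : Pt d} {h : ℝ}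
    (hF : IsConeBase F a n h) : IsFiniteMeasure (facetMeasure F) := by
  have key := hF.volume_inter MeasurableSet.univ
  simp only [Set.univ_inter, Set.preimage_univ] at key
  have hfin := (isCompact_hull (insert a F)).measure_lt_top (μ := volume)
  rw [key, lintegral_mul_const _ (by fun_prop)] at hfin
  refine ⟨lt_top_iff_ne_top.2 fun htop => ?_⟩
  rw [htop, ENNReal.mul_top] at hfin
  · exact lt_irrefl _ hfin
  · rw [← ofReal_integral_eq_lintegral_ofReal, ← intervalIntegral.integral_of_le zero_le_one,
      intervalIntegral.integral_const_mul, integral_pow]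
    · rw [Ne, ENNReal.ofReal_eq_zero, not_le]
      have := hF.height_pos
      simp only [one_pow, ne_eq, Nat.add_eq_zero_iff, one_ne_zero, and_false, not_false_eq_true,
        zero_pow, sub_zero]
      positivity
    · exact (by fun_prop : Continuous fun r : ℝ => h * r ^ (d - 1)).integrableOn_Ioc
    · filter_upwards [ae_restrict_mem measurableSet_Ioc] with r hr
      exact mul_nonneg hF.height_pos.le (pow_nonneg hr.1.le _)

-- The slicing formula holds for every measurable set, so it identifies Lebesgue measure on the cone
-- as the image of a product measure under the ray parametrization. Fubini's theorem then applies to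
-- functions.
open Classical in
theorem IsConeBase.restrict_eq_map {d : ℕ} {F : Finset (Pt d)} {a n : Pt d} {h : ℝ}
    (hF : IsConeBase F a n h) :
    volume.restrict (convexHull ℝ ((insert a F : Finset (Pt d)) : Set (Pt d))) =
      (((volume.restrict (Set.Ioc (0 : ℝ) 1)).withDensity
        fun r => ENNReal.ofReal (h * r ^ (d - 1))).prod (facetMeasure F)).map
        fun q : ℝ × Pt d => a + q.1 • (q.2 - a) := by
  have := hF.isFiniteMeasure
  have hm : Measurable fun q : ℝ × Pt d => a + q.1 • (q.2 - a) := by fun_prop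
  ext s hs
  rw [Measure.restrict_apply hs, hF.volume_inter hs, Measure.map_apply hm hs,
    Measure.prod_apply (hm hs), lintegral_withDensity_eq_lintegral_mul _ (by fun_prop)
      (measurable_measure_prodMk_left (hm hs))]
  rfl

open Classical in
/-- Integration over a cone along the rays from its apex. -/
theorem IsConeBase.integral_eq {d : ℕ} {F : Finset (Pt d)} {a n : Pt d} {h : ℝ}
    (hF : IsConeBase F a n h) {g : Pt d → ℝ} (hg : Continuous g) :
    ∫ x in convexHull ℝ ((insert a F : Finset (Pt d)) : Set (Pt d)), g x =
      h * ∫ y, (∫ r in (0 : ℝ)..1, r ^ (d - 1) * g (a + r • (y - a))) ∂facetMeasure F := by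
  have := hF.isFiniteMeasure
  have hm : Measurable fun q : ℝ × Pt d => a + q.1 • (q.2 - a) := by fun_prop
  have hint : IntegrableOn g (convexHull ℝ ((insert a F : Finset (Pt d)) : Set (Pt d))) :=
    hg.continuousOn.integrableOn_compact (isCompact_hull _)
  have hfin : IsFiniteMeasure ((volume.restrict (Set.Ioc (0 : ℝ) 1)).withDensity
        fun r => ENNReal.ofReal (h * r ^ (d - 1))) := by
    apply isFiniteMeasure_withDensity_ofReal
    exact (by fun_prop : Continuous fun r : ℝ => h * r ^ (d - 1)).integrableOn_Ioc.2
  rw [IntegrableOn, hF.restrict_eq_map, integrable_map_measure hg.aestronglyMeasurable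
    hm.aemeasurable] at hint
  rw [hF.restrict_eq_map, integral_map hm.aemeasurable hg.aestronglyMeasurable,
    integral_prod_symm (fun q : ℝ × Pt d => g (a + q.1 • (q.2 - a))) hint, ← integral_const_mul]
  refine integral_congr_ae (Filter.Eventually.of_forall fun y => ?_)
  simp only
  rw [integral_withDensity_eq_integral_toReal_smul (by fun_prop) (by simp),
    intervalIntegral.integral_of_le zero_le_one, ← integral_const_mul]
  refine setIntegral_congr_fun measurableSet_Ioc fun r hr => ?_
  simp only [smul_eq_mul]
  rw [ENNReal.toReal_ofReal (mul_nonneg hF.height_pos.le (pow_nonneg hr.1.le _))]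
  ring

/-! ## Polynomials on lines and cones -/

/-- The restriction of a polynomial to the line `r ↦ a + r v`. -/
noncomputable def linePoly {d : ℕ} (a v : Pt d) (p : MvPolynomial (Fin d) ℝ) : ℝ[X] :=
  MvPolynomial.aeval (fun i => C (a i) + C (v i) * X) p

theorem eval_linePoly {d : ℕ} (a v : Pt d) (p : MvPolynomial (Fin d) ℝ) (r : ℝ) :
    (linePoly a v p).eval r = MvPolynomial.eval (fun j => (a + r • v) j) p := by
  induction p using MvPolynomial.induction_on with
  | C c => simp [linePoly]
  | add p q hp hq => simp only [linePoly, map_add, eval_add] at *; rw [hp, hq]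
  | mul_X p i hp =>
    simp only [linePoly, map_mul, eval_mul] at *
    rw [hp]
    simp only [MvPolynomial.aeval_X, MvPolynomial.eval_X, eval_add, eval_mul, eval_C, eval_X,
      PiLp.add_apply, PiLp.smul_apply, smul_eq_mul]
    ring

theorem natDegree_linePoly_le {d : ℕ} (a v : Pt d) (p : MvPolynomial (Fin d) ℝ) :
    (linePoly a v p).natDegree ≤ p.totalDegree := by
  rw [linePoly, MvPolynomial.aeval_def, MvPolynomial.eval₂_eq]
  refine natDegree_sum_le_of_forall_le _ _ fun m hm => ?_
  refine natDegree_mul_le.trans ?_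
  refine le_trans ?_ (MvPolynomial.le_totalDegree hm)
  rw [show (algebraMap ℝ ℝ[X]) (MvPolynomial.coeff m p) = C (MvPolynomial.coeff m p) from rfl,
    natDegree_C, zero_add, Finsupp.sum]
  refine (natDegree_prod_le _ _).trans (Finset.sum_le_sum fun i _ => ?_)
  refine natDegree_pow_le.trans ?_
  rw [add_comm]
  exact (Nat.mul_le_mul_left _ natDegree_linear_le).trans (by simp)

theorem derivative_linePoly {d : ℕ} (a v : Pt d) (p : MvPolynomial (Fin d) ℝ) :
    derivative (linePoly a v p) = ∑ i, C (v i) * linePoly a v (MvPolynomial.pderiv i p) := by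
  induction p using MvPolynomial.induction_on with
  | C c => simp [linePoly]
  | add p q hp hq =>
    simp only [linePoly, map_add, mul_add, Finset.sum_add_distrib] at *; rw [hp, hq]
  | mul_X p j hp =>
    simp only [linePoly, map_mul, derivative_mul, MvPolynomial.pderiv_mul, map_add,
      MvPolynomial.pderiv_X, mul_add, Finset.sum_add_distrib] at *
    rw [hp, Finset.sum_mul]
    congr 1
    · exact Finset.sum_congr rfl fun i _ => by ring
    · rw [Finset.sum_eq_single j]
      · simp; ring
      · intro i _ hij; simp [Pi.single_eq_of_ne hij.symm]
      · simp

theorem continuous_eval_coord {d : ℕ} (p : MvPolynomial (Fin d) ℝ) :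
    Continuous fun x : Pt d => MvPolynomial.eval (fun j => x j) p :=
  p.continuous_eval.comp (by fun_prop)

theorem continuous_val {d : ℕ} (p : PolyField d) : Continuous (val p) := by
  unfold val
  refine (PiLp.continuous_toLp 2 _).comp (continuous_pi fun i => continuous_eval_coord _)

theorem inner_val {d : ℕ} (p : PolyField d) (x y : Pt d) :
    inner ℝ (val p x) y = ∑ i, MvPolynomial.eval (fun j => x j) (p i) * y i := by
  rw [PiLp.inner_apply]
  exact Finset.sum_congr rfl fun i _ => by simp [val, mul_comm]

theorem integrable_facetMeasure {d : ℕ} {F : Finset (Pt d)} [IsFiniteMeasure (facetMeasure F)]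
    {E : Type*} [NormedAddCommGroup E] [SecondCountableTopologyEither (Pt d) E]
    {g : Pt d → E} (hg : Continuous g) :
    Integrable g (facetMeasure F) := by
  obtain ⟨B, hB⟩ := (isCompact_hull F).exists_bound_of_continuousOn hg.continuousOn
  refine Integrable.of_bound hg.aestronglyMeasurable B ?_
  filter_upwards [ae_restrict_mem (measurableSet_hull F)] with x hx using hB x hx

open Classical in
/-- A discrete trace inequality on a cone, with a constant that depends only on the dimension and
the degree. -/
theorem exists_trace_constant (d k : ℕ) : ∃ C : ℝ, 0 < C ∧
    ∀ (F : Finset (Pt d)) (a n : Pt d) (h : ℝ), IsConeBase F a n h →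
      ∀ p : MvPolynomial (Fin d) ℝ, p.totalDegree ≤ k →
        h * facetIntegral F (fun x => MvPolynomial.eval (fun j => x j) p ^ 2) ≤
          C * ∫ x in convexHull ℝ ((insert a F : Finset (Pt d)) : Set (Pt d)),
            MvPolynomial.eval (fun j => x j) p ^ 2 := by
  obtain ⟨C, hC, hb⟩ := exists_sq_eval_one_le k (d - 1)
  refine ⟨C, hC, fun F a n h hF p hp => ?_⟩
  have := hF.isFiniteMeasure
  rw [hF.integral_eq (g := fun x => MvPolynomial.eval (fun j => x j) p ^ 2)
    ((continuous_eval_coord p).pow 2), mul_left_comm]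
  refine mul_le_mul_of_nonneg_left ?_ hF.height_pos.le
  rw [← integral_const_mul]
  change ∫ x, _ ∂facetMeasure F ≤ _
  have hcont : Continuous fun y : Pt d => C * ∫ r in (0 : ℝ)..1,
      r ^ (d - 1) * MvPolynomial.eval (fun j => (a + r • (y - a)) j) p ^ 2 := by
    refine continuous_const.mul ?_
    apply intervalIntegral.continuous_parametric_intervalIntegral_of_continuous'
    have h1 : Continuous fun q : Pt d × ℝ => a + q.2 • (q.1 - a) := by fun_prop
    exact (continuous_snd.pow _).mul (((continuous_eval_coord p).comp h1).pow 2)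
  refine integral_mono (integrable_facetMeasure ((continuous_eval_coord p).pow 2))
    (integrable_facetMeasure hcont) fun y => ?_
  -- On each ray the restriction has degree at most `k`, and the weight `r ^ (d - 1)` of the
  -- one-dimensional trace estimate is the Jacobian of the cone. The height `h` occurs linearly on
  -- both sides, so no shape dependence enters.
  have h1 := hb (linePoly a (y - a) p) ((natDegree_linePoly_le _ _ _).trans hp)
  simp only [eval_linePoly, one_smul, add_sub_cancel] at h1
  exact h1

open Classical in
/-- The divergence theorem on a cone for a field pointing away from the apex. -/
theorem IsConeBase.integral_radial {d : ℕ} {F : Finset (Pt d)} {a n : Pt d} {h : ℝ}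
    (hF : IsConeBase F a n h) (p : MvPolynomial (Fin d) ℝ) :
    ∫ x in convexHull ℝ ((insert a F : Finset (Pt d)) : Set (Pt d)),
        (d * MvPolynomial.eval (fun j => x j) p + ∑ i, (x i - a i) *
          MvPolynomial.eval (fun j => x j) (MvPolynomial.pderiv i p)) =
      h * facetIntegral F fun x => MvPolynomial.eval (fun j => x j) p := by
  have hd : 0 < d := by
    rcases Nat.eq_zero_or_pos d with rfl | hd
    · have h0 := hF.norm_eq
      rw [Subsingleton.elim n 0] at h0
      simp at h0
    · exact hd
  have hcont : Continuous fun x : Pt d => d * MvPolynomial.eval (fun j => x j) p +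
      ∑ i, (x i - a i) * MvPolynomial.eval (fun j => x j) (MvPolynomial.pderiv i p) := by
    refine (continuous_const.mul (continuous_eval_coord p)).add
      (continuous_finsetSum _ fun i _ => Continuous.mul (by fun_prop) (continuous_eval_coord _))
  rw [hF.integral_eq hcont]
  congr 1
  change _ = ∫ y, _ ∂facetMeasure F
  refine integral_congr_ae (Filter.Eventually.of_forall fun y => ?_)
  simp only
  -- Along a ray the integrand times the Jacobian is the derivative of `r ^ d p(a + r (y - a))`. The
  -- value at the apex vanishes because `d > 0`.
  have hint := intervalIntegral.integral_eq_sub_of_hasDerivAt (a := 0) (b := 1)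
    (f := fun r => (X ^ d * linePoly a (y - a) p).eval r)
    (fun r _ => Polynomial.hasDerivAt _ r) ((Polynomial.continuous _).intervalIntegrable _ _)
  simp only [eval_mul, eval_pow, eval_X, eval_linePoly, one_pow, one_mul, one_smul,
    add_sub_cancel, zero_pow hd.ne', zero_mul, sub_zero] at hint
  rw [← hint]
  refine intervalIntegral.integral_congr fun r _ => ?_
  simp only [derivative_mul, derivative_linePoly, derivative_X_pow, eval_add, eval_mul, eval_pow,
    eval_X, eval_finsetSum, eval_C, eval_linePoly]
  obtain ⟨m, rfl⟩ : ∃ m, d = m + 1 := ⟨d - 1, by omega⟩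
  simp only [Nat.add_sub_cancel, mul_add, Finset.mul_sum]
  congr 1
  · ring
  · refine Finset.sum_congr rfl fun i _ => ?_
    simp only [PiLp.add_apply, PiLp.smul_apply, PiLp.sub_apply, smul_eq_mul]
    ring

/-- Take the barycentric coordinates of `v` minus those of the origin. As the weights sum to zero,
the same weights give `v` from the differences `b - x` for any base point `x`. -/
theorem exists_affine_weights {d : ℕ} {K : Finset (Pt d)} (hcard : K.card = d + 1)
    (hind : AffineIndependent ℝ (fun x : K => (x : Pt d))) (v : Pt d) :
    ∃ γ : Pt d → ℝ, ∑ b ∈ K, γ b = 0 ∧ ∑ b ∈ K, γ b • b = v := by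
  classical
  have htop : affineSpan ℝ (Set.range fun x : K => (x : Pt d)) = ⊤ := by
    rw [hind.affineSpan_eq_top_iff_card_eq_finrank_add_one]
    simp [hcard]
  let β : AffineBasis K ℝ (Pt d) := ⟨_, hind, htop⟩
  refine ⟨fun b => if h : b ∈ K then β.coord ⟨b, h⟩ v - β.coord ⟨b, h⟩ 0 else 0, ?_, ?_⟩
  · rw [← Finset.sum_coe_sort]
    simp only [Finset.coe_mem, dite_true, Subtype.coe_eta, Finset.sum_sub_distrib,
      β.sum_coord_apply_eq_one, sub_self]
  · rw [← Finset.sum_coe_sort]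
    simp only [Finset.coe_mem, dite_true, Subtype.coe_eta, sub_smul, Finset.sum_sub_distrib]
    have h1 := β.linear_combination_coord_eq_self v
    have h2 := β.linear_combination_coord_eq_self 0
    simp only [β] at h1 h2 ⊢
    erw [h1, h2]
    simp

open Classical in
/-- The divergence theorem on a simplex for polynomial fields. -/
theorem integral_divergence {d : ℕ} {K : Finset (Pt d)} (hcard : K.card = d + 1)
    (hind : AffineIndependent ℝ (fun x : K => (x : Pt d))) {N : Pt d → Pt d} {h : Pt d → ℝ}
    (hN : ∀ b ∈ K, IsConeBase (K.erase b) b (N b) (h b)) (q : PolyField d) :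
    ∫ x in convexHull ℝ (K : Set (Pt d)), MvPolynomial.eval (fun j => x j) (divergence q) =
      ∑ b ∈ K, facetIntegral (K.erase b) fun x => inner ℝ (val q x) (N b) := by
  choose γ hγ0 hγ using fun i => exists_affine_weights hcard hind (EuclideanSpace.single i (1 : ℝ))
  -- For weights `γ i` of total zero that represent the basis vector `e_i`, one has `∑ γ i b (x - b)
  -- = -e_i`. Hence `q` is the sum over the vertices `b` of the radial fields `g b (x - b)`, for
  -- which the theorem is already known on cones.
  let g : Pt d → MvPolynomial (Fin d) ℝ := fun b => - ∑ i, MvPolynomial.C (γ i b) * q i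
  let R : Pt d → PolyField d := fun b j => g b * (MvPolynomial.X j - MvPolynomial.C (b j))
  have hq : q = ∑ b ∈ K, R b := by
    funext j
    simp only [Finset.sum_apply, R, g, neg_mul, Finset.sum_mul, Finset.sum_neg_distrib]
    rw [Finset.sum_comm]
    have h1 : ∀ i, ∑ b ∈ K, MvPolynomial.C (γ i b) * q i * (MvPolynomial.X j - MvPolynomial.C (b j))
        = - (if j = i then q i else 0) := by
      intro i
      have e1 : ∑ b ∈ K, MvPolynomial.C (R := ℝ) (σ := Fin d) (γ i b) = 0 := by
        rw [← map_sum, hγ0, map_zero]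
      have e2 : ∑ b ∈ K, MvPolynomial.C (R := ℝ) (σ := Fin d) (γ i b) * MvPolynomial.C (b j) =
          if j = i then 1 else 0 := by
        have := congrArg (fun x : Pt d => x j) (hγ i)
        simp only [WithLp.ofLp_sum, Finset.sum_apply, PiLp.smul_apply, smul_eq_mul] at this
        simp only [← MvPolynomial.C_mul, ← map_sum]
        rw [this]
        by_cases hji : j = i <;> simp [hji]
      calc _ = (∑ b ∈ K, MvPolynomial.C (γ i b)) * (q i * MvPolynomial.X j) -
            q i * ∑ b ∈ K, MvPolynomial.C (γ i b) * MvPolynomial.C (b j) := by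
            rw [Finset.sum_mul, Finset.mul_sum, ← Finset.sum_sub_distrib]
            exact Finset.sum_congr rfl fun b _ => by ring
        _ = _ := by rw [e1, e2]; split_ifs <;> simp
    simp only [h1]
    simp
  have hdiv : ∀ x : Pt d, MvPolynomial.eval (fun j => x j) (divergence q) =
      ∑ b ∈ K, (d * MvPolynomial.eval (fun j => x j) (g b) + ∑ i, (x i - b i) *
          MvPolynomial.eval (fun j => x j) (MvPolynomial.pderiv i (g b))) := by
    intro x
    conv_lhs => rw [hq]
    simp only [divergence, Finset.sum_apply, map_sum]
    rw [Finset.sum_comm]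
    refine Finset.sum_congr rfl fun b _ => ?_
    simp only [R, MvPolynomial.pderiv_mul, map_add, map_sub, MvPolynomial.pderiv_X_self,
      MvPolynomial.pderiv_C, sub_zero, mul_one, map_mul, MvPolynomial.eval_X, MvPolynomial.eval_C,
      Finset.sum_add_distrib]
    rw [add_comm]
    simp [mul_comm]
  simp only [hdiv]
  have hcomp : IsCompact (convexHull ℝ (K : Set (Pt d))) := isCompact_hull K
  rw [integral_finsetSum]
  · have hR : ∀ c ∈ K, facetIntegral (K.erase c) (fun x => inner ℝ (val q x) (N c)) =
        h c * facetIntegral (K.erase c) fun x => MvPolynomial.eval (fun j => x j) (g c) := by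
      intro c hc
      have e0 : ∀ x : Pt d, inner ℝ (val q x) (N c) =
          ∑ b ∈ K, MvPolynomial.eval (fun j => x j) (g b) * inner ℝ (x - b) (N c) := by
        intro x
        conv_lhs => rw [hq]
        rw [inner_val]
        simp only [Finset.sum_apply, map_sum, Finset.sum_mul]
        rw [Finset.sum_comm]
        refine Finset.sum_congr rfl fun b _ => ?_
        rw [PiLp.inner_apply, Finset.mul_sum]
        refine Finset.sum_congr rfl fun i _ => ?_
        simp [R]
        ring
      unfold facetIntegral
      rw [← integral_const_mul]
      refine setIntegral_congr_fun (measurableSet_hull _) fun x hx => ?_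
      simp only
      -- A radial field based at a vertex of this facet is tangential to it, so only the field based
      -- at the opposite vertex `c` has a flux.
      rw [e0, Finset.sum_eq_single c]
      · rw [(hN c hc).inner_hull hx, mul_comm]
      · intro b hb hbc
        have h1 := (hN c hc).inner_hull hx
        have h2 := (hN c hc).inner_eq b (Finset.mem_erase.2 ⟨hbc, hb⟩)
        rw [show x - b = (x - c) - (b - c) by abel, inner_sub_left, h1, h2, sub_self, mul_zero]
      · exact fun hc' => absurd hc hc'
    rw [Finset.sum_congr rfl hR]
    refine Finset.sum_congr rfl fun b hb => ?_
    have := (hN b hb).integral_radial (g b)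
    rwa [Finset.insert_erase hb] at this
  · intro b _
    refine (Continuous.continuousOn ?_).integrableOn_compact hcomp
    refine (continuous_const.mul (continuous_eval_coord _)).add
      (continuous_finsetSum _ fun i _ => Continuous.mul (by fun_prop) (continuous_eval_coord _))

/-! ## Facets of a conforming mesh -/

section MeshGeometry

variable {d : ℕ} {M : SimplicialMesh d}

theorem mem_facets_iff {F : Finset (Pt d)} :
    F ∈ M.facets ↔ ∃ K ∈ M.elems, F ⊆ K ∧ F.card = d := by
  simp [SimplicialMesh.facets, Finset.mem_powersetCard]

theorem card_of_mem_facets {F : Finset (Pt d)} (hF : F ∈ M.facets) : F.card = d := by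
  obtain ⟨K, -, -, h⟩ := mem_facets_iff.1 hF
  exact h

theorem nonempty_of_mem_facets (hd : 0 < d) {F : Finset (Pt d)} (hF : F ∈ M.facets) :
    F.Nonempty := by
  rw [← Finset.card_pos, card_of_mem_facets hF]; exact hd

open Classical in
theorem exists_eq_insert {F K : Finset (Pt d)} (hK : K ∈ M.elems) (hFK : F ⊆ K)
    (hF : F.card = d) : ∃ a ∉ F, K = insert a F := by
  have h1 : (K \ F).card = 1 := by
    rw [Finset.card_sdiff_of_subset hFK, M.card_eq K hK, hF]; omega
  obtain ⟨a, ha⟩ := Finset.card_eq_one.1 h1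
  have haF : a ∈ K \ F := by rw [ha]; simp
  refine ⟨a, (Finset.mem_sdiff.1 haF).2, ?_⟩
  rw [Finset.insert_eq, ← ha, Finset.sdiff_union_of_subset hFK]

open Classical in
/-- Two elements on the same side of a common facet coincide. -/
theorem eq_of_same_side {F K L : Finset (Pt d)} (hd : 0 < d) (hK : K ∈ M.elems) (hL : L ∈ M.elems)
    (hF : F.card = d) {a b n x : Pt d} (haF : a ∉ F) (hbF : b ∉ F) (hKa : K = insert a F)
    (hLb : L = insert b F) (hn : ∀ y ∈ F, inner ℝ (y - x) n = 0)
    (ha : inner ℝ (a - x) n < 0) (hb : inner ℝ (b - x) n < 0) : K = L := by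
  by_contra hne
  have hd' : (0 : ℝ) < d := by exact_mod_cast hd
  have hyb : ∀ y ∈ F, y ≠ b := fun y hy h => hbF (by rwa [h] at hy)
  -- The plan is to start at the barycentre of `F` and move slightly towards `a`. The resulting
  -- point lies in both simplices but off the hyperplane of `F`, against conformity.
  set c : Pt d := (d : ℝ)⁻¹ • ∑ y ∈ F, y with hc
  have hcn : inner ℝ (c - x) n = 0 := by
    have : c - x = (d : ℝ)⁻¹ • ∑ y ∈ F, (y - x) := by
      rw [Finset.sum_sub_distrib, Finset.sum_const, hF, smul_sub, ← Nat.cast_smul_eq_nsmul ℝ,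
        smul_smul, inv_mul_cancel₀ hd'.ne', one_smul]
    rw [this, inner_smul_left, sum_inner, Finset.sum_eq_zero hn, mul_zero]
  have hcF : c ∈ convexHull ℝ (F : Set (Pt d)) := by
    rw [hc, Finset.smul_sum]
    refine (convex_convexHull ℝ _).sum_mem (fun _ _ => by positivity) ?_
      fun y hy => subset_convexHull ℝ _ hy
    rw [Finset.sum_const, hF, nsmul_eq_mul, mul_inv_cancel₀ hd'.ne']
  obtain ⟨γ, hγ0, hγ⟩ := exists_affine_weights (M.card_eq L hL) (M.indep L hL) (a - c)
  have hdist : ∀ v : Pt d, ∑ y ∈ L, γ y * inner ℝ (y - v) n = inner ℝ (a - c) n := by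
    intro v
    rw [← hγ, sum_inner]
    simp only [inner_sub_left, mul_sub, inner_smul_left, Finset.sum_sub_distrib]
    rw [← Finset.sum_mul, hγ0]
    simp
  have hac : inner ℝ (a - c) n = inner ℝ (a - x) n := by
    rw [show a - c = (a - x) - (c - x) by abel, inner_sub_left, hcn, sub_zero]
  -- In the direction `n` only the vertex `b` contributes, so `γ b` times the negative offset of `b`
  -- is the negative offset of `a`.
  have hγb : 0 < γ b := by
    have h1 := hdist x
    rw [hLb, Finset.sum_insert hbF, Finset.sum_eq_zero fun y hy => by rw [hn y hy, mul_zero],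
      add_zero, hac] at h1
    by_contra h0
    have := mul_nonneg_of_nonpos_of_nonpos (not_lt.1 h0) hb.le
    linarith
  set S := ∑ y ∈ F, |γ y| with hS
  have hS0 : 0 ≤ S := Finset.sum_nonneg fun _ _ => abs_nonneg _
  -- This choice gives `ε S ≤ 1 / d`, so the weights `1 / d + ε γ y` at the vertices of `F` stay
  -- nonnegative; the weight at `b` is `ε γ b > 0`.
  set ε : ℝ := (1 + d * S)⁻¹ with hε
  have hden : 0 < 1 + d * S := by positivity
  have hε0 : 0 < ε := inv_pos.2 hden
  have hε1 : ε ≤ 1 := inv_le_one_of_one_le₀ (by nlinarith)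
  set p : Pt d := c + ε • (a - c) with hp
  have hpK : p ∈ convexHull ℝ (K : Set (Pt d)) := by
    have h1 : c ∈ convexHull ℝ (K : Set (Pt d)) :=
      convexHull_mono (by rw [hKa]; simp) hcF
    have h2 : a ∈ convexHull ℝ (K : Set (Pt d)) := subset_convexHull ℝ _ (by rw [hKa]; simp)
    exact (convex_convexHull ℝ _).add_smul_sub_mem h1 h2 ⟨hε0.le, hε1⟩
  have hpL : p ∈ convexHull ℝ (L : Set (Pt d)) := by
    have h1 : p = ∑ y ∈ L, ((if y = b then 0 else (d : ℝ)⁻¹) + ε * γ y) • y := by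
      simp only [add_smul, Finset.sum_add_distrib, mul_smul, ← Finset.smul_sum, hγ]
      rw [hp, hc]
      congr 1
      rw [hLb, Finset.sum_insert hbF, Finset.smul_sum]
      simp only [if_true, zero_smul, zero_add]
      exact Finset.sum_congr rfl fun y hy => by rw [if_neg (hyb y hy)]
    rw [h1]
    refine (convex_convexHull ℝ _).sum_mem (fun y hy => ?_) ?_ fun y hy => subset_convexHull ℝ _ hy
    · split_ifs with h
      · rw [h]; positivity
      · have hyF : y ∈ F := by
          rw [hLb, Finset.mem_insert] at hy
          exact hy.resolve_left h
        have h2 : |γ y| ≤ S := Finset.single_le_sum (f := fun y => |γ y|)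
          (fun _ _ => abs_nonneg _) hyF
        have h3 := neg_abs_le (γ y)
        have h4 : ε * S ≤ (d : ℝ)⁻¹ := by
          rw [hε, inv_mul_le_iff₀ hden]
          field_simp
          linarith
        nlinarith
    · rw [Finset.sum_add_distrib, ← Finset.mul_sum, hγ0, mul_zero, add_zero, hLb,
        Finset.sum_insert hbF, if_pos rfl, zero_add,
        Finset.sum_congr rfl fun y hy => if_neg (hyb y hy), Finset.sum_const, hF,
        nsmul_eq_mul, mul_inv_cancel₀ hd'.ne']
  have hab : a ≠ b := fun h => hne (by rw [hKa, hLb, h])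
  have hinter : (K : Set (Pt d)) ∩ (L : Set (Pt d)) = F := by
    ext y
    simp only [hKa, hLb, Finset.coe_insert, Set.mem_inter_iff, Set.mem_insert_iff, Finset.mem_coe]
    constructor
    · rintro ⟨rfl | h, h' | h'⟩
      · exact absurd h' hab
      · exact h'
      · exact h
      · exact h
    · exact fun h => ⟨Or.inr h, Or.inr h⟩
  have hpF := M.conforming K hK L hL ⟨hpK, hpL⟩
  rw [hinter] at hpF
  have h1 := inner_eq_of_mem_hull hn hpF
  have h2 : inner ℝ (p - x) n = ε * inner ℝ (a - x) n := by
    rw [hp, show c + ε • (a - c) - x = (c - x) + ε • (a - c) by abel, inner_add_left, hcn,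
      inner_smul_left, hac]
    simp
  rw [h2] at h1
  nlinarith

/-! ### Outward normals and sums over facets -/

variable (O : FacetOrientation M)

/-- The outward unit normal of the element `K` on its facet `F`. -/
noncomputable def outwardNormal (K F : Finset (Pt d)) : Pt d :=
  open Classical in if K = O.plus F then O.normal F else -O.normal F

-- The normal is a combination of the vertices of `K` with total weight zero. If the opposite vertex
-- lay in the plane of `F`, all its contributions would be orthogonal to the normal, which would
-- then be orthogonal to itself.
open Classical in
theorem inner_normal_ne_zero {F K : Finset (Pt d)} (hK : K ∈ M.elems)
    (hF : F ∈ M.facets) {a x : Pt d} (hKa : K = insert a F) (hx : x ∈ F) :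
    inner ℝ (a - x) (O.normal F) ≠ 0 := by
  intro h0
  obtain ⟨γ, hγ0, hγ⟩ := exists_affine_weights (M.card_eq K hK) (M.indep K hK) (O.normal F)
  have h1 : ∀ m, inner ℝ (O.normal F) m = ∑ y ∈ K, γ y * inner ℝ (y - x) m := by
    intro m
    rw [← hγ, sum_inner]
    simp only [inner_sub_left, mul_sub, inner_smul_left, Finset.sum_sub_distrib]
    rw [← Finset.sum_mul, hγ0]
    simp
  specialize h1 (O.normal F)
  rw [Finset.sum_eq_zero, real_inner_self_eq_norm_sq, O.normal_norm F hF] at h1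
  · norm_num at h1
  · intro y hy
    rw [hKa, Finset.mem_insert] at hy
    rcases hy with rfl | hy
    · rw [h0, mul_zero]
    · rw [O.normal_orth F hF y hy x hx, mul_zero]

-- The orientation prescribes the side only for `plus F`. For any other element, the apex must lie
-- on the opposite side of the facet, since two elements on the same side coincide.
open Classical in
theorem isConeBase_outwardNormal {F K : Finset (Pt d)} (hd : 0 < d) (hK : K ∈ M.elems)
    (hF : F ∈ M.facets) {a : Pt d} (haF : a ∉ F) (hKa : K = insert a F) :
    ∃ h, IsConeBase F a (outwardNormal O K F) h := by
  obtain ⟨x, hx⟩ := nonempty_of_mem_facets hd hF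
  have horth : ∀ y ∈ F, inner ℝ (y - x) (O.normal F) = 0 :=
    fun y hy => O.normal_orth F hF y hy x hx
  have hout : ∀ y ∈ F, inner ℝ (y - x) (outwardNormal O K F) = 0 := by
    intro y hy
    unfold outwardNormal
    split_ifs <;> simp [inner_neg_right, horth y hy]
  refine ⟨inner ℝ (x - a) (outwardNormal O K F), ⟨x, hx⟩, ?_, ?_, fun y hy => ?_⟩
  · unfold outwardNormal
    rw [show x - a = -(a - x) by abel, inner_neg_left]
    split_ifs with hp
    · have := O.normal_outward F hF x hx a (by rw [← hp, hKa]; simp) haF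
      linarith
    · rw [inner_neg_right, neg_neg]
      by_contra h0
      obtain ⟨hP, hFP⟩ := O.plus_mem F hF
      obtain ⟨b, hbF, hPb⟩ := exists_eq_insert hP hFP (card_of_mem_facets hF)
      have hb := O.normal_outward F hF x hx b (by rw [hPb]; simp) hbF
      exact hp (eq_of_same_side hd hK hP (card_of_mem_facets hF) haF hbF hKa hPb horth
        (lt_of_le_of_ne (not_lt.1 h0) (inner_normal_ne_zero O hK hF hKa hx)) hb)
  · unfold outwardNormal
    split_ifs <;> simp [O.normal_norm F hF]
  · rw [show y - a = (y - x) + (x - a) by abel, inner_add_left, hout y hy, zero_add]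

theorem isFiniteMeasure_facetMeasure (O : FacetOrientation M) (hd : 0 < d) {F : Finset (Pt d)} (hF : F ∈ M.facets) :
    IsFiniteMeasure (facetMeasure F) := by
  classical
  obtain ⟨K, hK, hFK, hc⟩ := mem_facets_iff.1 hF
  obtain ⟨a, haF, hKa⟩ := exists_eq_insert hK hFK hc
  obtain ⟨h, hb⟩ := isConeBase_outwardNormal O hd hK hF haF hKa
  exact hb.isFiniteMeasure

open Classical in
/-- The elements that contain a given facet. -/
theorem filter_elems_eq (hd : 0 < d) {F : Finset (Pt d)} (hF : F ∈ M.facets) :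
    M.elems.filter (F ⊆ ·) =
      if F ∈ M.interiorFacets then {O.plus F, O.minus F} else {O.plus F} := by
  obtain ⟨hP, hFP⟩ := O.plus_mem F hF
  have hc := card_of_mem_facets hF
  ext K
  simp only [Finset.mem_filter]
  split_ifs with hI
  · obtain ⟨hm, hFm, hmp⟩ := O.minus_mem F hI
    simp only [Finset.mem_insert, Finset.mem_singleton]
    constructor
    · rintro ⟨hK, hFK⟩
      by_cases hp : K = O.plus F
      · exact Or.inl hp
      -- Both `K` and `minus F` differ from `plus F`, so both lie on the other side of the facet and
      -- coincide.
      right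
      obtain ⟨x, hx⟩ := nonempty_of_mem_facets hd hF
      obtain ⟨a, haF, hKa⟩ := exists_eq_insert hK hFK hc
      obtain ⟨b, hbF, hmb⟩ := exists_eq_insert hm hFm hc
      obtain ⟨h1, c1⟩ := isConeBase_outwardNormal O hd hK hF haF hKa
      obtain ⟨h2, c2⟩ := isConeBase_outwardNormal O hd hm hF hbF hmb
      rw [outwardNormal, if_neg hp] at c1
      rw [outwardNormal, if_neg hmp] at c2
      refine eq_of_same_side (n := -O.normal F) (x := x) hd hK hm hc haF hbF hKa hmb
        (fun y hy => ?_) ?_ ?_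
      · rw [inner_neg_right, O.normal_orth F hF y hy x hx, neg_zero]
      · rw [← neg_sub, inner_neg_left, c1.inner_eq x hx]
        linarith [c1.height_pos]
      · rw [← neg_sub, inner_neg_left, c2.inner_eq x hx]
        linarith [c2.height_pos]
    · rintro (rfl | rfl)
      · exact ⟨hP, hFP⟩
      · exact ⟨hm, hFm⟩
  · simp only [Finset.mem_singleton]
    constructor
    · rintro ⟨hK, hFK⟩
      by_contra hne
      exact hI (Finset.mem_filter.2 ⟨hF, K, hK, O.plus F, hP, hne, hFK, hFP⟩)
    · rintro rfl
      exact ⟨hP, hFP⟩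

open Classical in
/-- Sums over the facets of all elements, as sums over the facets of the mesh. -/
theorem sum_elems_facets (hd : 0 < d) (G : Finset (Pt d) → Finset (Pt d) → ℝ) :
    ∑ K ∈ M.elems, ∑ a ∈ K, G K (K.erase a) =
      ∑ F ∈ M.facets, if F ∈ M.interiorFacets then G (O.plus F) F + G (O.minus F) F
        else G (O.plus F) F := by
  have h1 : ∀ K ∈ M.elems, ∑ a ∈ K, G K (K.erase a) =
      ∑ F ∈ M.facets.filter (· ⊆ K), G K F := by
    intro K hK
    refine Finset.sum_bij (fun a _ => K.erase a) ?_ ?_ ?_ fun _ _ => rfl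
    · intro a ha
      refine Finset.mem_filter.2 ⟨mem_facets_iff.2 ⟨K, hK, K.erase_subset a, ?_⟩, K.erase_subset a⟩
      rw [Finset.card_erase_of_mem ha, M.card_eq K hK]; rfl
    · intro a ha b hb hab
      by_contra hne
      have : b ∈ K.erase a := Finset.mem_erase.2 ⟨Ne.symm hne, hb⟩
      rw [hab] at this
      simp at this
    · intro F hF
      obtain ⟨hF, hFK⟩ := Finset.mem_filter.1 hF
      obtain ⟨a, haF, hKa⟩ := exists_eq_insert hK hFK (card_of_mem_facets hF)
      exact ⟨a, by rw [hKa]; simp, by rw [hKa, Finset.erase_insert haF]⟩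
  rw [Finset.sum_congr rfl h1]
  simp only [Finset.sum_filter]
  rw [Finset.sum_comm]
  refine Finset.sum_congr rfl fun F hF => ?_
  rw [← Finset.sum_filter, filter_elems_eq O hd hF]
  split_ifs with hI
  · rw [Finset.sum_pair (O.minus_mem F hI).2.2.symm]
  · rw [Finset.sum_singleton]

theorem erase_mem_facets {K : Finset (Pt d)} (hK : K ∈ M.elems) {a : Pt d} (ha : a ∈ K) :
    open Classical in K.erase a ∈ M.facets := by
  classical
  refine mem_facets_iff.2 ⟨K, hK, K.erase_subset a, ?_⟩
  rw [Finset.card_erase_of_mem ha, M.card_eq K hK]; rfl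

open Classical in
/-- The divergence theorem on the mesh. -/
theorem meshIntegral_divergence (hd : 0 < d) (q : BrokenField d) :
    meshIntegral M (fun K x => MvPolynomial.eval (fun j => x j) (divergence (q K))) =
      ∑ F ∈ M.facets, if F ∈ M.interiorFacets then
          facetIntegral F (fun x => inner ℝ (val (q (O.plus F)) x) (O.normal F)) -
            facetIntegral F (fun x => inner ℝ (val (q (O.minus F)) x) (O.normal F))
        else facetIntegral F (fun x => inner ℝ (val (q (O.plus F)) x) (O.normal F)) := by
  have h1 : ∀ K ∈ M.elems, ∫ x in convexHull ℝ (K : Set (Pt d)),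
      MvPolynomial.eval (fun j => x j) (divergence (q K)) = ∑ a ∈ K,
        facetIntegral (K.erase a) fun x => inner ℝ (val (q K) x)
          (outwardNormal O K (K.erase a)) := by
    intro K hK
    have : ∀ b : Pt d, ∃ h, b ∈ K → IsConeBase (K.erase b) b (outwardNormal O K (K.erase b)) h := by
      intro b
      by_cases hb : b ∈ K
      · obtain ⟨h, hh⟩ := isConeBase_outwardNormal O hd hK (erase_mem_facets hK hb)
          (Finset.notMem_erase b K) (Finset.insert_erase hb).symm
        exact ⟨h, fun _ => hh⟩
      · exact ⟨0, fun h => absurd h hb⟩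
    choose h hh using this
    exact integral_divergence (M.card_eq K hK) (M.indep K hK) (h := h) hh (q K)
  rw [meshIntegral, Finset.sum_congr rfl h1, sum_elems_facets O hd
    (fun K F => facetIntegral F fun x => inner ℝ (val (q K) x) (outwardNormal O K F))]
  refine Finset.sum_congr rfl fun F hF => ?_
  split_ifs with hI
  · rw [outwardNormal, if_pos rfl, outwardNormal, if_neg (O.minus_mem F hI).2.2, sub_eq_add_neg]
    congr 1
    simp only [inner_neg_right, facetIntegral, integral_neg]
  · rw [outwardNormal, if_pos rfl]

/-- The height of an element over a facet is comparable to the diameter of the facet. -/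
theorem facetDiam_le_height {ρ : ℝ} (hM : M.ShapeRegular ρ) {K F : Finset (Pt d)}
    (hK : K ∈ M.elems) {a n : Pt d} {h : ℝ} (hc : IsConeBase F a n h)
    (hKa : open Classical in K = insert a F) : facetDiam F ≤ |ρ| * h := by
  classical
  obtain ⟨x, r, hr, hball, hdiam⟩ := hM K hK
  have h1 : ∀ y ∈ convexHull ℝ (K : Set (Pt d)), 0 ≤ inner ℝ (y - a) n ∧ inner ℝ (y - a) n ≤ h := by
    intro y hy
    rw [hKa, mem_hull_insert_iff hc.nonempty] at hy
    obtain ⟨s, hs, z, hz, rfl⟩ := hy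
    have hh := hc.height_pos
    rw [add_sub_cancel_left, inner_smul_left, hc.inner_hull hz]
    simp only [conj_trivial]
    exact ⟨mul_nonneg hs.1 hh.le, by nlinarith [hs.2]⟩
  -- The ends of the diameter of the inscribed ball in direction `n` lie in `K`. Their heights
  -- differ by `2 r` and range in `[0, h]`, whence `2 r ≤ h`.
  have h2 := h1 (x + r • n) (hball (by simp [norm_smul, hc.norm_eq, abs_of_pos hr]))
  have h3 := h1 (x - r • n) (hball (by simp [norm_smul, hc.norm_eq, abs_of_pos hr]))
  have h4 : 2 * r ≤ h := by
    have e : inner ℝ (x + r • n - a) n - inner ℝ (x - r • n - a) n = 2 * r := by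
      rw [← inner_sub_left, show x + r • n - a - (x - r • n - a) = (2 * r) • n by
        rw [two_mul, add_smul]; abel, inner_smul_left, real_inner_self_eq_norm_sq, hc.norm_eq]
      simp
    linarith [h2.2, h3.1]
  calc facetDiam F ≤ Metric.diam (convexHull ℝ (K : Set (Pt d))) :=
        Metric.diam_mono (convexHull_mono (by rw [hKa]; simp)) (isCompact_hull K).isBounded
    _ ≤ ρ * (2 * r) := hdiam
    _ ≤ |ρ| * h := mul_le_mul (le_abs_self _) h4 (by positivity) (abs_nonneg _)

theorem facetDiam_pos (hd : 2 ≤ d) {F : Finset (Pt d)} (hF : F ∈ M.facets) : 0 < facetDiam F := by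
  have h1 : 1 < F.card := by rw [card_of_mem_facets hF]; omega
  obtain ⟨x, hx, y, hy, hxy⟩ := Finset.one_lt_card.1 h1
  refine (dist_pos.2 hxy).trans_le (Metric.dist_le_diam_of_mem (isCompact_hull F).isBounded
    (subset_convexHull ℝ _ hx) (subset_convexHull ℝ _ hy))

end MeshGeometry

/-! ## Bilinear forms on broken fields -/

section Bilinear

variable {V : Type*} [AddCommGroup V] [Module ℝ V]

theorem isBilinearMap_add {b₁ b₂ : V → V → ℝ} (h₁ : IsBilinearMap ℝ b₁)
    (h₂ : IsBilinearMap ℝ b₂) : IsBilinearMap ℝ fun v w => b₁ v w + b₂ v w where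
  add_left _ _ _ := by rw [h₁.add_left, h₂.add_left]; ring
  smul_left _ _ _ := by rw [h₁.smul_left, h₂.smul_left, smul_add]
  add_right _ _ _ := by rw [h₁.add_right, h₂.add_right]; ring
  smul_right _ _ _ := by rw [h₁.smul_right, h₂.smul_right, smul_add]

theorem isBilinearMap_const_mul {b : V → V → ℝ} (c : ℝ) (h : IsBilinearMap ℝ b) :
    IsBilinearMap ℝ fun v w => c * b v w where
  add_left _ _ _ := by rw [h.add_left, mul_add]
  smul_left _ _ _ := by rw [h.smul_left, smul_eq_mul, smul_eq_mul]; ring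
  add_right _ _ _ := by rw [h.add_right, mul_add]
  smul_right _ _ _ := by rw [h.smul_right, smul_eq_mul, smul_eq_mul]; ring

theorem isBilinearMap_sub {b₁ b₂ : V → V → ℝ} (h₁ : IsBilinearMap ℝ b₁)
    (h₂ : IsBilinearMap ℝ b₂) : IsBilinearMap ℝ fun v w => b₁ v w - b₂ v w where
  add_left _ _ _ := by rw [h₁.add_left, h₂.add_left]; ring
  smul_left _ _ _ := by rw [h₁.smul_left, h₂.smul_left, smul_sub]
  add_right _ _ _ := by rw [h₁.add_right, h₂.add_right]; ring
  smul_right _ _ _ := by rw [h₁.smul_right, h₂.smul_right, smul_sub]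

theorem isBilinearMap_sum {ι : Type*} {S : Finset ι} {b : ι → V → V → ℝ}
    (h : ∀ i ∈ S, IsBilinearMap ℝ (b i)) : IsBilinearMap ℝ fun v w => ∑ i ∈ S, b i v w where
  add_left _ _ _ := by
    rw [← Finset.sum_add_distrib]
    exact Finset.sum_congr rfl fun i hi => (h i hi).add_left _ _ _
  smul_left _ _ _ := by
    rw [Finset.smul_sum]
    exact Finset.sum_congr rfl fun i hi => (h i hi).smul_left _ _ _
  add_right _ _ _ := by
    rw [← Finset.sum_add_distrib]
    exact Finset.sum_congr rfl fun i hi => (h i hi).add_right _ _ _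
  smul_right _ _ _ := by
    rw [Finset.smul_sum]
    exact Finset.sum_congr rfl fun i hi => (h i hi).smul_right _ _ _

end Bilinear

/-- A continuous function on space that depends linearly on a broken field. -/
structure IsLinearField {d : ℕ} {E : Type*} [NormedAddCommGroup E] [NormedSpace ℝ E]
    (φ : BrokenField d → Pt d → E) : Prop where
  map_add : ∀ v w x, φ (v + w) x = φ v x + φ w x
  map_smul : ∀ (c : ℝ) v x, φ (c • v) x = c • φ v x
  continuous : ∀ v, Continuous (φ v)

/-- Each term of the spatial forms integrates an inner product of two such fields over an element or
a facet. Their bilinearity, which the quadrature in time requires, follows from this one fact. -/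
theorem IsLinearField.isBilinearMap {d : ℕ} {E : Type*} [NormedAddCommGroup E]
    [InnerProductSpace ℝ E] {φ ψ : BrokenField d → Pt d → E} (hφ : IsLinearField φ)
    (hψ : IsLinearField ψ) {μ : Measure (Pt d)}
    (hμ : ∀ g : Pt d → ℝ, Continuous g → Integrable g μ) :
    IsBilinearMap ℝ fun v w => ∫ x, inner ℝ (φ v x) (ψ w x) ∂μ := by
  have hi : ∀ v w, Integrable (fun x => inner ℝ (φ v x) (ψ w x)) μ :=
    fun v w => hμ _ ((hφ.continuous v).inner (hψ.continuous w))
  constructor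
  · intro v w z
    simp only [hφ.map_add, inner_add_left]
    exact integral_add (hi _ _) (hi _ _)
  · intro c v w
    simp only [hφ.map_smul, inner_smul_left, conj_trivial, integral_const_mul, smul_eq_mul]
  · intro v w z
    simp only [hψ.map_add, inner_add_right]
    exact integral_add (hi _ _) (hi _ _)
  · intro c v w
    simp only [hψ.map_smul, inner_smul_right, integral_const_mul, smul_eq_mul]

/-! ### The concrete fields, forms and norms in space -/

section Fields

variable {d : ℕ} {M : SimplicialMesh d} (O : FacetOrientation M)

theorem val_add (p q : PolyField d) (x : Pt d) : val (p + q) x = val p x + val q x := by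
  ext i; simp [val]

theorem val_smul (c : ℝ) (p : PolyField d) (x : Pt d) : val (c • p) x = c • val p x := by
  ext i; simp [val]

theorem grad_add (p q : PolyField d) (x : Pt d) : grad (p + q) x = grad p x + grad q x := by
  ext i j; simp [grad]

theorem grad_smul (c : ℝ) (p : PolyField d) (x : Pt d) : grad (c • p) x = c • grad p x := by
  ext i j; simp [grad]

theorem matVec_add_left (A B : Matrix (Fin d) (Fin d) ℝ) (x : Pt d) :
    matVec (A + B) x = matVec A x + matVec B x := by
  ext i; simp [matVec, add_mul, Finset.sum_add_distrib]

theorem matVec_smul_left (c : ℝ) (A : Matrix (Fin d) (Fin d) ℝ) (x : Pt d) :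
    matVec (c • A) x = c • matVec A x := by
  ext i; simp [matVec, Finset.mul_sum, mul_assoc]

theorem continuous_grad (p : PolyField d) (i j : Fin d) : Continuous fun x => grad p x i j :=
  continuous_eval_coord _

theorem isLinearField_val (K : Finset (Pt d)) : IsLinearField fun v x => val (v K) x where
  map_add _ _ _ := val_add _ _ _
  map_smul _ _ _ := val_smul _ _ _
  continuous _ := continuous_val _

theorem isLinearField_gradMatVec (K : Finset (Pt d)) {g : Pt d → Pt d} (hg : Continuous g) :
    IsLinearField fun v x => matVec (grad (v K) x) (g x) where
  map_add _ _ _ := by simp only [Pi.add_apply, grad_add, matVec_add_left]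
  map_smul _ _ _ := by simp only [Pi.smul_apply, grad_smul, matVec_smul_left]
  continuous v := by
    refine (PiLp.continuous_toLp 2 _).comp (continuous_pi fun i => continuous_finsetSum _
      fun j _ => (continuous_grad _ i j).mul ?_)
    fun_prop

theorem IsLinearField.add {E : Type*} [NormedAddCommGroup E] [NormedSpace ℝ E]
    {φ ψ : BrokenField d → Pt d → E} (hφ : IsLinearField φ) (hψ : IsLinearField ψ) :
    IsLinearField fun v x => φ v x + ψ v x where
  map_add _ _ _ := by rw [hφ.map_add, hψ.map_add]; abel
  map_smul _ _ _ := by rw [hφ.map_smul, hψ.map_smul, smul_add]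
  continuous _ := (hφ.continuous _).add (hψ.continuous _)

theorem IsLinearField.smul {E : Type*} [NormedAddCommGroup E] [NormedSpace ℝ E]
    {φ : BrokenField d → Pt d → E} {g : Pt d → ℝ} (hg : Continuous g) (hφ : IsLinearField φ) :
    IsLinearField fun v x => g x • φ v x where
  map_add _ _ _ := by rw [hφ.map_add, smul_add]
  map_smul _ _ _ := by rw [hφ.map_smul, smul_comm]
  continuous _ := hg.smul (hφ.continuous _)

theorem isLinearField_jump (F : Finset (Pt d)) : IsLinearField fun v x => jump O v F x := by
  unfold jump
  split_ifs
  · have := (isLinearField_val (O.plus F)).add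
      ((isLinearField_val (O.minus F)).smul (g := fun _ => -1) continuous_const)
    simpa only [neg_smul, one_smul, ← sub_eq_add_neg] using this
  · exact isLinearField_val _

theorem isLinearField_average (F : Finset (Pt d)) :
    IsLinearField fun v x => average O v F x := by
  unfold average
  split_ifs
  · exact ((isLinearField_val (O.plus F)).add (isLinearField_val (O.minus F))).smul
      (g := fun _ => 1 / 2) continuous_const
  · exact isLinearField_val _

theorem isLinearField_gradAverage (F : Finset (Pt d)) (n : Pt d) :
    IsLinearField fun v x => matVec (gradAverage O v F x) n := by
  unfold gradAverage
  split_ifs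
  · simp only [matVec_add_left, matVec_smul_left]
    exact ((isLinearField_gradMatVec (O.plus F) (g := fun _ => n) continuous_const).add
      (isLinearField_gradMatVec (O.minus F) (g := fun _ => n) continuous_const)).smul
      (g := fun _ => 1 / 2) continuous_const
  · exact isLinearField_gradMatVec _ (g := fun _ => n) continuous_const

theorem integrable_hull (K : Finset (Pt d)) (g : Pt d → ℝ) (hg : Continuous g) :
    Integrable g (volume.restrict (convexHull ℝ (K : Set (Pt d)))) :=
  hg.continuousOn.integrableOn_compact (isCompact_hull K)

theorem integrable_facet (O : FacetOrientation M) (hd : 0 < d) {F : Finset (Pt d)}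
    (hF : F ∈ M.facets) (g : Pt d → ℝ) (hg : Continuous g) :
    Integrable g ((Measure.euclideanHausdorffMeasure (d - 1)).restrict
      (convexHull ℝ (F : Set (Pt d)))) := by
  have := isFiniteMeasure_facetMeasure O hd hF
  exact integrable_facetMeasure hg

theorem isBilinearMap_innerL2 : IsBilinearMap ℝ (innerL2 M) := by
  unfold innerL2 meshIntegral
  exact isBilinearMap_sum fun K _ =>
    (isLinearField_val K).isBilinearMap (isLinearField_val K) (integrable_hull K)

theorem innerL2_comm (v w : BrokenField d) : innerL2 M v w = innerL2 M w v := by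
  simp only [innerL2, real_inner_comm]

theorem innerL2_self (v : BrokenField d) : innerL2 M v v = normL2Sq M v := by
  simp only [innerL2, normL2Sq, real_inner_self_eq_norm_sq]

theorem meshIntegral_nonneg {g : Finset (Pt d) → Pt d → ℝ} (hg : ∀ K x, 0 ≤ g K x) :
    0 ≤ meshIntegral M g :=
  Finset.sum_nonneg fun _ _ => integral_nonneg fun _ => hg _ _

theorem normL2Sq_nonneg (v : BrokenField d) : 0 ≤ normL2Sq M v :=
  meshIntegral_nonneg fun _ _ => sq_nonneg _

/-- The gradient as an element of a Euclidean space. -/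
noncomputable def gradVec (p : PolyField d) (x : Pt d) : EuclideanSpace ℝ (Fin d × Fin d) :=
  WithLp.toLp 2 fun ij => grad p x ij.1 ij.2

theorem inner_gradVec (p q : PolyField d) (x : Pt d) :
    inner ℝ (gradVec p x) (gradVec q x) = ∑ i, ∑ j, grad p x i j * grad q x i j := by
  rw [PiLp.inner_apply, Fintype.sum_prod_type]
  simp [gradVec, mul_comm]

theorem isLinearField_gradVec (K : Finset (Pt d)) :
    IsLinearField fun (v : BrokenField d) x => gradVec (v K) x where
  map_add _ _ _ := by ext i; simp [gradVec, grad_add]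
  map_smul _ _ _ := by ext i; simp [gradVec, grad_smul]
  continuous v := (PiLp.continuous_toLp 2 _).comp (continuous_pi fun i => continuous_grad _ _ _)

theorem isBilinearMap_gradForm :
    IsBilinearMap ℝ fun v w : BrokenField d =>
      meshIntegral M fun K x => ∑ i, ∑ j, grad (v K) x i j * grad (w K) x i j := by
  simp only [← inner_gradVec]
  unfold meshIntegral
  exact isBilinearMap_sum fun K _ => (isLinearField_gradVec K).isBilinearMap
    (isLinearField_gradVec K) (integrable_hull K)

theorem isBilinearMap_jumpForm (hd : 0 < d) (c : Finset (Pt d) → ℝ) :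
    IsBilinearMap ℝ fun v w : BrokenField d => ∑ F ∈ M.facets, facetIntegral F fun x =>
      c F * inner ℝ (jump O v F x) (jump O w F x) := by
  unfold facetIntegral
  simp only [integral_const_mul]
  exact isBilinearMap_sum fun F hF => isBilinearMap_const_mul _
    ((isLinearField_jump O F).isBilinearMap (isLinearField_jump O F) (integrable_facet O hd hF))

theorem isBilinearMap_penaltyForm (hd : 0 < d) (σ : ℝ) : IsBilinearMap ℝ (penaltyForm O σ) := by
  unfold penaltyForm
  refine isBilinearMap_add (isBilinearMap_sub (isBilinearMap_sub isBilinearMap_gradForm ?_) ?_)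
    (isBilinearMap_jumpForm O hd _)
  · exact isBilinearMap_sum fun F hF => (isLinearField_gradAverage O F _).isBilinearMap
      (isLinearField_jump O F) (integrable_facet O hd hF)
  · exact isBilinearMap_sum fun F hF => (isLinearField_jump O F).isBilinearMap
      (isLinearField_gradAverage O F _) (integrable_facet O hd hF)

/-- The bilinear form whose quadratic form is `penaltyNormSq`. -/
noncomputable def penaltyInner (σ : ℝ) (v w : BrokenField d) : ℝ :=
  (meshIntegral M fun K x => ∑ i, ∑ j, grad (v K) x i j * grad (w K) x i j) +
    ∑ F ∈ M.facets, facetIntegral F fun x =>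
      σ * (facetDiam F)⁻¹ * inner ℝ (jump O v F x) (jump O w F x)

theorem isBilinearMap_penaltyInner (hd : 0 < d) (σ : ℝ) : IsBilinearMap ℝ (penaltyInner O σ) :=
  isBilinearMap_add isBilinearMap_gradForm (isBilinearMap_jumpForm O hd _)

theorem penaltyInner_self (σ : ℝ) (v : BrokenField d) :
    penaltyInner O σ v v = penaltyNormSq O σ v := by
  simp only [penaltyInner, penaltyNormSq, real_inner_self_eq_norm_sq, sq]

/-! ## Coercivity of the interior penalty form -/

theorem totalDegree_pderiv_le (p : MvPolynomial (Fin d) ℝ) (i : Fin d) :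
    (MvPolynomial.pderiv i p).totalDegree ≤ p.totalDegree := by
  conv_lhs => rw [p.as_sum, map_sum]
  refine MvPolynomial.totalDegree_finsetSum_le fun m hm => ?_
  rw [MvPolynomial.pderiv_monomial]
  refine (MvPolynomial.totalDegree_monomial_le _ _).trans ?_
  refine le_trans ?_ (MvPolynomial.le_totalDegree hm)
  change Finsupp.degree _ ≤ Finsupp.degree _
  exact Finsupp.degree_mono tsub_le_self

theorem IsLocalVelocity.totalDegree_le {fam : VelocityFamily} {k : ℕ} {p : PolyField d}
    (hp : IsLocalVelocity fam k p) (i : Fin d) : (p i).totalDegree ≤ k + 1 := by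
  cases fam with
  | RT =>
    obtain ⟨q, r, hq, hr, h⟩ := hp
    rw [h]
    refine (MvPolynomial.totalDegree_add _ _).trans (max_le ((hq i).trans (by omega)) ?_)
    refine (MvPolynomial.totalDegree_mul _ _).trans ?_
    rw [MvPolynomial.totalDegree_X]
    omega
  | BDM => exact (hp i).trans (by omega)

theorem norm_matVec_sq_le (A : Matrix (Fin d) (Fin d) ℝ) {n : Pt d} (hn : ‖n‖ = 1) :
    ‖matVec A n‖ ^ 2 ≤ ∑ i, ∑ j, A i j ^ 2 := by
  rw [EuclideanSpace.norm_sq_eq]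
  refine Finset.sum_le_sum fun i _ => ?_
  have h1 : ∑ j, n j ^ 2 = 1 := by
    have := EuclideanSpace.norm_sq_eq n
    rw [hn] at this
    simpa using this.symm
  have h2 := Finset.sum_mul_sq_le_sq_mul_sq Finset.univ (fun j => A i j) fun j => n j
  rw [h1, mul_one] at h2
  simpa [matVec] using h2

theorem continuous_gradSq (p : PolyField d) :
    Continuous fun x => ∑ i, ∑ j, grad p x i j ^ 2 :=
  continuous_finsetSum _ fun i _ => continuous_finsetSum _ fun j _ => (continuous_grad p i j).pow 2

theorem integral_gradSq {μ : Measure (Pt d)} (hμ : ∀ g : Pt d → ℝ, Continuous g → Integrable g μ)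
    (p : PolyField d) : ∫ x, (∑ i, ∑ j, grad p x i j ^ 2) ∂μ =
      ∑ i, ∑ j, ∫ x, grad p x i j ^ 2 ∂μ := by
  have h1 : ∀ i j, Integrable (fun x => grad p x i j ^ 2) μ :=
    fun i j => hμ _ ((continuous_grad p i j).pow 2)
  rw [integral_finsetSum _ fun i _ => integrable_finsetSum _ fun j _ => h1 i j]
  exact Finset.sum_congr rfl fun i _ => integral_finsetSum _ fun j _ => h1 i j

theorem two_mul_integral_le {μ : Measure (Pt d)} {f p m g : Pt d → ℝ} (hf : Integrable f μ)
    (hp : Integrable p μ) (hm : Integrable m μ) (hg : Integrable g μ) (c e : ℝ)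
    (h : ∀ x, 2 * f x ≤ c * (p x + m x) + e * g x) :
    2 * ∫ x, f x ∂μ ≤ c * (∫ x, p x ∂μ + ∫ x, m x ∂μ) + e * ∫ x, g x ∂μ := by
  have hpm : Integrable (fun x => c * (p x + m x)) μ := (hp.add hm).const_mul c
  have := integral_mono (hf.const_mul 2) (hpm.add (hg.const_mul e)) h
  rw [integral_const_mul, integral_add' hpm (hg.const_mul e), integral_const_mul,
    integral_const_mul, integral_add hp hm] at this
  exact this

theorem facetIntegral_nonneg {F : Finset (Pt d)} {g : Pt d → ℝ} (hg : ∀ x, 0 ≤ g x) :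
    0 ≤ facetIntegral F g := integral_nonneg hg

-- The trace inequality holds with the height of `K` over the facet, for each entry of the gradient.
-- Shape regularity trades that height for the facet diameter at the price `|ρ|`.
open Classical in
theorem facet_gradSq_le {k : ℕ} {C ρ : ℝ} (hd : 0 < d)
    (hC : ∀ (F : Finset (Pt d)) (a n : Pt d) (h : ℝ), IsConeBase F a n h →
      ∀ p : MvPolynomial (Fin d) ℝ, p.totalDegree ≤ k →
        h * facetIntegral F (fun x => MvPolynomial.eval (fun j => x j) p ^ 2) ≤
          C * ∫ x in convexHull ℝ ((insert a F : Finset (Pt d)) : Set (Pt d)),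
            MvPolynomial.eval (fun j => x j) p ^ 2)
    (O : FacetOrientation M) (hM : M.ShapeRegular ρ) {K : Finset (Pt d)} (hK : K ∈ M.elems)
    {a : Pt d} (ha : a ∈ K) {p : PolyField d} (hp : ∀ i, (p i).totalDegree ≤ k) :
    facetDiam (K.erase a) * facetIntegral (K.erase a) (fun x => ∑ i, ∑ j, grad p x i j ^ 2) ≤
      |ρ| * C * ∫ x in convexHull ℝ (K : Set (Pt d)), ∑ i, ∑ j, grad p x i j ^ 2 := by
  have hF := erase_mem_facets hK ha
  obtain ⟨h, hc⟩ := isConeBase_outwardNormal O hd hK hF (Finset.notMem_erase a K)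
    (Finset.insert_erase ha).symm
  have h1 : h * facetIntegral (K.erase a) (fun x => ∑ i, ∑ j, grad p x i j ^ 2) ≤
      C * ∫ x in convexHull ℝ (K : Set (Pt d)), ∑ i, ∑ j, grad p x i j ^ 2 := by
    rw [facetIntegral, integral_gradSq (integrable_facet O hd hF), integral_gradSq
      (integrable_hull K), Finset.mul_sum, Finset.mul_sum]
    refine Finset.sum_le_sum fun i _ => ?_
    rw [Finset.mul_sum, Finset.mul_sum]
    refine Finset.sum_le_sum fun j _ => ?_
    have := hC _ _ _ _ hc (MvPolynomial.pderiv j (p i)) ((totalDegree_pderiv_le _ _).trans (hp i))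
    rwa [Finset.insert_erase ha] at this
  calc _ ≤ |ρ| * h * facetIntegral (K.erase a) (fun x => ∑ i, ∑ j, grad p x i j ^ 2) :=
        mul_le_mul_of_nonneg_right
          (facetDiam_le_height hM hK hc (Finset.insert_erase ha).symm)
          (facetIntegral_nonneg fun x => by positivity)
    _ ≤ _ := by
        rw [mul_assoc, mul_assoc]
        exact mul_le_mul_of_nonneg_left h1 (abs_nonneg _)

-- Young's inequality with weight `c`. The square of an average is at most the sum of the squares, a
-- crude bound that treats interior and boundary facets alike.
open Classical in
theorem two_inner_gradAverage_jump_le {F : Finset (Pt d)} (hF : F ∈ M.facets)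
    (v : BrokenField d) (x : Pt d) {c : ℝ} (hc : 0 < c) :
    2 * inner ℝ (matVec (gradAverage O v F x) (O.normal F)) (jump O v F x) ≤
      c * (∑ i, ∑ j, grad (v (O.plus F)) x i j ^ 2 +
        if F ∈ M.interiorFacets then ∑ i, ∑ j, grad (v (O.minus F)) x i j ^ 2 else 0) +
      c⁻¹ * ‖jump O v F x‖ ^ 2 := by
  set y := matVec (gradAverage O v F x) (O.normal F) with hy
  set z := jump O v F x
  have h1 : 2 * inner ℝ y z ≤ c * ‖y‖ ^ 2 + c⁻¹ * ‖z‖ ^ 2 := by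
    have h2 := real_inner_le_norm y z
    have h3 : c * ‖y‖ ^ 2 + c⁻¹ * ‖z‖ ^ 2 - 2 * (‖y‖ * ‖z‖) = c⁻¹ * (c * ‖y‖ - ‖z‖) ^ 2 := by
      field_simp
      ring
    have h4 : 0 ≤ c⁻¹ * (c * ‖y‖ - ‖z‖) ^ 2 := by positivity
    linarith
  have h5 : ‖y‖ ^ 2 ≤ ∑ i, ∑ j, grad (v (O.plus F)) x i j ^ 2 +
        if F ∈ M.interiorFacets then ∑ i, ∑ j, grad (v (O.minus F)) x i j ^ 2 else 0 := by
    refine (norm_matVec_sq_le _ (O.normal_norm F hF)).trans ?_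
    unfold gradAverage
    split_ifs
    · rw [← Finset.sum_add_distrib]
      refine Finset.sum_le_sum fun i _ => ?_
      rw [← Finset.sum_add_distrib]
      refine Finset.sum_le_sum fun j _ => ?_
      simp only [Matrix.smul_apply, Matrix.add_apply, smul_eq_mul]
      nlinarith [sq_nonneg (grad (v (O.plus F)) x i j - grad (v (O.minus F)) x i j),
        sq_nonneg (grad (v (O.plus F)) x i j), sq_nonneg (grad (v (O.minus F)) x i j)]
    · rw [add_zero]
  have := mul_le_mul_of_nonneg_left h5 hc.le
  linarith

/-- Coercivity of the symmetric interior penalty form for a large penalty parameter. -/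
theorem exists_penalty_threshold (d : ℕ) (hd : 2 ≤ d) (fam : VelocityFamily) (k : ℕ) (ρ : ℝ) :
    ∃ σ₀ : ℝ, 0 < σ₀ ∧ ∀ (M : SimplicialMesh d) (O : FacetOrientation M) (σ : ℝ), σ₀ ≤ σ →
      M.ShapeRegular ρ → ∀ v : BrokenField d, (∀ K ∈ M.elems, IsLocalVelocity fam k (v K)) →
        penaltyNormSq O σ v ≤ 2 * penaltyForm O σ v v := by
  classical
  obtain ⟨C, hC, htr⟩ := exists_trace_constant d (k + 1)
  -- An element has `d + 1` facets, so the gradient part of the consistency terms is at most `(2 /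
  -- σ) (d + 1) |ρ| C A`. This is at most `A / 2` once `σ ≥ 4 (d + 1) |ρ| C`; the added 1 keeps the
  -- threshold positive.
  refine ⟨4 * (d + 1) * (|ρ| * C) + 1, by positivity, fun M O σ hσ hM v hv => ?_⟩
  have hd0 : 0 < d := by omega
  have hρC : 0 ≤ |ρ| * C := by positivity
  have hσ0 : 0 < σ := lt_of_lt_of_le (by positivity) hσ
  set A := meshIntegral M fun K x => ∑ i, ∑ j, (grad (v K) x i j) ^ 2 with hA
  have hA0 : 0 ≤ A := meshIntegral_nonneg fun _ _ => by positivity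
  let J : Finset (Pt d) → ℝ := fun F =>
    facetIntegral F fun x => σ * (facetDiam F)⁻¹ * ‖jump O v F x‖ ^ 2
  let T : Finset (Pt d) → ℝ := fun F => facetIntegral F fun x =>
    inner ℝ (matVec (gradAverage O v F x) (O.normal F)) (jump O v F x)
  let G : Finset (Pt d) → Finset (Pt d) → ℝ := fun K F =>
    facetDiam F * facetIntegral F fun x => ∑ i, ∑ j, grad (v K) x i j ^ 2
  have hform : penaltyForm O σ v v = A - ∑ F ∈ M.facets, T F - ∑ F ∈ M.facets, T F +
      ∑ F ∈ M.facets, J F := by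
    simp only [penaltyForm, A, T, J, real_inner_self_eq_norm_sq, ← sq]
    congr 2
    exact Finset.sum_congr rfl fun F _ => by simp only [real_inner_comm]
  have hTF : ∀ F ∈ M.facets, 2 * T F ≤ (2 / σ) * (if F ∈ M.interiorFacets then
      G (O.plus F) F + G (O.minus F) F else G (O.plus F) F) + 1 / 2 * J F := by
    intro F hF
    have hF0 := facetDiam_pos hd hF
    -- With the Young weight `2 h_F / σ` the jump part of the bound is exactly half of the penalty
    -- term on `F`.
    have hc : 0 < 2 / σ * facetDiam F := by positivity
    have hi := integrable_facet O hd0 hF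
    have i1 := hi _ (continuous_gradSq (v (O.plus F)))
    have i2 := hi _ (continuous_gradSq (v (O.minus F)))
    have i3 : Integrable (fun x => ‖jump O v F x‖ ^ 2) _ :=
      hi _ (((isLinearField_jump O F).continuous v).norm.pow 2)
    have i4 := hi _ (((isLinearField_gradAverage O F (O.normal F)).continuous v).inner
      ((isLinearField_jump O F).continuous v))
    have hpt := fun x => two_inner_gradAverage_jump_le O hF v x hc
    have hJ : J F = σ * (facetDiam F)⁻¹ * facetIntegral F fun x => ‖jump O v F x‖ ^ 2 :=
      integral_const_mul _ _
    have hc' : (2 / σ * facetDiam F)⁻¹ = 1 / 2 * (σ * (facetDiam F)⁻¹) := by field_simp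
    rw [hJ]
    split_ifs with hI
    · simp only [if_pos hI] at hpt
      refine (two_mul_integral_le i4 i1 i2 i3 _ _ hpt).trans (le_of_eq ?_)
      simp only [G, facetIntegral, hc']
      ring
    · simp only [if_neg hI] at hpt
      refine (two_mul_integral_le i4 i1 (integrable_zero _ _ _) i3 _ _ hpt).trans (le_of_eq ?_)
      simp only [G, facetIntegral, hc', Pi.zero_apply, integral_zero]
      ring
  have hsum : ∑ F ∈ M.facets, 2 * T F ≤ (2 / σ) * (∑ K ∈ M.elems, ∑ a ∈ K, G K (K.erase a)) +
      1 / 2 * ∑ F ∈ M.facets, J F := by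
    rw [sum_elems_facets O hd0 G, Finset.mul_sum, Finset.mul_sum, ← Finset.sum_add_distrib]
    exact Finset.sum_le_sum hTF
  have hG : ∑ K ∈ M.elems, ∑ a ∈ K, G K (K.erase a) ≤ (d + 1) * (|ρ| * C) * A := by
    rw [hA, meshIntegral, Finset.mul_sum]
    refine Finset.sum_le_sum fun K hK => ?_
    refine (Finset.sum_le_card_nsmul _ _ _ fun a ha =>
      facet_gradSq_le hd0 htr O hM hK ha fun i => (hv K hK).totalDegree_le i).trans ?_
    rw [M.card_eq K hK, nsmul_eq_mul, ← mul_assoc]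
    push_cast
    exact le_rfl
  have h2 : (2 / σ) * (∑ K ∈ M.elems, ∑ a ∈ K, G K (K.erase a)) ≤ 1 / 2 * A := by
    refine (mul_le_mul_of_nonneg_left hG (by positivity)).trans ?_
    rw [← mul_assoc]
    refine mul_le_mul_of_nonneg_right ?_ hA0
    rw [div_mul_eq_mul_div, div_le_iff₀ hσ0]
    linarith
  rw [hform, penaltyNormSq]
  rw [← Finset.mul_sum] at hsum
  change A + ∑ F ∈ M.facets, J F ≤ _
  linarith

end Fields

/-! ## The convective form at a fixed time -/

section Convection

variable {d : ℕ} {M : SimplicialMesh d} (O : FacetOrientation M)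

theorem mem_facets_of_mem_interiorFacets {F : Finset (Pt d)} (hF : F ∈ M.interiorFacets) :
    F ∈ M.facets := by
  classical
  exact (Finset.mem_filter.1 hF).1

/-- The volume part of the convective form. -/
noncomputable def convVolume (M : SimplicialMesh d) (w v z : BrokenField d) : ℝ :=
  meshIntegral M fun K x => inner ℝ (matVec (grad (v K) x) (val (w K) x)) (val (z K) x)

/-- The consistency part of the convective form. -/
noncomputable def convFlux (w v z : BrokenField d) : ℝ :=
  ∑ F ∈ M.interiorFacets, facetIntegral F fun x =>
    inner ℝ ((inner ℝ (val (w (O.plus F)) x) (O.normal F) : ℝ) • jump O v F x) (average O z F x)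

/-- The upwind part of the convective form. -/
noncomputable def convUpwind (cS : ℝ) (w v z : BrokenField d) : ℝ :=
  ∑ F ∈ M.interiorFacets, facetIntegral F fun x =>
    inner ℝ (upwindCoeff O cS w F • jump O v F x) (jump O z F x)

theorem continuous_normalComponent (p : PolyField d) (n : Pt d) :
    Continuous fun x => (inner ℝ (val p x) n : ℝ) := (continuous_val p).inner continuous_const

theorem isBilinearMap_convVolume (w : BrokenField d) : IsBilinearMap ℝ (convVolume M w) :=
  isBilinearMap_sum fun K _ => (isLinearField_gradMatVec K (continuous_val _)).isBilinearMap
    (isLinearField_val K) (integrable_hull K)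

theorem isBilinearMap_convFlux (hd : 0 < d) (w : BrokenField d) :
    IsBilinearMap ℝ (convFlux O w) :=
  isBilinearMap_sum fun F hF => ((isLinearField_jump O F).smul
    (continuous_normalComponent _ _)).isBilinearMap (isLinearField_average O F)
    (integrable_facet O hd (mem_facets_of_mem_interiorFacets hF))

theorem isBilinearMap_convUpwind (hd : 0 < d) (cS : ℝ) (w : BrokenField d) :
    IsBilinearMap ℝ (convUpwind O cS w) :=
  isBilinearMap_sum fun F hF => ((isLinearField_jump O F).smul
    (g := fun _ => upwindCoeff O cS w F) continuous_const).isBilinearMap (isLinearField_jump O F)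
    (integrable_facet O hd (mem_facets_of_mem_interiorFacets hF))

theorem convUpwind_self (cS : ℝ) (w v : BrokenField d) : convUpwind O cS w v v =
    ∑ F ∈ M.interiorFacets, upwindCoeff O cS w F * facetIntegral F fun x => ‖jump O v F x‖ ^ 2 := by
  simp only [convUpwind, inner_smul_left, conj_trivial, real_inner_self_eq_norm_sq]
  exact Finset.sum_congr rfl fun F _ => integral_const_mul _ _

theorem convUpwind_self_nonneg {cS : ℝ} (hc : 0 ≤ cS) (w v : BrokenField d) :
    0 ≤ convUpwind O cS w v v := by
  rw [convUpwind_self]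
  exact Finset.sum_nonneg fun F _ => mul_nonneg (hc.trans (le_max_left _ _))
    (facetIntegral_nonneg fun _ => sq_nonneg _)

/-! ### Discrete spaces as submodules and skew-symmetry of convection -/

/-- The space `V_h` as a submodule. -/
noncomputable def velocitySubmodule (fam : VelocityFamily) (k : ℕ) : Submodule ℝ (BrokenField d) where
  carrier := velocitySpace O fam k
  zero_mem' := by
    have h0 : ∀ x : Pt d, val (0 : PolyField d) x = 0 := fun x => by ext i; simp [val]
    refine ⟨fun K _ => ?_, fun F _ x _ => by simp [h0]⟩
    cases fam with
    | RT => exact ⟨0, 0, by simp, by simp, by simp⟩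
    | BDM => intro i; simp
  add_mem' := by
    rintro v w ⟨hv, hvn⟩ ⟨hw, hwn⟩
    refine ⟨fun K hK => ?_, fun F hF x hx => ?_⟩
    · have h1 := hv K hK
      have h2 := hw K hK
      cases fam with
      | RT =>
        obtain ⟨q, r, hq, hr, h⟩ := h1
        obtain ⟨q', r', hq', hr', h'⟩ := h2
        refine ⟨q + q', r + r', fun i => (MvPolynomial.totalDegree_add _ _).trans
          (max_le (hq i) (hq' i)), (MvPolynomial.totalDegree_add _ _).trans (max_le hr hr'),
          fun i => ?_⟩
        simp only [Pi.add_apply, h, h']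
        ring
      | BDM => exact fun i => (MvPolynomial.totalDegree_add _ _).trans (max_le (h1 i) (h2 i))
    · simp only [Pi.add_apply, val_add, inner_add_left, hvn F hF x hx, hwn F hF x hx]
  smul_mem' := by
    rintro c v ⟨hv, hvn⟩
    refine ⟨fun K hK => ?_, fun F hF x hx => ?_⟩
    · have h1 := hv K hK
      cases fam with
      | RT =>
        obtain ⟨q, r, hq, hr, h⟩ := h1
        refine ⟨c • q, c • r, fun i => (MvPolynomial.totalDegree_smul_le _ _).trans (hq i),
          (MvPolynomial.totalDegree_smul_le _ _).trans hr, fun i => ?_⟩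
        simp only [Pi.smul_apply, h, smul_add, mul_smul_comm]
      | BDM => exact fun i => (MvPolynomial.totalDegree_smul_le _ _).trans (h1 i)
    · simp only [Pi.smul_apply, val_smul, inner_smul_left, hvn F hF x hx]

/-- The divergence-free fields with zero normal component on the boundary. -/
noncomputable def solenoidalSubmodule : Submodule ℝ (BrokenField d) where
  carrier := {v | (∀ F ∈ M.boundaryFacets, ∀ x ∈ convexHull ℝ (F : Set (Pt d)),
      inner ℝ (val (v (O.plus F)) x) (O.normal F) = 0) ∧
    ∀ K ∈ M.elems, divergence (v K) = 0}
  zero_mem' := by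
    have h0 : ∀ x : Pt d, val (0 : PolyField d) x = 0 := fun x => by ext i; simp [val]
    exact ⟨fun F _ x _ => by simp [h0], fun K _ => by simp [divergence]⟩
  add_mem' := by
    rintro v w ⟨hv0, hvd⟩ ⟨hw0, hwd⟩
    refine ⟨fun F hF x hx => ?_, fun K hK => ?_⟩
    · simp only [Pi.add_apply, val_add, inner_add_left, hv0 F hF x hx, hw0 F hF x hx, add_zero]
    · have h1 := hvd K hK
      have h2 := hwd K hK
      simp only [divergence] at h1 h2
      simp only [divergence, Pi.add_apply, map_add, Finset.sum_add_distrib, h1, h2, add_zero]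
  smul_mem' := by
    rintro c v ⟨hv0, hvd⟩
    refine ⟨fun F hF x hx => ?_, fun K hK => ?_⟩
    · simp only [Pi.smul_apply, val_smul, inner_smul_left, hv0 F hF x hx, mul_zero]
    · have h1 := hvd K hK
      simp only [divergence] at h1
      simp only [divergence, Pi.smul_apply, Derivation.map_smul, ← Finset.smul_sum, h1, smul_zero]

/-- The divergence-free fields in `V_h` with zero normal component on the boundary. -/
noncomputable def kernelSubmodule (fam : VelocityFamily) (k : ℕ) : Submodule ℝ (BrokenField d) :=
  velocitySubmodule O fam k ⊓ solenoidalSubmodule O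

/-- The kinetic energy flux `w |v|² / 2`. -/
noncomputable def energyFlux (w v : PolyField d) : PolyField d :=
  fun i => MvPolynomial.C (1 / 2) * w i * ∑ j, v j * v j

/-- The product rule gives two terms, and the one with the divergence of `w` vanishes. The volume
part of convection is thus the integral of a divergence. -/
theorem eval_divergence_energyFlux {w : PolyField d} (hw : divergence w = 0) (v : PolyField d)
    (x : Pt d) : MvPolynomial.eval (fun j => x j) (divergence (energyFlux w v)) =
      inner ℝ (matVec (grad v x) (val w x)) (val v x) := by
  have h1 : ∀ i, MvPolynomial.eval (fun j => x j) (MvPolynomial.pderiv i (energyFlux w v i)) =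
      (1 / 2 * MvPolynomial.eval (fun j => x j) (∑ j, v j * v j)) *
          MvPolynomial.eval (fun j => x j) (MvPolynomial.pderiv i (w i)) +
        ∑ j, MvPolynomial.eval (fun j => x j) (MvPolynomial.pderiv i (v j)) *
          MvPolynomial.eval (fun j => x j) (w i) * MvPolynomial.eval (fun j => x j) (v j) := by
    intro i
    have h2 : MvPolynomial.eval (fun j => x j) (MvPolynomial.pderiv i (∑ j, v j * v j)) =
        2 * ∑ j, MvPolynomial.eval (fun j => x j) (MvPolynomial.pderiv i (v j)) *
          MvPolynomial.eval (fun j => x j) (v j) := by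
      rw [map_sum, map_sum, Finset.mul_sum]
      refine Finset.sum_congr rfl fun j _ => ?_
      rw [MvPolynomial.pderiv_mul, map_add, map_mul, map_mul]
      ring
    rw [energyFlux, MvPolynomial.pderiv_mul, MvPolynomial.pderiv_mul, MvPolynomial.pderiv_C,
      zero_mul, zero_add, map_add, map_mul, map_mul, map_mul, map_mul, h2, MvPolynomial.eval_C]
    have h3 : ∑ j, MvPolynomial.eval (fun j => x j) (MvPolynomial.pderiv i (v j)) *
          MvPolynomial.eval (fun j => x j) (w i) * MvPolynomial.eval (fun j => x j) (v j) =
        MvPolynomial.eval (fun j => x j) (w i) *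
          ∑ j, MvPolynomial.eval (fun j => x j) (MvPolynomial.pderiv i (v j)) *
          MvPolynomial.eval (fun j => x j) (v j) := by
      rw [Finset.mul_sum]
      exact Finset.sum_congr rfl fun j _ => by ring
    rw [h3]
    ring
  have h4 : ∑ i, MvPolynomial.eval (fun j => x j) (MvPolynomial.pderiv i (w i)) = 0 := by
    rw [← map_sum]
    change MvPolynomial.eval _ (divergence w) = 0
    rw [hw, map_zero]
  rw [divergence, map_sum, Finset.sum_congr rfl fun i _ => h1 i, Finset.sum_add_distrib,
    ← Finset.mul_sum, h4, mul_zero, zero_add, Finset.sum_comm, real_inner_comm, inner_val]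
  refine Finset.sum_congr rfl fun j _ => ?_
  rw [← Finset.sum_mul, mul_comm]
  rfl

theorem inner_energyFlux (w v : PolyField d) (x n : Pt d) :
    inner ℝ (val (energyFlux w v) x) n = 1 / 2 * inner ℝ (val w x) n * ‖val v x‖ ^ 2 := by
  rw [inner_val, inner_val, EuclideanSpace.norm_sq_eq, mul_assoc, Finset.sum_mul, Finset.mul_sum]
  refine Finset.sum_congr rfl fun i _ => ?_
  simp only [energyFlux, map_mul, MvPolynomial.eval_C, map_sum, val, Real.norm_eq_abs, sq_abs]
  simp only [sq]
  ring

/-- The consistent part of the convective form vanishes on the diagonal. -/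
theorem convVolume_eq_convFlux (hd : 0 < d) {fam : VelocityFamily} {k : ℕ} {w : BrokenField d}
    (hw : w ∈ kernelSubmodule O fam k) (v : BrokenField d) :
    convVolume M w v v = convFlux O w v v := by
  classical
  obtain ⟨⟨-, hn⟩, h0, hdiv⟩ := hw
  have h1 : convVolume M w v v = meshIntegral M fun K x =>
      MvPolynomial.eval (fun j => x j) (divergence (energyFlux (w K) (v K))) := by
    refine Finset.sum_congr rfl fun K hK => ?_
    simp only [eval_divergence_energyFlux (hdiv K hK)]
  rw [h1, meshIntegral_divergence O hd (fun K => energyFlux (w K) (v K)), convFlux,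
    SimplicialMesh.interiorFacets, Finset.sum_filter]
  refine Finset.sum_congr rfl fun F hF => ?_
  by_cases hI : M.IsShared F
  · have hI' : F ∈ M.interiorFacets := Finset.mem_filter.2 ⟨hF, hI⟩
    rw [if_pos hI, if_pos (Finset.mem_filter.2 ⟨hF, hI⟩)]
    have hi := integrable_facet O hd hF
    unfold facetIntegral
    rw [← integral_sub (hi _ (continuous_normalComponent _ _))
      (hi _ (continuous_normalComponent _ _))]
    refine setIntegral_congr_fun (measurableSet_hull F) fun x hx => ?_
    -- The normal component of `w` is the same from both sides, and half the difference of `|v|²`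
    -- across the facet is the jump of `v` times its average.
    simp only [inner_energyFlux, jump, average, if_pos hI', ← hn F hI' x hx, inner_smul_left,
      inner_smul_right, inner_sub_left, inner_add_right, conj_trivial, real_inner_self_eq_norm_sq,
      real_inner_comm (val (v (O.plus F)) x) (val (v (O.minus F)) x)]
    ring
  · have hI' : F ∉ M.interiorFacets := fun h => hI (Finset.mem_filter.1 h).2
    rw [if_neg hI, if_neg (fun h => hI (Finset.mem_filter.1 h).2), facetIntegral]
    rw [setIntegral_congr_fun (g := fun _ => (0 : ℝ)) (measurableSet_hull F)]
    · simp
    · intro x hx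
      simp only [inner_energyFlux, h0 F (Finset.mem_filter.2 ⟨hF, hI⟩) x hx, mul_zero, zero_mul]

end Convection

/-! ## The pairing with square-integrable functions -/

section Pairing

variable {d : ℕ} {M : SimplicialMesh d} {Ω : Set (Pt d)}

/-- By conformity the intersection lies in the hull of the common vertices. These miss a vertex of
`K`, so they span a proper affine subspace, which is null. -/
theorem volume_hull_inter {K L : Finset (Pt d)} (hK : K ∈ M.elems) (hL : L ∈ M.elems)
    (hne : K ≠ L) : volume (convexHull ℝ (K : Set (Pt d)) ∩ convexHull ℝ (L : Set (Pt d))) = 0 := by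
  classical
  obtain ⟨a, haK, haL⟩ : ∃ a ∈ K, a ∉ L := by
    by_contra! h
    exact hne (Finset.eq_of_subset_of_card_le h (by rw [M.card_eq K hK, M.card_eq L hL]))
  have h1 : a ∉ affineSpan ℝ ((K.erase a : Finset (Pt d)) : Set (Pt d)) := by
    have := (M.indep K hK).notMem_affineSpan_sdiff ⟨a, haK⟩ Set.univ
    convert this using 3
    ext y
    simp only [Finset.coe_erase, Set.mem_sdiff, Finset.mem_coe, Set.mem_singleton_iff,
      Set.mem_image, Set.mem_univ, true_and, Subtype.exists, Subtype.mk.injEq]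
    constructor
    · rintro ⟨h, h'⟩; exact ⟨y, h, h', rfl⟩
    · rintro ⟨z, h, h', rfl⟩; exact ⟨h, h'⟩
  have h2 : affineSpan ℝ ((K.erase a : Finset (Pt d)) : Set (Pt d)) ≠ ⊤ := by
    intro h; rw [h] at h1; exact h1 (AffineSubspace.mem_top ℝ _ a)
  refine measure_mono_null ?_ (Measure.addHaar_affineSubspace volume _ h2)
  refine (M.conforming K hK L hL).trans ?_
  refine (convexHull_mono ?_).trans (convexHull_subset_affineSpan _)
  rintro y ⟨hyK, hyL⟩
  exact Finset.mem_coe.2 (Finset.mem_erase.2 ⟨fun h => haL (h ▸ hyL), hyK⟩)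

/-- As `Ω` is the interior of its closure, a point of the closure outside `Ω` cannot be interior to
any simplex. It lies on the frontier of one, and frontiers of convex sets are null. -/
theorem restrict_eq_of_isMeshOf (hM : M.IsMeshOf Ω) :
    volume.restrict Ω =
      volume.restrict (⋃ K : M.elems, convexHull ℝ ((K : Finset (Pt d)) : Set (Pt d))) := by
  have h1 : (⋃ K : M.elems, convexHull ℝ ((K : Finset (Pt d)) : Set (Pt d))) = closure Ω := by
    rw [hM.closure_eq]
    ext x
    simp
  rw [h1]
  refine Measure.restrict_congr_set ?_
  refine (ae_eq_set.2 ⟨?_, ?_⟩ : Ω =ᵐ[volume] closure Ω)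
  · rw [Set.sdiff_eq_empty.2 subset_closure, measure_empty]
  · have h2 : closure Ω \ Ω ⊆ ⋃ K ∈ M.elems, frontier (convexHull ℝ (K : Set (Pt d))) := by
      rintro x ⟨hx, hxΩ⟩
      rw [hM.closure_eq] at hx
      simp only [Set.mem_iUnion, exists_prop] at hx ⊢
      obtain ⟨K, hK, hxK⟩ := hx
      refine ⟨K, hK, subset_closure hxK, fun hi => hxΩ ?_⟩
      rw [← hM.interior_closure]
      refine interior_mono ?_ hi
      rw [hM.closure_eq]
      exact Set.subset_biUnion_of_mem (u := fun K : Finset (Pt d) =>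
        convexHull ℝ (K : Set (Pt d))) hK
    refine measure_mono_null h2 ((measure_biUnion_null_iff M.elems.countable_toSet).2 fun K _ => ?_)
    exact (convex_convexHull ℝ _).addHaar_frontier volume

theorem restrict_hull_le (hM : M.IsMeshOf Ω) {K : Finset (Pt d)} (hK : K ∈ M.elems) :
    volume.restrict (convexHull ℝ (K : Set (Pt d))) ≤ volume.restrict Ω := by
  rw [restrict_eq_of_isMeshOf hM]
  exact Measure.restrict_mono_set _ (Set.subset_iUnion_of_subset ⟨K, hK⟩ (by rfl))

theorem meshIntegral_eq_integral (hM : M.IsMeshOf Ω) {g : Pt d → ℝ}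
    (hg : Integrable g (volume.restrict Ω)) : meshIntegral M (fun _ => g) = ∫ x in Ω, g x := by
  rw [restrict_eq_of_isMeshOf hM] at hg ⊢
  rw [integral_iUnion_ae (fun K => (measurableSet_hull _).nullMeasurableSet) ?_ hg, tsum_fintype,
    meshIntegral, ← Finset.sum_coe_sort]
  intro K L hKL
  exact volume_hull_inter K.2 L.2 fun h => hKL (Subtype.ext h)

/-- Cauchy-Schwarz by the discriminant, carried out on the elementwise integrals. This avoids gluing
the broken field into an element of `L²(Ω)`. -/
theorem abs_pairing_le (hM : M.IsMeshOf Ω) (g : Lp (Pt d) 2 (volume.restrict Ω))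
    (v : BrokenField d) : |pairing M g v| ≤ ‖g‖ * √(normL2Sq M v) := by
  have hgK : ∀ K ∈ M.elems, MemLp g 2 (volume.restrict (convexHull ℝ (K : Set (Pt d)))) :=
    fun K hK => (Lp.memLp g).mono_measure (restrict_hull_le hM hK)
  have hvK : ∀ K : Finset (Pt d),
      MemLp (val (v K)) 2 (volume.restrict (convexHull ℝ (K : Set (Pt d)))) := by
    intro K
    rw [memLp_two_iff_integrable_sq_norm (continuous_val _).aestronglyMeasurable]
    exact integrable_hull K _ ((continuous_val _).norm.pow 2)
  have hgsq : Integrable (fun x => ‖g x‖ ^ 2) (volume.restrict Ω) :=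
    (Lp.memLp g).integrable_norm_pow two_ne_zero
  have hnorm : ‖g‖ ^ 2 = meshIntegral M fun _ x => ‖g x‖ ^ 2 := by
    rw [meshIntegral_eq_integral hM hgsq, ← real_inner_self_eq_norm_sq, L2.inner_def]
    simp only [real_inner_self_eq_norm_sq]
  have hquad : ∀ t : ℝ, 0 ≤ normL2Sq M v * (t * t) + (2 * pairing M g v) * t + ‖g‖ ^ 2 := by
    intro t
    have h0 : 0 ≤ meshIntegral M fun K x => ‖g x + t • val (v K) x‖ ^ 2 :=
      meshIntegral_nonneg fun _ _ => sq_nonneg _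
    refine h0.trans (le_of_eq ?_)
    rw [hnorm, normL2Sq, pairing]
    simp only [meshIntegral, Finset.sum_mul, Finset.mul_sum]
    rw [← Finset.sum_add_distrib, ← Finset.sum_add_distrib]
    refine Finset.sum_congr rfl fun K hK => ?_
    have i1 := (hgK K hK).integrable_norm_pow two_ne_zero
    have i2 : Integrable (fun x => ‖val (v K) x‖ ^ 2) _ :=
      integrable_hull K _ ((continuous_val (v K)).norm.pow 2)
    have i3 : Integrable (fun x => inner ℝ (g x) (val (v K) x))
        (volume.restrict (convexHull ℝ (K : Set (Pt d)))) :=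
      ((hgK K hK).norm.integrable_mul (hvK K).norm).mono'
        ((hgK K hK).1.inner (hvK K).1) (Filter.Eventually.of_forall fun x => norm_inner_le_norm _ _)
    simp only [norm_add_sq_real, norm_smul, inner_smul_right, mul_pow]
    have i4 := (i3.const_mul t).const_mul 2
    have i5 := i2.const_mul (‖t‖ ^ 2)
    have i6 : Integrable (fun x => ‖g x‖ ^ 2 + 2 * (t * inner ℝ (g x) (val (v K) x)))
        (volume.restrict (convexHull ℝ (K : Set (Pt d)))) := i1.add i4
    rw [integral_add i6 i5, integral_add i1 i4, integral_const_mul, integral_const_mul,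
      integral_const_mul, Real.norm_eq_abs, sq_abs]
    ring
  have hdisc := discrim_le_zero hquad
  rw [discrim] at hdisc
  have h2 : |pairing M g v| ≤ √(‖g‖ ^ 2 * normL2Sq M v) :=
    Real.abs_le_sqrt (by nlinarith)
  rwa [Real.sqrt_mul (sq_nonneg _), Real.sqrt_sq (norm_nonneg _)] at h2

end Pairing

/-! ## The space-time problem on one slab -/

theorem isBilinearMap_zero_right {V : Type*} [AddCommGroup V] [Module ℝ V] {b : V → V → ℝ}
    (hb : IsBilinearMap ℝ b) (v : V) : b v 0 = 0 := by
  simpa using hb.smul_right 0 v 0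

theorem isBilinearMap_sub_left {V : Type*} [AddCommGroup V] [Module ℝ V] {b : V → V → ℝ}
    (hb : IsBilinearMap ℝ b) (v w z : V) : b (v - w) z = b v z - b w z := by
  rw [sub_eq_add_neg, ← neg_one_smul ℝ w, hb.add_left, hb.smul_left]
  simp [sub_eq_add_neg]

theorem isPolyPath_const {V : Type*} [AddCommGroup V] [Module ℝ V] {W : Submodule ℝ V} {v : V}
    (hv : v ∈ W) : IsPolyPath W 0 fun _ => v :=
  ⟨fun _ => v, fun _ => hv, fun s => by simp⟩

/-- Quadrature of a bilinear form with an interpolated first argument. -/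
theorem integral_sum_basis_bilin {V : Type*} [AddCommGroup V] [Module ℝ V] {W : Submodule ℝ V}
    {ℓ : ℕ} {a b : ℝ} (hab : a < b) {v : ℝ → V} (hv : IsPolyPath W ℓ v)
    (B : Fin (ℓ + 1) → V → V → ℝ) (hB : ∀ i, IsBilinearMap ℝ (B i)) (y : Fin (ℓ + 1) → V) :
    ∫ s in a..b, ∑ i, (Lagrange.basis Finset.univ (slabNode ℓ a b) i).eval s * B i (y i) (v s) =
      ∑ i, ((b - a) * radauWeight ℓ i) * B i (y i) (v (slabNode ℓ a b i)) := by
  choose P hP h using fun i =>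
    (isPolyPath_const (W := ⊤) (v := y i) trivial).exists_bilin_poly hv (hB i)
  -- Each form may depend on its node, as convection does through `w`. Every summand is a basis
  -- polynomial of degree `ℓ` times a polynomial of degree at most `ℓ`, and at a node only one basis
  -- polynomial survives.
  have h1 := sum_radau_eq_integral ℓ hab
    (∑ i, Lagrange.basis Finset.univ (slabNode ℓ a b) i * P i)
    (natDegree_sum_le_of_forall_le _ _ fun i _ => natDegree_mul_le.trans (by
      have := hP i
      rw [natDegree_basis_slabNode ℓ hab]
      omega))
  simp only [eval_finsetSum, eval_mul, h] at h1
  rw [h1]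
  refine Finset.sum_congr rfl fun j _ => ?_
  change _ * ∑ i, eval (slabNode ℓ a b j) _ * B i (y i) (v (slabNode ℓ a b j)) = _
  simp [eval_basis_slabNode_node ℓ hab]

theorem integral_inner_sum_smul {d : ℕ} {ι : Type*} (S : Finset ι) {μ : Measure (Pt d)}
    (hμ : ∀ g : Pt d → ℝ, Continuous g → Integrable g μ) (c : ι → ℝ) (φ : ι → Pt d → Pt d)
    (hφ : ∀ i, Continuous (φ i)) {ψ : Pt d → Pt d} (hψ : Continuous ψ) :
    ∫ x, inner ℝ (∑ i ∈ S, c i • φ i x) (ψ x) ∂μ = ∑ i ∈ S, c i * ∫ x, inner ℝ (φ i x) (ψ x) ∂μ := by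
  simp only [sum_inner, inner_smul_left, conj_trivial]
  rw [integral_finsetSum _ fun i _ => (hμ _ ((hφ i).inner hψ)).const_mul _]
  simp only [integral_const_mul]

section SpaceTime

variable {d : ℕ} {T : ℝ} (D : SpaceTimeMesh d T) {fam : VelocityFamily} {k ℓ : ℕ}

theorem node_eq_slabNode (n : ℕ) : D.node ℓ n = slabNode ℓ (D.t n) (D.t (n + 1)) := rfl

/-- By definition the time coefficients lie only in `V_h`, while the divergence and boundary
constraints hold for the values at each time. Re-expansion at the Radau nodes turns values into
coefficients, so the coefficients satisfy the constraints too. -/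
theorem isPolyPath_of_mem_kernel {u : SpaceTimeField d} (hu : u ∈ spaceTimeKernel D fam k ℓ)
    {n : ℕ} (hn : n < D.N) : IsPolyPath (kernelSubmodule D.orient fam k) ℓ (u n) := by
  obtain ⟨hv, hdiv⟩ := hu
  obtain ⟨⟨c, hc, h⟩, hb⟩ := hv n hn
  have h1 : IsPolyPath (velocitySubmodule D.orient fam k) ℓ (u n) := ⟨c, hc, h⟩
  rw [funext (h1.eq_sum_basis (D.t_lt n hn))]
  exact isPolyPath_sum_eval_smul _ _
    (fun i _ => (natDegree_basis_slabNode ℓ (D.t_lt n hn) i).le) _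
    fun i _ => ⟨h1.mem _, hb _, hdiv n hn _⟩

theorem mem_kernel_of_isPolyPath {z : SpaceTimeField d}
    (hz : ∀ n < D.N, IsPolyPath (kernelSubmodule D.orient fam k) ℓ (z n)) :
    z ∈ spaceTimeKernel D fam k ℓ := by
  refine ⟨fun n hn => ⟨?_, fun s => ((hz n hn).mem s).2.1⟩, fun n hn s => ((hz n hn).mem s).2.2⟩
  obtain ⟨c, hc, h⟩ := hz n hn
  exact ⟨c, fun j => (hc j).1, h⟩

/-- The convective form as a quadrature of forms in space. -/
theorem convectiveForm_eq_sum (hd : 0 < d) (cS : ℝ) (w u : SpaceTimeField d)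
    {z : SpaceTimeField d} (hz : z ∈ spaceTimeKernel D fam k ℓ) :
    convectiveForm D ℓ cS w u z = ∑ n ∈ Finset.range D.N, ∑ i, D.weight ℓ n i *
      (convVolume D.mesh (w n (D.node ℓ n i)) (u n (D.node ℓ n i)) (z n (D.node ℓ n i))
        - convFlux D.orient (w n (D.node ℓ n i)) (u n (D.node ℓ n i)) (z n (D.node ℓ n i))
        + 1 / 2 * convUpwind D.orient cS (w n (D.node ℓ n i)) (u n (D.node ℓ n i))
          (z n (D.node ℓ n i))) := by
  refine Finset.sum_congr rfl fun n hn => ?_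
  have hn' := Finset.mem_range.1 hn
  have hzp := isPolyPath_of_mem_kernel D hz hn'
  have hab := D.t_lt n hn'
  have hfac : ∀ F ∈ D.mesh.interiorFacets, ∀ g : Pt d → ℝ, Continuous g →
      Integrable g ((Measure.euclideanHausdorffMeasure (d - 1)).restrict
        (convexHull ℝ (F : Set (Pt d)))) := fun F hF =>
    integrable_facet D.orient hd (mem_facets_of_mem_interiorFacets hF)
  -- In all three parts the interpolant is a finite sum over nodes, with `w` and `u` frozen there,
  -- so it can be pulled out of the integral in space.
  have e1 : ∀ s, (meshIntegral D.mesh fun K x =>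
      inner ℝ (D.interp ℓ n (fun r => matVec (grad (u n r K) x) (val (w n r K) x)) s)
          (val (z n s K) x)) = ∑ i, (Lagrange.basis Finset.univ (D.node ℓ n) i).eval s *
        convVolume D.mesh (w n (D.node ℓ n i)) (u n (D.node ℓ n i)) (z n s) := by
    intro s
    simp only [convVolume, meshIntegral, Finset.mul_sum]
    rw [Finset.sum_comm]
    refine Finset.sum_congr rfl fun K _ => ?_
    exact integral_inner_sum_smul Finset.univ (integrable_hull K) _ _
      (fun i => (isLinearField_gradMatVec K (continuous_val _)).continuous (u n (D.node ℓ n i)))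
      (continuous_val _)
  have e2 : ∀ s, (∑ F ∈ D.mesh.interiorFacets, facetIntegral F fun x =>
      inner ℝ (D.interp ℓ n (fun r =>
            (inner ℝ (val (w n r (D.orient.plus F)) x) (D.orient.normal F) : ℝ) •
              jump D.orient (u n r) F x) s) (average D.orient (z n s) F x)) =
      ∑ i, (Lagrange.basis Finset.univ (D.node ℓ n) i).eval s *
        convFlux D.orient (w n (D.node ℓ n i)) (u n (D.node ℓ n i)) (z n s) := by
    intro s
    simp only [convFlux, Finset.mul_sum]
    rw [Finset.sum_comm]
    refine Finset.sum_congr rfl fun F hF => ?_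
    exact integral_inner_sum_smul Finset.univ (hfac F hF) _ _
      (fun i => ((isLinearField_jump D.orient F).smul
        (continuous_normalComponent _ _)).continuous (u n (D.node ℓ n i)))
      ((isLinearField_average D.orient F).continuous _)
  have e3 : ∀ s, (∑ F ∈ D.mesh.interiorFacets, facetIntegral F fun x =>
      inner ℝ (D.interp ℓ n (fun r => upwindCoeff D.orient cS (w n r) F •
              jump D.orient (u n r) F x) s) (jump D.orient (z n s) F x)) =
      ∑ i, (Lagrange.basis Finset.univ (D.node ℓ n) i).eval s *
        convUpwind D.orient cS (w n (D.node ℓ n i)) (u n (D.node ℓ n i)) (z n s) := by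
    intro s
    simp only [convUpwind, Finset.mul_sum]
    rw [Finset.sum_comm]
    refine Finset.sum_congr rfl fun F hF => ?_
    exact integral_inner_sum_smul Finset.univ (hfac F hF) _
      (fun i x => upwindCoeff D.orient cS (w n (D.node ℓ n i)) F •
        jump D.orient (u n (D.node ℓ n i)) F x)
      (fun i => ((isLinearField_jump D.orient F).smul
        (g := fun _ => upwindCoeff D.orient cS (w n (D.node ℓ n i)) F)
        continuous_const).continuous _)
      ((isLinearField_jump D.orient F).continuous _)
  simp only [e1, e2, e3, node_eq_slabNode]
  rw [integral_sum_basis_bilin hab hzp _ (fun i => isBilinearMap_convVolume _)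
      fun i => u n (slabNode ℓ (D.t n) (D.t (n + 1)) i),
    integral_sum_basis_bilin hab hzp _ (fun i => isBilinearMap_convFlux D.orient hd _)
      fun i => u n (slabNode ℓ (D.t n) (D.t (n + 1)) i),
    integral_sum_basis_bilin hab hzp _ (fun i => isBilinearMap_convUpwind D.orient hd cS _)
      fun i => u n (slabNode ℓ (D.t n) (D.t (n + 1)) i), Finset.mul_sum, ← Finset.sum_sub_distrib,
    ← Finset.sum_add_distrib]
  exact Finset.sum_congr rfl fun i _ => by simp only [SpaceTimeMesh.weight]; ring

theorem pairing_smul {M : SimplicialMesh d} (g : Pt d → Pt d) (c : ℝ) (v : BrokenField d) :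
    pairing M g (c • v) = c * pairing M g v := by
  simp only [pairing, meshIntegral, Pi.smul_apply, val_smul, inner_smul_right, integral_const_mul,
    Finset.mul_sum]

theorem pairing_zero {M : SimplicialMesh d} (g : Pt d → Pt d) : pairing M g 0 = 0 := by
  simpa using pairing_smul (M := M) g 0 0

/-- The value transported into the slab number `m`, tested with `u(t_m^+)`. -/
noncomputable def inflow {Ω : Set (Pt d)} (u₀ : Lp (Pt d) 2 (volume.restrict Ω))
    (u : SpaceTimeField d) (m : ℕ) : ℝ :=
  if m = 0 then pairing D.mesh u₀ (u 0 0)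
  else innerL2 D.mesh (u (m - 1) (D.t m)) (u m (D.t m))

/-- Testing with the interpolant of `θ u` on one slab, for an affine weight `θ`. -/
theorem IsLinearizedSolution.slab_identity {D : SpaceTimeMesh d T} (hd : 0 < d) {Ω : Set (Pt d)}
    {ν σ cS : ℝ} {f : ℝ → Lp (Pt d) 2 (volume.restrict Ω)} {u₀ : Lp (Pt d) 2 (volume.restrict Ω)}
    {w u : SpaceTimeField d} (hw : w ∈ spaceTimeKernel D fam k ℓ)
    (hu : IsLinearizedSolution D Ω fam k ℓ ν σ cS f u₀ w u) {m : ℕ} (hm : m < D.N) (α β : ℝ) :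
    1 / 2 * ((α + β * D.t (m + 1)) * normL2Sq D.mesh (u m (D.t (m + 1)))
        - (α + β * D.t m) * normL2Sq D.mesh (u m (D.t m)))
      - β / 2 * (∫ s in (D.t m)..(D.t (m + 1)), normL2Sq D.mesh (u m s))
      + (α + β * D.t m) * (normL2Sq D.mesh (u m (D.t m)) - inflow D u₀ u m)
      + ∑ i, D.weight ℓ m i * ((α + β * D.node ℓ m i) *
          (ν * penaltyForm D.orient σ (u m (D.node ℓ m i)) (u m (D.node ℓ m i)) +
            1 / 2 * convUpwind D.orient cS (w m (D.node ℓ m i)) (u m (D.node ℓ m i))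
              (u m (D.node ℓ m i)))) =
      ∫ s in (D.t m)..(D.t (m + 1)), pairing D.mesh (f s)
        (interpMul ℓ (D.t m) (D.t (m + 1)) (fun r => α + β * r) (u m) s) := by
  obtain ⟨huZ, heq⟩ := hu
  have hup := fun n (hn : n < D.N) => isPolyPath_of_mem_kernel D huZ hn
  have hab := D.t_lt m hm
  set v : ℝ → BrokenField d := interpMul ℓ (D.t m) (D.t (m + 1)) (fun r => α + β * r) (u m) with hv
  have hvp := isPolyPath_interpMul ℓ hab (fun r => α + β * r) (hup m hm)
  -- Continuity in time is not imposed, so the test function may be supported on one slab.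
  let z : SpaceTimeField d := fun n => if n = m then v else fun _ => 0
  have hzm : z m = v := if_pos rfl
  have hzn : ∀ n, n ≠ m → z n = fun _ => 0 := fun n hn => if_neg hn
  have hz : z ∈ spaceTimeKernel D fam k ℓ := by
    refine mem_kernel_of_isPolyPath D fun n hn => ?_
    by_cases h : n = m
    · rw [h, hzm]; exact hvp
    · rw [hzn n h]
      exact ⟨fun _ => 0, fun _ => Submodule.zero_mem _, fun s => by simp⟩
  have hB := isBilinearMap_innerL2 (M := D.mesh)
  -- The left end of the slab is a Radau node, so the interpolant is exact in the jump term.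
  have hv0 : v (D.t m) = (α + β * D.t m) • u m (D.t m) := interpMul_left ℓ hab _ _
  have hvi : ∀ i, v (D.node ℓ m i) = (α + β * D.node ℓ m i) • u m (D.node ℓ m i) :=
    fun i => interpMul_node ℓ hab _ _ i
  have key := heq z hz
  -- the data
  have hdata : ∑ n ∈ Finset.range D.N, ∫ s in (D.t n)..(D.t (n + 1)),
      pairing D.mesh (f s) (z n s) = ∫ s in (D.t m)..(D.t (m + 1)), pairing D.mesh (f s) (v s) := by
    rw [Finset.sum_eq_single m, hzm]
    · intro n _ hn
      simp [hzn n hn, pairing_zero]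
    · exact fun h => absurd (Finset.mem_range.2 hm) h
  -- the viscous form
  have hvisc : viscousForm D σ u z = ∑ i, D.weight ℓ m i * ((α + β * D.node ℓ m i) *
      penaltyForm D.orient σ (u m (D.node ℓ m i)) (u m (D.node ℓ m i))) := by
    have hP := isBilinearMap_penaltyForm D.orient hd σ
    rw [viscousForm, Finset.sum_eq_single m, hzm]
    · exact integral_bilin_interpMul hab (hup m hm) hP _
    · intro n _ hn
      simp [hzn n hn, isBilinearMap_zero_right hP]
    · exact fun h => absurd (Finset.mem_range.2 hm) h
  -- the convective form
  have hconv : convectiveForm D ℓ cS w u z = ∑ i, D.weight ℓ m i * ((α + β * D.node ℓ m i) *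
      (1 / 2 * convUpwind D.orient cS (w m (D.node ℓ m i)) (u m (D.node ℓ m i))
        (u m (D.node ℓ m i)))) := by
    rw [convectiveForm_eq_sum D hd cS w u hz, Finset.sum_eq_single m, hzm]
    -- At each node the test value is a scalar multiple of `u`, so the forms are evaluated on the
    -- diagonal and the volume part cancels the flux part.
    · refine Finset.sum_congr rfl fun i _ => ?_
      rw [hvi, (isBilinearMap_convVolume _).smul_right,
        (isBilinearMap_convFlux D.orient hd _).smul_right,
        (isBilinearMap_convUpwind D.orient hd cS _).smul_right,
        convVolume_eq_convFlux D.orient hd ((isPolyPath_of_mem_kernel D hw hm).mem _)]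
      simp only [smul_eq_mul]
      ring
    · intro n _ hn
      simp [hzn n hn, isBilinearMap_zero_right (isBilinearMap_convVolume _),
        isBilinearMap_zero_right (isBilinearMap_convFlux D.orient hd _),
        isBilinearMap_zero_right (isBilinearMap_convUpwind D.orient hd cS _)]
    · exact fun h => absurd (Finset.mem_range.2 hm) h
  -- the time derivative
  have hder : ∑ n ∈ Finset.range D.N, ∫ s in (D.t n)..(D.t (n + 1)),
      (meshIntegral D.mesh fun K x =>
        inner ℝ (deriv (fun r => val (u n r K) x) s) (val (z n s K) x)) =
      1 / 2 * ((α + β * D.t (m + 1)) * normL2Sq D.mesh (u m (D.t (m + 1)))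
        - (α + β * D.t m) * normL2Sq D.mesh (u m (D.t m)))
      - β / 2 * ∫ s in (D.t m)..(D.t (m + 1)), normL2Sq D.mesh (u m s) := by
    rw [Finset.sum_eq_single m, hzm]
    · obtain ⟨u', hu', hφ, hd2⟩ := (hup m hm).exists_deriv
      have h1 := integral_deriv_interpMul hab (hup m hm) hu' hB innerL2_comm
        (hd2 _ hB) α β
      simp only [innerL2_self] at h1
      rw [← h1]
      refine intervalIntegral.integral_congr fun s _ => ?_
      refine Finset.sum_congr rfl fun K _ => ?_
      congr 1
      funext x
      let φ : BrokenField d →ₗ[ℝ] Pt d :=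
        { toFun := fun v => val (v K) x
          map_add' := fun _ _ => val_add _ _ _
          map_smul' := fun _ _ => val_smul _ _ _ }
      have h2 : deriv (fun r => val (u m r K) x) s = val (u' s K) x := (hφ (Pt d) φ s).deriv
      simp only [h2]
      rfl
    · intro n _ hn
      have h0 : ∀ x : Pt d, val (0 : PolyField d) x = 0 := fun x => by ext i; simp [val]
      simp [hzn n hn, h0, meshIntegral]
    · exact fun h => absurd (Finset.mem_range.2 hm) h
  rw [timeForm, hder, hvisc, hconv, hdata] at key
  -- the jump at the left end of the slab
  have hjump : - (∑ n ∈ Finset.range (D.N - 1), innerL2 D.mesh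
        (u n (D.t (n + 1)) - u (n + 1) (D.t (n + 1))) (z (n + 1) (D.t (n + 1))))
      + innerL2 D.mesh (u 0 0) (z 0 0) - pairing D.mesh u₀ (z 0 0) =
      (α + β * D.t m) * (normL2Sq D.mesh (u m (D.t m)) - inflow D u₀ u m) := by
    rcases m with _ | m
    · rw [Finset.sum_eq_zero fun n _ => by
        rw [hzn (n + 1) (by omega), isBilinearMap_zero_right hB], hzm, inflow, if_pos rfl]
      rw [D.t_zero] at hv0 ⊢
      rw [hv0, hB.smul_right, pairing_smul, innerL2_self, smul_eq_mul]
      ring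
    -- The jump at the right end of the slab is tested with `z` on the next slab, where it vanishes.
    -- Only the jump at the left end remains.
    · rw [Finset.sum_eq_single m, hzm, hzn 0 (by omega), isBilinearMap_zero_right hB, pairing_zero,
        hv0, hB.smul_right, isBilinearMap_sub_left hB, innerL2_self, inflow, if_neg (by omega), Nat.add_sub_cancel]
      · simp only [smul_eq_mul]; ring
      · intro n _ hn
        rw [hzn (n + 1) (by omega), isBilinearMap_zero_right hB]
      · intro h
        exact absurd (Finset.mem_range.2 (by omega)) h
  have hsum : ∑ i, D.weight ℓ m i * ((α + β * D.node ℓ m i) *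
          (ν * penaltyForm D.orient σ (u m (D.node ℓ m i)) (u m (D.node ℓ m i)) +
            1 / 2 * convUpwind D.orient cS (w m (D.node ℓ m i)) (u m (D.node ℓ m i))
              (u m (D.node ℓ m i)))) =
      ν * (∑ i, D.weight ℓ m i * ((α + β * D.node ℓ m i) *
        penaltyForm D.orient σ (u m (D.node ℓ m i)) (u m (D.node ℓ m i)))) +
      ∑ i, D.weight ℓ m i * ((α + β * D.node ℓ m i) *
        (1 / 2 * convUpwind D.orient cS (w m (D.node ℓ m i)) (u m (D.node ℓ m i))
          (u m (D.node ℓ m i)))) := by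
    rw [Finset.mul_sum, ← Finset.sum_add_distrib]
    exact Finset.sum_congr rfl fun i _ => by ring
  rw [hsum]
  linarith

end SpaceTime

/-! ## The energy estimate -/

section Energy

variable {d : ℕ} {T : ℝ} {D : SpaceTimeMesh d T} {fam : VelocityFamily} {k ℓ : ℕ}

theorem SpaceTimeMesh.t_mono (D : SpaceTimeMesh d T) {i j : ℕ} (hij : i ≤ j) (hj : j ≤ D.N) :
    D.t i ≤ D.t j := by
  induction j, hij using Nat.le_induction with
  | base => exact le_rfl
  | succ j hij ih => exact (ih (by omega)).trans (D.t_lt j (by omega)).le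

theorem SpaceTimeMesh.weight_nonneg (D : SpaceTimeMesh d T) {n : ℕ} (hn : n < D.N)
    (i : Fin (ℓ + 1)) : 0 ≤ D.weight ℓ n i :=
  mul_nonneg (sub_pos.2 (D.t_lt n hn)).le ((isLeftGaussRadau_radau ℓ).weight_pos i).le

/-- The open slabs are disjoint, so at each time at most one indicator is active, and at the
partition points the sum is zero. -/
theorem normLinftyL2_le {u : SpaceTimeField d} {A : ℝ} (hA : 0 ≤ A)
    (h : ∀ n < D.N, ∀ s ∈ Set.Icc (D.t n) (D.t (n + 1)), √(normL2Sq D.mesh (u n s)) ≤ A) :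
    normLinftyL2 D u ≤ A := by
  refine ENNReal.toReal_le_of_le_ofReal hA ?_
  rw [eLpNorm_exponent_top]
  refine eLpNormEssSup_le_of_ae_bound (Filter.Eventually.of_forall fun s => ?_)
  rw [Real.norm_of_nonneg (Finset.sum_nonneg fun n _ =>
    Set.indicator_nonneg (fun _ _ => Real.sqrt_nonneg _) _)]
  by_cases hs : ∃ n ∈ Finset.range D.N, s ∈ Set.Ioo (D.t n) (D.t (n + 1))
  · obtain ⟨n, hn, hs⟩ := hs
    rw [Finset.sum_eq_single n, Set.indicator_of_mem hs]
    · exact h n (Finset.mem_range.1 hn) s (Set.Ioo_subset_Icc_self hs)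
    · intro m hm hmn
      refine Set.indicator_of_notMem (fun hs' => ?_) _
      rw [Finset.mem_range] at hn hm
      rcases lt_or_gt_of_ne hmn with h1 | h1
      · have := D.t_mono (show m + 1 ≤ n by omega) hn.le
        linarith [hs.1, hs'.2]
      · have := D.t_mono (show n + 1 ≤ m by omega) hm.le
        linarith [hs.2, hs'.1]
    · exact fun h => absurd hn h
  · push Not at hs
    rw [Finset.sum_eq_zero fun n hn => Set.indicator_of_notMem (hs n hn) _]
    exact hA

/-- The squared norm is the diagonal of a bilinear form, hence of degree `2ℓ` in time. Writing it at
the nodes allows comparison with the dissipation node by node. -/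
theorem viscousNormSq_eq_sum (hd : 0 < d) (σ : ℝ) {u : SpaceTimeField d}
    (hu : u ∈ spaceTimeKernel D fam k ℓ) : viscousNormSq D σ u =
      ∑ n ∈ Finset.range D.N, ∑ i, D.weight ℓ n i *
        penaltyNormSq D.orient σ (u n (D.node ℓ n i)) := by
  refine Finset.sum_congr rfl fun n hn => ?_
  have hn' := Finset.mem_range.1 hn
  have hp := isPolyPath_of_mem_kernel D hu hn'
  simp only [← penaltyInner_self]
  exact integral_bilin_eq_sum (D.t_lt n hn') hp hp (isBilinearMap_penaltyInner D.orient hd σ)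

theorem upwindSq_eq_sum (cS : ℝ) (w u : SpaceTimeField d) : upwindSq D ℓ cS w u =
    ∑ n ∈ Finset.range D.N, ∑ i, D.weight ℓ n i * (1 / 2 *
      convUpwind D.orient cS (w n (D.node ℓ n i)) (u n (D.node ℓ n i)) (u n (D.node ℓ n i))) := by
  simp only [upwindSq, SpaceTimeMesh.quad, convUpwind_self, Finset.mul_sum]
  rw [Finset.sum_comm]
  refine Finset.sum_congr rfl fun n _ => ?_
  rw [Finset.sum_comm]
  refine Finset.sum_congr rfl fun i _ => Finset.sum_congr rfl fun F _ => ?_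
  ring

theorem normL2Sq_smul {M : SimplicialMesh d} (c : ℝ) (v : BrokenField d) :
    normL2Sq M (c • v) = c ^ 2 * normL2Sq M v := by
  have hB := isBilinearMap_innerL2 (M := M)
  rw [← innerL2_self, hB.smul_left, hB.smul_right, innerL2_self, smul_eq_mul, smul_eq_mul]
  ring

/-- The energy dissipated on the slab number `n` by viscosity and upwinding. -/
noncomputable def dissipation (D : SpaceTimeMesh d T) (ℓ : ℕ) (ν σ cS : ℝ)
    (w u : SpaceTimeField d) (n : ℕ) : ℝ :=
  ∑ i, D.weight ℓ n i * (ν * penaltyForm D.orient σ (u n (D.node ℓ n i)) (u n (D.node ℓ n i)) +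
    1 / 2 * convUpwind D.orient cS (w n (D.node ℓ n i)) (u n (D.node ℓ n i)) (u n (D.node ℓ n i)))

variable {Ω : Set (Pt d)} {f : ℝ → Lp (Pt d) 2 (volume.restrict Ω)}

theorem intervalIntegrable_norm (hT : 0 < T) (hf : IntegrableOn f (Set.Ioo 0 T)) {n : ℕ}
    (hn : n < D.N) :
    IntervalIntegrable (fun s => ‖f s‖) volume (D.t n) (D.t (n + 1)) := by
  have h1 : IntervalIntegrable (fun s => ‖f s‖) volume 0 T := by
    rw [intervalIntegrable_iff_integrableOn_Ioo_of_le hT.le]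
    exact hf.norm
  refine h1.mono_set ?_
  rw [Set.uIcc_of_le (D.t_lt n hn).le, Set.uIcc_of_le hT.le]
  have h2 := D.t_mono (Nat.zero_le n) hn.le
  have h3 := D.t_mono (show n + 1 ≤ D.N by omega) le_rfl
  rw [D.t_zero] at h2
  rw [D.t_last] at h3
  exact Set.Icc_subset_Icc h2 h3

theorem sum_integral_norm (hT : 0 < T) (hf : IntegrableOn f (Set.Ioo 0 T)) :
    ∑ n ∈ Finset.range D.N, ∫ s in (D.t n)..(D.t (n + 1)), ‖f s‖ = ∫ s in Set.Ioo 0 T, ‖f s‖ := by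
  have h := intervalIntegral.sum_integral_adjacent_intervals (f := fun s => ‖f s‖) (μ := volume)
    (a := D.t) (n := D.N) fun n hn => intervalIntegrable_norm hT hf hn
  rw [h, D.t_zero, D.t_last, intervalIntegral.integral_of_le hT.le, integral_Ioc_eq_integral_Ioo]

theorem abs_integral_pairing_le (hM : D.mesh.IsMeshOf Ω) (hT : 0 < T)
    (hf : IntegrableOn f (Set.Ioo 0 T)) {n : ℕ} (hn : n < D.N) {z : ℝ → BrokenField d} {A : ℝ}
    (hz : ∀ s ∈ Set.Icc (D.t n) (D.t (n + 1)), √(normL2Sq D.mesh (z s)) ≤ A) :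
    |∫ s in (D.t n)..(D.t (n + 1)), pairing D.mesh (f s) (z s)| ≤
      A * ∫ s in (D.t n)..(D.t (n + 1)), ‖f s‖ := by
  rw [← Real.norm_eq_abs, ← intervalIntegral.integral_const_mul]
  refine intervalIntegral.norm_integral_le_of_norm_le (D.t_lt n hn).le
    (Filter.Eventually.of_forall fun s hs => ?_) ((intervalIntegrable_norm hT hf hn).const_mul A)
  rw [Real.norm_eq_abs, mul_comm A]
  exact (abs_pairing_le hM _ _).trans (mul_le_mul_of_nonneg_left
    (hz s (Set.Ioc_subset_Icc_self hs)) (norm_nonneg _))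

theorem timeJumpSq_nonneg (D : SpaceTimeMesh d T) (u : SpaceTimeField d) : 0 ≤ timeJumpSq D u :=
  mul_nonneg (by norm_num) (add_nonneg (add_nonneg (normL2Sq_nonneg _)
    (Finset.sum_nonneg fun _ _ => normL2Sq_nonneg _)) (normL2Sq_nonneg _))

-- The largest nodal value `A` serves as the unknown. The plain energy balance bounds the value
-- entering each slab by the data and `Λ A F`, the weighted balance then bounds `A` itself, and a
-- last use of the plain balance collects the remaining norms.
set_option maxHeartbeats 400000 in
theorem energy_estimate {Λ κ : ℝ} (hΛ1 : 1 ≤ Λ)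
    (hΛ : ∀ s ∈ Set.Icc (0 : ℝ) 1,
      ∑ i, |(Lagrange.basis Finset.univ (radauNode ℓ) i).eval s| ≤ Λ)
    (hκ : 0 < κ) (hκw : ∀ i, κ ≤ radauWeight ℓ i) (hd : 0 < d) (hT : 0 < T) {ν σ cS : ℝ}
    (hν : 0 < ν) (hcS : 0 < cS) (hσ : 0 ≤ σ) (hM : D.mesh.IsMeshOf Ω)
    (hcoer : ∀ v : BrokenField d, (∀ K ∈ D.mesh.elems, IsLocalVelocity fam k (v K)) →
      penaltyNormSq D.orient σ v ≤ 2 * penaltyForm D.orient σ v v)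
    (hf : IntegrableOn f (Set.Ioo 0 T)) {u₀ : Lp (Pt d) 2 (volume.restrict Ω)}
    {w u : SpaceTimeField d} (hw : w ∈ spaceTimeKernel D fam k ℓ)
    (hu : IsLinearizedSolution D Ω fam k ℓ ν σ cS f u₀ w u) :
    energyNormSq D ℓ ν σ cS w u ≤
      ((Λ ^ 2 + 2) * (16 * Λ ^ 2 / κ ^ 2 + 2 / κ) + 1 + Λ ^ 2) *
        ((∫ s in Set.Ioo 0 T, ‖f s‖) ^ 2 + ‖u₀‖ ^ 2) := by
  have hB := isBilinearMap_innerL2 (M := D.mesh)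
  have hBpos : ∀ v, 0 ≤ innerL2 D.mesh v v := fun v => by
    rw [innerL2_self]; exact normL2Sq_nonneg v
  have hup := fun n (hn : n < D.N) => isPolyPath_of_mem_kernel D hu.1 hn
  have hN : 0 < D.N := by
    by_contra h0
    have h1 : D.N = 0 := by omega
    have := D.t_last
    rw [h1, D.t_zero] at this
    linarith
  set F := ∫ s in Set.Ioo 0 T, ‖f s‖ with hF
  set G : ℕ → ℝ := fun n => ∫ s in (D.t n)..(D.t (n + 1)), ‖f s‖ with hG
  have hG0 : ∀ n < D.N, 0 ≤ G n := fun n hn =>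
    intervalIntegral.integral_nonneg (D.t_lt n hn).le fun _ _ => norm_nonneg _
  have hGF : ∑ n ∈ Finset.range D.N, G n = F := sum_integral_norm hT hf
  have hGle : ∀ n ≤ D.N, ∑ m ∈ Finset.range n, G m ≤ F := by
    intro n hn
    rw [← hGF]
    exact Finset.sum_le_sum_of_subset_of_nonneg (Finset.range_mono hn)
      fun m hm _ => hG0 m (Finset.mem_range.1 hm)
  have hF0 : 0 ≤ F := hGF ▸ Finset.sum_nonneg fun n hn => hG0 n (Finset.mem_range.1 hn)
  -- the largest nodal value
  obtain ⟨⟨n₀, i₀⟩, hmem, hmax⟩ := Finset.exists_max_image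
    (Finset.range D.N ×ˢ (Finset.univ : Finset (Fin (ℓ + 1))))
    (fun q => normL2Sq D.mesh (u q.1 (D.node ℓ q.1 q.2)))
    ⟨(0, 0), by simp [hN]⟩
  have hn₀ : n₀ < D.N := Finset.mem_range.1 (Finset.mem_product.1 hmem).1
  set A := √(normL2Sq D.mesh (u n₀ (D.node ℓ n₀ i₀))) with hA
  have hA0 : 0 ≤ A := Real.sqrt_nonneg _
  have hA2 : A ^ 2 = normL2Sq D.mesh (u n₀ (D.node ℓ n₀ i₀)) := Real.sq_sqrt (normL2Sq_nonneg _)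
  have hnode : ∀ n < D.N, ∀ i, normL2Sq D.mesh (u n (D.node ℓ n i)) ≤ A ^ 2 := by
    intro n hn i
    rw [hA2]
    exact hmax (n, i) (Finset.mem_product.2 ⟨Finset.mem_range.2 hn, Finset.mem_univ i⟩)
  have hΛA : 0 ≤ Λ * A := by positivity
  -- One bound serves `u` and both test functions: the weight is at most 1 in modulus at the nodes,
  -- and the basis polynomials sum in modulus to at most `Λ`.
  have hinterp : ∀ n < D.N, ∀ θ : ℝ → ℝ, (∀ i, |θ (D.node ℓ n i)| ≤ 1) →
      ∀ s ∈ Set.Icc (D.t n) (D.t (n + 1)),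
        √(normL2Sq D.mesh (interpMul ℓ (D.t n) (D.t (n + 1)) θ (u n) s)) ≤ Λ * A := by
    intro n hn θ hθ s hs
    refine Real.sqrt_le_iff.2 ⟨hΛA, ?_⟩
    rw [← innerL2_self, mul_pow]
    refine (bilin_sum_le Finset.univ hB innerL2_comm hBpos _ _ (A := A ^ 2) fun i _ => ?_).trans ?_
    · rw [innerL2_self, normL2Sq_smul]
      have h1 : θ (D.node ℓ n i) ^ 2 ≤ 1 := (sq_le_one_iff_abs_le_one _).2 (hθ i)
      exact (mul_le_of_le_one_left (normL2Sq_nonneg _) h1).trans (hnode n hn i)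
    · have h2 := sum_abs_basis_slabNode_le hΛ (D.t_lt n hn) hs
      have h3 : 0 ≤ ∑ i, |(Lagrange.basis Finset.univ (slabNode ℓ (D.t n) (D.t (n + 1))) i).eval s| :=
        Finset.sum_nonneg fun _ _ => abs_nonneg _
      gcongr
  have hslab : ∀ n < D.N, ∀ s ∈ Set.Icc (D.t n) (D.t (n + 1)),
      √(normL2Sq D.mesh (u n s)) ≤ Λ * A := by
    intro n hn s hs
    have h1 := hinterp n hn (fun _ => 1) (fun i => by simp) s hs
    simp only [interpMul, one_smul] at h1
    rwa [← (hup n hn).eq_sum_basis (D.t_lt n hn)] at h1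
  -- dissipation
  have hpen : ∀ n < D.N, ∀ s, penaltyNormSq D.orient σ (u n s) ≤
      2 * penaltyForm D.orient σ (u n s) (u n s) := fun n hn s =>
    hcoer _ ((hup n hn).mem s).1.1
  have hpen0 : ∀ v, 0 ≤ penaltyNormSq D.orient σ v := fun v =>
    add_nonneg (meshIntegral_nonneg fun _ _ => by positivity)
      (Finset.sum_nonneg fun F _ => facetIntegral_nonneg fun x =>
        mul_nonneg (mul_nonneg hσ (inv_nonneg.2 Metric.diam_nonneg)) (sq_nonneg _))
  have hdens : ∀ n < D.N, ∀ i, 0 ≤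
      ν * penaltyForm D.orient σ (u n (D.node ℓ n i)) (u n (D.node ℓ n i)) +
      1 / 2 * convUpwind D.orient cS (w n (D.node ℓ n i)) (u n (D.node ℓ n i))
        (u n (D.node ℓ n i)) := by
    intro n hn i
    have h1 := hpen n hn (D.node ℓ n i)
    have h2 := hpen0 (u n (D.node ℓ n i))
    have h3 := convUpwind_self_nonneg D.orient hcS.le (w n (D.node ℓ n i)) (u n (D.node ℓ n i))
    have h4 : 0 ≤ ν * penaltyForm D.orient σ (u n (D.node ℓ n i)) (u n (D.node ℓ n i)) :=
      mul_nonneg hν.le (by linarith)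
    linarith
  have hdiss : ∀ n < D.N, 0 ≤ dissipation D ℓ ν σ cS w u n := fun n hn =>
    Finset.sum_nonneg fun i _ => mul_nonneg (D.weight_nonneg hn i) (hdens n hn i)
  have hinflow0 : inflow D u₀ u 0 ≤ (‖u₀‖ ^ 2 + normL2Sq D.mesh (u 0 (D.t 0))) / 2 := by
    rw [inflow, if_pos rfl, D.t_zero]
    have h1 := (le_abs_self _).trans (abs_pairing_le hM u₀ (u 0 0))
    have h2 := Real.sq_sqrt (normL2Sq_nonneg (M := D.mesh) (u 0 0))
    nlinarith [sq_nonneg (‖u₀‖ - √(normL2Sq D.mesh (u 0 0)))]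
  -- the energy balance on one slab
  have hbal : ∀ n < D.N, 1 / 2 * normL2Sq D.mesh (u n (D.t (n + 1))) +
      1 / 2 * normL2Sq D.mesh (u n (D.t n)) + dissipation D ℓ ν σ cS w u n ≤
        inflow D u₀ u n + Λ * A * G n := by
    intro n hn
    -- The weight `θ = 1` makes the test function equal to `u` on the slab.
    have h1 := hu.slab_identity hd hw hn 1 0
    have h2 := (le_abs_self _).trans (abs_integral_pairing_le hM hT hf hn
      (hinterp n hn (fun r => 1 + 0 * r) fun i => by simp))
    rw [← h1] at h2
    simp only [zero_mul, add_zero, one_mul, zero_div] at h2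
    change _ + dissipation D ℓ ν σ cS w u n ≤ _ at h2
    linarith
  -- Polarization: the transported value costs half of each one-sided energy and leaves the squared
  -- jump as a gain.
  have hjump : ∀ n, innerL2 D.mesh (u n (D.t (n + 1))) (u (n + 1) (D.t (n + 1))) =
      1 / 2 * normL2Sq D.mesh (u n (D.t (n + 1))) +
      1 / 2 * normL2Sq D.mesh (u (n + 1) (D.t (n + 1))) -
      1 / 2 * normL2Sq D.mesh (u n (D.t (n + 1)) - u (n + 1) (D.t (n + 1))) := by
    intro n
    rw [← innerL2_self (_ - _), isBilinearMap_sub_left hB, innerL2_comm _ (_ - _),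
      innerL2_comm (u (n + 1) _) (_ - _), isBilinearMap_sub_left hB, isBilinearMap_sub_left hB,
      innerL2_self, innerL2_self, innerL2_comm (u (n + 1) _) (u n _)]
    ring
  -- Summation over the slabs telescopes: the end energy of a slab cancels against the inflow of the
  -- next one, leaving the squared jumps.
  have hglobal : ∀ n < D.N, 1 / 2 * normL2Sq D.mesh (u n (D.t (n + 1))) +
      1 / 2 * (∑ m ∈ Finset.range n,
        normL2Sq D.mesh (u m (D.t (m + 1)) - u (m + 1) (D.t (m + 1)))) +
      1 / 2 * normL2Sq D.mesh (u 0 (D.t 0)) +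
      ∑ m ∈ Finset.range (n + 1), dissipation D ℓ ν σ cS w u m ≤
        inflow D u₀ u 0 + Λ * A * ∑ m ∈ Finset.range (n + 1), G m := by
    intro n hn
    induction n with
    | zero =>
      have := hbal 0 hn
      simp only [Finset.range_zero, Finset.sum_empty, zero_add, Finset.range_one,
        Finset.sum_singleton] at this ⊢
      linarith
    | succ n ih =>
      have h1 := ih (by omega)
      have h2 := hbal (n + 1) hn
      rw [inflow, if_neg (by omega), Nat.add_sub_cancel, hjump] at h2
      rw [Finset.sum_range_succ _ n, Finset.sum_range_succ _ (n + 1),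
        Finset.sum_range_succ _ (n + 1)]
      linarith
  -- The initial inflow consumes half of the energy at time 0, which the left side supplies; jumps
  -- and dissipation are dropped.
  have hend : ∀ n < D.N, normL2Sq D.mesh (u n (D.t (n + 1))) ≤ ‖u₀‖ ^ 2 + 2 * (Λ * A * F) := by
    intro n hn
    have h1 := hglobal n hn
    have h2 : 0 ≤ ∑ m ∈ Finset.range (n + 1), dissipation D ℓ ν σ cS w u m :=
      Finset.sum_nonneg fun m hm => hdiss m (by rw [Finset.mem_range] at hm; omega)
    have h3 : 0 ≤ ∑ m ∈ Finset.range n,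
        normL2Sq D.mesh (u m (D.t (m + 1)) - u (m + 1) (D.t (m + 1))) :=
      Finset.sum_nonneg fun _ _ => normL2Sq_nonneg _
    have h4 := mul_le_mul_of_nonneg_left (hGle (n + 1) hn) hΛA
    linarith
  have hinflow : ∀ n < D.N, inflow D u₀ u n ≤
      (‖u₀‖ ^ 2 + 2 * (Λ * A * F)) / 2 + normL2Sq D.mesh (u n (D.t n)) / 2 := by
    intro n hn
    have h0 : 0 ≤ Λ * A * F := mul_nonneg hΛA hF0
    rcases n with _ | n
    · linarith
    · have h1 := hend n (by omega)
      have h2 := (le_abs_self _).trans (bilin_cauchy hB innerL2_comm hBpos (u n (D.t (n + 1)))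
        (u (n + 1) (D.t (n + 1))))
      rw [innerL2_self, innerL2_self] at h2
      rw [inflow, if_neg (by omega), Nat.add_sub_cancel]
      linarith
  -- the linear weight controls the values inside a slab
  have hmean : ∀ n < D.N, (D.t (n + 1) - D.t n)⁻¹ *
      ∫ s in (D.t n)..(D.t (n + 1)), normL2Sq D.mesh (u n s) ≤
        ‖u₀‖ ^ 2 + 4 * (Λ * A * F) := by
    intro n hn
    have hab := D.t_lt n hn
    set τ := D.t (n + 1) - D.t n with hτ
    have hτ0 : 0 < τ := sub_pos.2 hab
    have hθ : ∀ r, τ⁻¹ * D.t (n + 1) + -τ⁻¹ * r = (D.t (n + 1) - r) / τ := fun r => by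
      field_simp; ring
    have hθ01 : ∀ i, 0 ≤ τ⁻¹ * D.t (n + 1) + -τ⁻¹ * D.node ℓ n i ∧
        τ⁻¹ * D.t (n + 1) + -τ⁻¹ * D.node ℓ n i ≤ 1 := by
      intro i
      have := slabNode_mem ℓ hab i
      rw [← node_eq_slabNode] at this
      rw [hθ, div_le_one hτ0]
      exact ⟨div_nonneg (by linarith [this.2]) hτ0.le, by linarith [this.1]⟩
    -- This weight is 1 at the left end and 0 at the right end. The derivative and the jump together
    -- leave half of the energy at the left end, which cancels the half in the bound for the inflow;
    -- what remains is half of the mean.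
    have h1 := hu.slab_identity hd hw hn (τ⁻¹ * D.t (n + 1)) (-τ⁻¹)
    have h2 := (le_abs_self _).trans (abs_integral_pairing_le hM hT hf hn
      (hinterp n hn (fun r => τ⁻¹ * D.t (n + 1) + -τ⁻¹ * r) fun i => by
        rw [abs_of_nonneg (hθ01 i).1]; exact (hθ01 i).2))
    rw [← h1, hθ (D.t n), hθ (D.t (n + 1)), ← hτ, sub_self, zero_div, div_self hτ0.ne'] at h2
    have h3 : 0 ≤ ∑ i, D.weight ℓ n i * ((τ⁻¹ * D.t (n + 1) + -τ⁻¹ * D.node ℓ n i) *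
          (ν * penaltyForm D.orient σ (u n (D.node ℓ n i)) (u n (D.node ℓ n i)) +
            1 / 2 * convUpwind D.orient cS (w n (D.node ℓ n i)) (u n (D.node ℓ n i))
              (u n (D.node ℓ n i)))) :=
      Finset.sum_nonneg fun i _ => mul_nonneg (D.weight_nonneg hn i)
        (mul_nonneg (hθ01 i).1 (hdens n hn i))
    have h4 := hinflow n hn
    have h5 : Λ * A * G n ≤ Λ * A * F := by
      refine mul_le_mul_of_nonneg_left ?_ hΛA
      rw [← hGF]
      exact Finset.single_le_sum (f := G) (fun m hm => hG0 m (Finset.mem_range.1 hm))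
        (Finset.mem_range.2 hn)
    have h6 : Λ * A * ∫ s in (D.t n)..(D.t (n + 1)), ‖f s‖ = Λ * A * G n := rfl
    rw [h6] at h2
    linarith
  -- The mean over the slab is exactly the Radau sum, and the term of the maximizing node alone is
  -- at least `κ A²`.
  have hkey : κ * A ^ 2 ≤ ‖u₀‖ ^ 2 + 4 * (Λ * A * F) := by
    refine le_trans ?_ (hmean n₀ hn₀)
    have hab := D.t_lt n₀ hn₀
    have h1 := integral_bilin_eq_sum hab (hup n₀ hn₀) (hup n₀ hn₀) hB
    simp only [innerL2_self] at h1
    have hτ0 := sub_pos.2 hab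
    rw [h1, inv_mul_eq_div, le_div_iff₀ hτ0]
    refine le_trans ?_ (Finset.single_le_sum (f := fun i => (D.t (n₀ + 1) - D.t n₀) *
      radauWeight ℓ i * normL2Sq D.mesh (u n₀ (slabNode ℓ (D.t n₀) (D.t (n₀ + 1)) i)))
      (fun i _ => mul_nonneg (D.weight_nonneg hn₀ i) (normL2Sq_nonneg _)) (Finset.mem_univ i₀))
    rw [hA2, ← node_eq_slabNode]
    have h2 := mul_le_mul_of_nonneg_right (mul_le_mul_of_nonneg_left (hκw i₀) hτ0.le)
      (normL2Sq_nonneg (M := D.mesh) (u n₀ (D.node ℓ n₀ i₀)))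
    linarith
  -- Young's inequality moves `κ A² / 2` to the left. The two coefficients of the data are then
  -- merged into their sum.
  have hA2le : A ^ 2 ≤ (16 * Λ ^ 2 / κ ^ 2 + 2 / κ) * (F ^ 2 + ‖u₀‖ ^ 2) := by
    have h1 : 4 * (Λ * A * F) ≤ κ / 2 * A ^ 2 + 8 * Λ ^ 2 / κ * F ^ 2 := by
      have e : κ / 2 * A ^ 2 + 8 * Λ ^ 2 / κ * F ^ 2 - 4 * (Λ * A * F) =
          (κ * A - 4 * Λ * F) ^ 2 / (2 * κ) := by field_simp; ring
      have : 0 ≤ (κ * A - 4 * Λ * F) ^ 2 / (2 * κ) := by positivity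
      linarith
    have h2 : A ^ 2 ≤ 2 / κ * (‖u₀‖ ^ 2 + 8 * Λ ^ 2 / κ * F ^ 2) := by
      rw [div_mul_eq_mul_div, le_div_iff₀ hκ]
      linarith
    refine h2.trans ?_
    have e : (16 * Λ ^ 2 / κ ^ 2 + 2 / κ) * (F ^ 2 + ‖u₀‖ ^ 2) -
        2 / κ * (‖u₀‖ ^ 2 + 8 * Λ ^ 2 / κ * F ^ 2) =
        2 / κ * F ^ 2 + 16 * Λ ^ 2 / κ ^ 2 * ‖u₀‖ ^ 2 := by field_simp; ring
    have : 0 ≤ 2 / κ * F ^ 2 + 16 * Λ ^ 2 / κ ^ 2 * ‖u₀‖ ^ 2 := by positivity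
    linarith
  -- collecting the terms
  have hlinf : normLinftyL2 D u ^ 2 ≤ Λ ^ 2 * A ^ 2 := by
    rw [← mul_pow]
    exact pow_le_pow_left₀ ENNReal.toReal_nonneg (normLinftyL2_le hΛA hslab) 2
  -- The factor 2 is the loss in coercivity; the upwind part would need only 1.
  have hvisc : ν * viscousNormSq D σ u + upwindSq D ℓ cS w u ≤
      2 * ∑ n ∈ Finset.range D.N, dissipation D ℓ ν σ cS w u n := by
    rw [viscousNormSq_eq_sum hd σ hu.1, upwindSq_eq_sum, Finset.mul_sum, Finset.mul_sum,
      ← Finset.sum_add_distrib]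
    refine Finset.sum_le_sum fun n hn => ?_
    rw [Finset.mem_range] at hn
    rw [dissipation, Finset.mul_sum, Finset.mul_sum, ← Finset.sum_add_distrib]
    refine Finset.sum_le_sum fun i _ => ?_
    have h1 := mul_le_mul_of_nonneg_left (hpen n hn (D.node ℓ n i)) hν.le
    have h2 := convUpwind_self_nonneg D.orient hcS.le (w n (D.node ℓ n i)) (u n (D.node ℓ n i))
    have h3 := mul_le_mul_of_nonneg_left (add_le_add h1 (show 1 / 2 * convUpwind D.orient cS
      (w n (D.node ℓ n i)) (u n (D.node ℓ n i)) (u n (D.node ℓ n i)) ≤ convUpwind D.orient cS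
      (w n (D.node ℓ n i)) (u n (D.node ℓ n i)) (u n (D.node ℓ n i)) by linarith))
      (D.weight_nonneg (ℓ := ℓ) hn i)
    linarith
  obtain ⟨N', hN'⟩ : ∃ N', D.N = N' + 1 := ⟨D.N - 1, by omega⟩
  have hlast := hglobal N' (by omega)
  -- Time 0 is a Radau node of the first slab.
  have hY : normL2Sq D.mesh (u 0 (D.t 0)) ≤ A ^ 2 := by
    have := hnode 0 hN 0
    rwa [node_eq_slabNode, slabNode_zero] at this
  have htime : timeJumpSq D u = 1 / 2 * normL2Sq D.mesh (u N' (D.t (N' + 1))) +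
      1 / 2 * (∑ m ∈ Finset.range N',
        normL2Sq D.mesh (u m (D.t (m + 1)) - u (m + 1) (D.t (m + 1)))) +
      1 / 2 * normL2Sq D.mesh (u 0 (D.t 0)) := by
    rw [timeJumpSq, ← hN', D.t_last, hN', Nat.add_sub_cancel, D.t_zero]
    ring
  rw [← htime, ← hN', hGF] at hlast
  have htime0 := timeJumpSq_nonneg D u
  have hyoung : 2 * (Λ * A * F) ≤ A ^ 2 + Λ ^ 2 * F ^ 2 := by
    have h1 := two_mul_le_add_sq A (Λ * F)
    have e : 2 * A * (Λ * F) = 2 * (Λ * A * F) := by ring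
    rwa [mul_pow, e] at h1
  -- The sum of time jumps and dissipation is at most the initial inflow plus `Λ A F`. Doubling this
  -- bound adds `‖u₀‖² + A²` from the inflow and `A² + Λ² F²` from Young, besides `Λ² A²` from the
  -- supremum norm.
  have htotal : energyNormSq D ℓ ν σ cS w u ≤ (Λ ^ 2 + 2) * A ^ 2 + ‖u₀‖ ^ 2 + Λ ^ 2 * F ^ 2 := by
    rw [energyNormSq]
    linarith only [hlinf, hvisc, hlast, hyoung, htime0, hinflow0, hY]
  refine htotal.trans ?_
  have h1 := mul_le_mul_of_nonneg_left hA2le (by positivity : 0 ≤ Λ ^ 2 + 2)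
  have h2 : 0 ≤ F ^ 2 + Λ ^ 2 * ‖u₀‖ ^ 2 := by positivity
  linarith only [h1, h2]

end Energy

end OseenDG

/-- Continuous dependence on the data for the linearized space-time DG problem. The constant `C`
depends only on `ℓ`; the penalty parameter is large enough when `σ₀ ≤ σ`, for a threshold that
depends only on the dimension, the elements, the degree `k` and the shape regularity `ρ`. -/
theorem proposition3p4 (ℓ : ℕ) :
    ∃ C : ℝ, 0 < C ∧
      ∀ (d : ℕ), (d = 2 ∨ d = 3) →
      ∀ (fam : VelocityFamily) (k : ℕ), 1 ≤ k →
      ∀ (ρ : ℝ),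
      ∃ σ₀ : ℝ, 0 < σ₀ ∧
        ∀ (Ω : Set (Pt d)) (T : ℝ) (D : SpaceTimeMesh d T) (ν cS σ : ℝ),
          0 < T → 0 < ν → 0 < cS → σ₀ ≤ σ →
          D.mesh.IsMeshOf Ω → D.mesh.ShapeRegular ρ →
          ∀ (f : ℝ → MeasureTheory.Lp (Pt d) 2 (MeasureTheory.volume.restrict Ω)),
            MeasureTheory.IntegrableOn f (Set.Ioo 0 T) MeasureTheory.volume →
          ∀ (u₀ : MeasureTheory.Lp (Pt d) 2 (MeasureTheory.volume.restrict Ω))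
            (w u : SpaceTimeField d),
            w ∈ spaceTimeKernel D fam k ℓ →
            IsLinearizedSolution D Ω fam k ℓ ν σ cS f u₀ w u →
            energyNormSq D ℓ ν σ cS w u ≤
              C * ((∫ s in Set.Ioo 0 T, ‖f s‖) ^ 2 + ‖u₀‖ ^ 2) := by
  -- Both constants belong to the reference Radau rule, so `C` is fixed before the dimension, the
  -- elements and the mesh are introduced.
  obtain ⟨Λ, hΛ1, hΛ⟩ := exists_lebesgue_constant ℓ
  obtain ⟨κ, hκ, hκw⟩ := exists_weight_lower_bound ℓ
  refine ⟨(Λ ^ 2 + 2) * (16 * Λ ^ 2 / κ ^ 2 + 2 / κ) + 1 + Λ ^ 2, by positivity, ?_⟩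
  intro d hd fam k _ ρ
  have hd2 : 2 ≤ d := by omega
  obtain ⟨σ₀, hσ₀, hcoer⟩ := exists_penalty_threshold d hd2 fam k ρ
  refine ⟨σ₀, hσ₀, ?_⟩
  intro Ω T D ν cS σ hT hν hcS hσ hM hreg f hf u₀ w u hw hu
  exact energy_estimate hΛ1 hΛ hκ hκw (by omega) hT hν hcS (hσ₀.le.trans hσ) hM
    (hcoer D.mesh D.orient σ hσ hreg) hf hw hu
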